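/- Let $\gamma>0$, let $s\in\mathbb{C}$ with $|s|=1$, and let $\phi,\xi\in\mathbb{C}$ with $|\phi|<1$, $|\xi|<1$. Let $\mathbf{h}\sim\mathcal{CN}_2(\mathbf 0,\boldsymbol\Phi)$ and $\mathbf{n}\sim\mathcal{CN}_2(\mathbf 0,\boldsymbol\Xi)$ be independent circularly symmetric complex Gaussian vectors with covariance matrices $$\boldsymbol\Phi=\begin{bmatrix}1&\phi^*\\ \phi&1\end{bmatrix},\qquad \boldsymbol\Xi=\begin{bmatrix}1&\xi^*\\ \xi&1\end{bmatrix},$$ where $^*$ is complex conjugation. Put $\mathbf{y}=\sqrt{\gamma}\,s\,\mathbf{h}+\mathbf{n}$, and let $\mathbf{r}$ be its one-bit quantization, $r_k=\mathrm{sgn}(\mathrm{Re}\,y_k)+j\,\mathrm{sgn}(\mathrm{Im}\,y_k)$ for $k=1,2$, so that $\mathbf{r}\in\{\pm1\pm j\}^2$ almost surely. Let $\widehat{\mathbf h}_{\rm mmse}(\mathbf r)=\mathbb{E}\{\mathbf h\,|\,\mathbf r\}$ be the minimum mean-square error (MMSE) estimator of $\mathbf h$, and let $\mathrm{MMSE}_2(\gamma,\phi,\xi)=\frac12\mathbb{E}\{\|\mathbf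 h-\widehat{\mathbf h}_{\rm mmse}(\mathbf r)\|^2\}$ be the MMSE per dimension. Define $\beta_{\rm c}=\dfrac{\gamma\phi+\xi}{1+\gamma}$ and $$\kappa_1=\arcsin\frac{\mathrm{Re}\,\beta_{\rm c}}{\sqrt{1-(\mathrm{Im}\,\beta_{\rm c})^2}},\quad \kappa_2=\arcsin\frac{\mathrm{Im}\,\beta_{\rm c}}{\sqrt{1-(\mathrm{Re}\,\beta_{\rm c})^2}},\quad \kappa_3=\arcsin(\sin\kappa_1\sin\kappa_2),$$ $$\kappa_4=\arcsin(\mathrm{Re}\,\beta_{\rm c}),\qquad \kappa_5=\arcsin(\mathrm{Im}\,\beta_{\rm c}),$$ $$\mathcal I_1=\int_0^{|\kappa_4|}\arcsin\sqrt{\frac{|\beta_{\rm c}|^2\cos^2\theta-(\mathrm{Im}\,\beta_{\rm c})^2}{\cos^2\theta-(\mathrm{Im}\,\beta_{\rm c})^2}}\,d\theta,\qquad \mathcal I_2=\int_0^{|\kappa_5|}\arcsin\sqrt{\frac{|\beta_{\rm c}|^2\cos^2\theta-(\mathrm{Re}\,\beta_{\rm c})^2}{\cos^2\theta-(\mathrm{Re}\,\beta_{\rm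 c})^2}}\,d\theta.$$ For $\mathbf r\in\{\pm1\pm j\}^2$ let $\mathbf u(\mathbf r)\in\mathbb{C}^2$ have the entries $$u_1(\mathbf r)=r_2^*\,\mathrm{Re}\,r_1\,\mathrm{Im}\,r_1\,(j\kappa_1-\kappa_2)-r_1^*\,\mathrm{Re}\,r_2\,\mathrm{Im}\,r_2\,\kappa_3,\qquad u_2(\mathbf r)=r_1^*\,\mathrm{Re}\,r_2\,\mathrm{Im}\,r_2\,(\kappa_2+j\kappa_1)+r_2^*\,\mathrm{Re}\,r_1\,\mathrm{Im}\,r_1\,\kappa_3 .$$ Then, for every $\mathbf r\in\{\pm1\pm j\}^2$, the probability $\mathrm{P}(\mathbf r)$ of observing $\mathbf r$ is positive and equals $$\mathrm{P}(\mathbf r)=\frac1{16}+\frac{\kappa_4}{8\pi}\mathrm{Re}(r_1^*r_2)+\frac{\kappa_5}{8\pi}\mathrm{Im}(r_1^*r_2)+\frac{\mathcal I_1-\mathcal I_2}{4\pi^2}\,\mathrm{Re}\,r_1\,\mathrm{Re}\,r_2\,\mathrm{Im}\,r_1\,\mathrm{Im}\,r_2,$$ and the MMSE estimator is $$\widehat{\mathbf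 h}_{\rm mmse}(\mathbf r)=s^*\sqrt{\frac{\gamma}{4\pi(1+\gamma)}}\;\frac{\boldsymbol\Phi}{\mathrm{P}(\mathbf r)}\left(\frac{\mathbf r}{8}+\frac{\mathbf u(\mathbf r)}{4\pi}\right).$$ Consequently, $$\mathrm{MMSE}_2(\gamma,\phi,\xi)=1-\frac{\gamma}{8\pi(1+\gamma)}\sum_{\mathbf r\in\{\pm1\pm j\}^2}\frac{\left\|\boldsymbol\Phi\left(\frac{\mathbf r}{8}+\frac{\mathbf u(\mathbf r)}{4\pi}\right)\right\|^2}{\mathrm{P}(\mathbf r)} .$$ -/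

import Mathlib

open MeasureTheory ProbabilityTheory
open scoped Matrix ComplexConjugate

noncomputable section

namespace OneBitChannel

/-- `X ∼ CN_n(0, Γ)`: the random vector `X` has the circularly symmetric complex normal law with
mean `0` and covariance matrix `Γ`. Its law is Gaussian (on `ℂⁿ` as a real vector space), it is
centered, `E{X X^H} = Γ`, and, by circular symmetry, `E{X X^T} = 0`. -/
structure IsComplexNormal {Ω : Type*} [MeasurableSpace Ω] {n : ℕ}
    (X : Ω → EuclideanSpace ℂ (Fin n)) (Γ : Matrix (Fin n) (Fin n) ℂ) (μ : Measure Ω) : Prop where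
  gaussian : HasGaussianLaw X μ
  mean : ∀ k, ∫ ω, X ω k ∂μ = 0
  covariance : ∀ k l, ∫ ω, X ω k * conj (X ω l) ∂μ = Γ k l
  pseudoCovariance : ∀ k l, ∫ ω, X ω k * X ω l ∂μ = 0

/-- The constant complex correlation matrix: `1` on the diagonal, `c` below it and `c^*` above. -/
def constCorr (n : ℕ) (c : ℂ) : Matrix (Fin n) (Fin n) ℂ :=
  Matrix.of fun k l => if k < l then conj c else if l = k then 1 else c

/-- One-bit quantization of a complex number, `sgn(Re z) + j sgn(Im z)`. -/
def quantize (z : ℂ) : ℂ := ⟨Real.sign z.re, Real.sign z.im⟩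

/-- The alphabet `{±1 ± j}`. -/
def symbols : Finset ℂ := {⟨1, 1⟩, ⟨1, -1⟩, ⟨-1, 1⟩, ⟨-1, -1⟩}

/-- All possible observation vectors, `{±1 ± j}ⁿ`. -/
def observations (n : ℕ) : Finset (Fin n → ℂ) := Fintype.piFinset fun _ => symbols

/-- The one-bit observation `r = Q(y)` of `y = √γ s h + w` (channel `h`, noise `w`, pilot
`√γ s`), taken entrywise. -/
def observe {Ω : Type*} {n : ℕ} (γ : ℝ) (s : ℂ) (h w : Ω → EuclideanSpace ℂ (Fin n))
    (ω : Ω) : Fin n → ℂ :=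
  fun k => quantize (((√γ : ℝ) : ℂ) * s * h ω k + w ω k)

/-- The MMSE estimator `ĥ(ρ) = E{h | r = ρ}`, the mean of `h` under the conditional law given the
event `r = ρ`. -/
def mmseEstimator {Ω : Type*} [MeasurableSpace Ω] {n : ℕ} (μ : Measure Ω)
    (h : Ω → EuclideanSpace ℂ (Fin n)) (r : Ω → Fin n → ℂ) (ρ : Fin n → ℂ) :
    EuclideanSpace ℂ (Fin n) :=
  ∫ ω, h ω ∂(μ[|r ⁻¹' {ρ}])

/-- The MMSE per dimension, `(1/n) E{‖h - ĥ(r)‖²}`. -/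
def mmse {Ω : Type*} [MeasurableSpace Ω] {n : ℕ} (μ : Measure Ω)
    (h : Ω → EuclideanSpace ℂ (Fin n)) (r : Ω → Fin n → ℂ) : ℝ :=
  1 / (n : ℝ) * ∫ ω, ‖h ω - mmseEstimator μ h r (r ω)‖ ^ 2 ∂μ

/-- `β_c = (γ φ + ξ) / (1 + γ)`. -/
def betaC (γ : ℝ) (φ ξ : ℂ) : ℂ := ((γ : ℂ) * φ + ξ) / (1 + (γ : ℂ))

/-- `κ₁`, as a function of `β = β_c`. -/
def kappa1 (β : ℂ) : ℝ := Real.arcsin (β.re / √(1 - β.im ^ 2))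

/-- `κ₂`. -/
def kappa2 (β : ℂ) : ℝ := Real.arcsin (β.im / √(1 - β.re ^ 2))

/-- `κ₃`. -/
def kappa3 (β : ℂ) : ℝ := Real.arcsin (Real.sin (kappa1 β) * Real.sin (kappa2 β))

/-- `κ₄`. -/
def kappa4 (β : ℂ) : ℝ := Real.arcsin β.re

/-- `κ₅`. -/
def kappa5 (β : ℂ) : ℝ := Real.arcsin β.im

/-- The integral `I₁`. -/
def integral1 (β : ℂ) : ℝ :=
  ∫ θ in (0 : ℝ)..|kappa4 β|, Real.arcsin
    (√((‖β‖ ^ 2 * Real.cos θ ^ 2 - β.im ^ 2) / (Real.cos θ ^ 2 - β.im ^ 2)))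

/-- The integral `I₂`. -/
def integral2 (β : ℂ) : ℝ :=
  ∫ θ in (0 : ℝ)..|kappa5 β|, Real.arcsin
    (√((‖β‖ ^ 2 * Real.cos θ ^ 2 - β.re ^ 2) / (Real.cos θ ^ 2 - β.re ^ 2)))

/-- The vector `u(r)`; the entries `r₁, r₂` are `r 0, r 1`. -/
def uVec (β : ℂ) (r : Fin 2 → ℂ) : Fin 2 → ℂ :=
  ![conj (r 1) * ((r 0).re : ℂ) * ((r 0).im : ℂ)
        * (Complex.I * (kappa1 β : ℂ) - (kappa2 β : ℂ))
      - conj (r 0) * ((r 1).re : ℂ) * ((r 1).im : ℂ) * (kappa3 β : ℂ),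
    conj (r 0) * ((r 1).re : ℂ) * ((r 1).im : ℂ)
        * ((kappa2 β : ℂ) + Complex.I * (kappa1 β : ℂ))
      + conj (r 1) * ((r 0).re : ℂ) * ((r 0).im : ℂ) * (kappa3 β : ℂ)]

/-- The explicit expression `P(r)`. -/
def probExpr (β : ℂ) (r : Fin 2 → ℂ) : ℝ :=
  1 / 16 + kappa4 β / (8 * Real.pi) * (conj (r 0) * r 1).re
    + kappa5 β / (8 * Real.pi) * (conj (r 0) * r 1).im
    + (integral1 β - integral2 β) / (4 * Real.pi ^ 2)
        * ((r 0).re * (r 1).re * (r 0).im * (r 1).im)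

/-- The vector `Φ (r / 8 + u(r) / (4π))`, for `Φ` the `2 × 2` matrix with parameter `φ`. -/
def numVec (φ β : ℂ) (r : Fin 2 → ℂ) : EuclideanSpace ℂ (Fin 2) :=
  WithLp.toLp 2 (constCorr 2 φ *ᵥ
    ((1 / 8 : ℂ) • r + (1 / (4 * (Real.pi : ℂ))) • uVec β r))

/-- The explicit estimator `s^* √(γ / (4π(1+γ))) Φ (r / 8 + u(r) / (4π)) / P(r)`. -/
def explicitEstimator (γ : ℝ) (s φ ξ : ℂ) (r : Fin 2 → ℂ) : EuclideanSpace ℂ (Fin 2) :=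
  (conj s * ((√(γ / (4 * Real.pi * (1 + γ))) : ℝ) : ℂ) / (probExpr (betaC γ φ ξ) r : ℂ)) •
    numVec φ (betaC γ φ ξ) r

end OneBitChannel

end

namespace OneBitChannel

open Filter Topology

/-! Dividing the observation by √(1+γ) changes no sign and leaves a pair (z₁, z₂) of unit variance
complex normals with correlation E{z₂ z₁^*} = β_c, whose law is `pairLaw`. Quantization depends only
on the arguments of z₁ and z₂, so everything reduces to integrals of 1, z₁ and z₂ over products of
two quadrants, computed in polar coordinates. All angular densities depend only on ψ = θ₂ - θ₁
through c(ψ) = Re(β e^{-iψ}) = `corr β ψ`.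

Probability. Integrating out the radii gives the density (1-|β|²) `radialJ` c / π². By
`hasDerivAt_halfSqArc'`, this is affine in the second derivative of (π/2 + arcsin c)²/2, so its
integral over a box of side π/2 is a second difference: ((π/2 + arcsin c)² - (arcsin c')²) / (4π²),
taken at the difference of the corners (`integral_density_box`). The stated formula contains I₁ -
I₂, and `integral1_sub_integral2` shows that this equals κ₄² - κ₅²; each integral is evaluated by
Tonelli on a curved triangle. Positivity is |arcsin Im β| < π/2 + arcsin Re β (`abs_arcsin_im_lt`).

First moments. Weighting by either modulus gives an angular density proportional to (1-c)⁻². For the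
decorrelated combination z₁ - β^* z₂ the integrand becomes e^{iθ₁} times a function of ψ and is a
total derivative in θ₁ (`integral_exp_mul_angKernel`). What remains is the integral of 1/(1-c) over
a quarter turn, a sum of three arctangents, which are κ₁, κ₂, κ₃ up to sign, and the constant π/2
(`integral_quarterArc`). Collecting signs yields r/8 + u/(4π) (`setIntegral_cell_decorrelated`).

Channel. The error of the linear regression of h on (z₁, z₂) is uncorrelated with the pair, hence
independent of it, and integrates to 0 over every cell. The regression has coefficient matrix a^* Φ
applied to the decorrelated pair, so the moments of h follow (`setIntegral_channel`). The
mean-square error is then Pythagoras over the finitely many cells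
(`integral_norm_sub_mmseEstimator`). -/

/-! ### Elementary evaluation of the integrals I₁ and I₂. -/

/-- A nonnegative derivative is automatically integrable; the `ENNReal` form lets Tonelli be applied
with no integrability check, although the kernels used may blow up near the boundary. -/
lemma lintegral_Ioo_deriv {g g' : ℝ → ℝ} {a b : ℝ} (hab : a ≤ b)
    (hg : ContinuousOn g (Set.Icc a b)) (hd : ∀ x ∈ Set.Ioo a b, HasDerivAt g (g' x) x)
    (h0 : ∀ x ∈ Set.Ioo a b, 0 ≤ g' x) :
    ∫⁻ x in Set.Ioo a b, ENNReal.ofReal (g' x) = ENNReal.ofReal (g b - g a) := by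
  have hi := intervalIntegral.integrableOn_deriv_of_nonneg hg hd h0
  rw [← ofReal_integral_eq_lintegral_ofReal (hi.mono_set Set.Ioo_subset_Ioc_self)
    ((ae_restrict_iff' measurableSet_Ioo).2 (.of_forall h0)), ← integral_Ioc_eq_integral_Ioo,
    ← intervalIntegral.integral_of_le hab,
    intervalIntegral.integral_eq_sub_of_hasDerivAt_of_le hab hg hd]
  rwa [intervalIntegrable_iff_integrableOn_Ioc_of_le hab]

lemma abs_arcsin (x : ℝ) : |Real.arcsin x| = Real.arcsin |x| := by
  rcases le_total 0 x with h | h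
  · rw [abs_of_nonneg h, abs_of_nonneg (Real.arcsin_nonneg.2 h)]
  · rw [abs_of_nonpos h, abs_of_nonpos (Real.arcsin_nonpos.2 h), Real.arcsin_neg]

lemma le_arcsin_iff_sin_le_of_nonneg {θ x : ℝ} (h0 : 0 ≤ θ) (h2 : θ < Real.pi / 2) :
    θ ≤ Real.arcsin x ↔ Real.sin θ ≤ x :=
  Real.le_arcsin_iff_sin_le' ⟨by linarith [Real.pi_pos], h2.le⟩

lemma lt_arcsin_iff_sin_lt_of_nonneg {θ x : ℝ} (h0 : 0 ≤ θ) (h2 : θ < Real.pi / 2) :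
    θ < Real.arcsin x ↔ Real.sin θ < x :=
  Real.lt_arcsin_iff_sin_lt' ⟨by linarith [Real.pi_pos], h2⟩

/-- The radicand of the integrand of `integral1`, in real coordinates. -/
noncomputable def ratio (q x θ : ℝ) : ℝ :=
  ((x ^ 2 + q ^ 2) * Real.cos θ ^ 2 - q ^ 2) / (Real.cos θ ^ 2 - q ^ 2)

/-- The derivative of `arcsin √(ratio q x θ)` in `x`. -/
noncomputable def ratioKernel (q x θ : ℝ) : ℝ :=
  x * Real.cos θ / (√(1 - x ^ 2 - q ^ 2) * √(x ^ 2 * Real.cos θ ^ 2 - q ^ 2 * Real.sin θ ^ 2))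

lemma sin_lt_cos_bounds {x q θ : ℝ} (hx : 0 ≤ x) (hθ0 : 0 ≤ θ) (hθ : Real.sin θ ≤ x)
    (hθ2 : θ < Real.pi / 2) (hq : x ^ 2 + q ^ 2 < 1) :
    0 < Real.cos θ ∧ 0 ≤ Real.sin θ ∧ q ^ 2 < Real.cos θ ^ 2 := by
  have h1 := Real.cos_pos_of_mem_Ioo ⟨by linarith [Real.pi_pos], hθ2⟩
  have h2 := Real.sin_nonneg_of_nonneg_of_le_pi hθ0 (by linarith [Real.pi_pos])
  refine ⟨h1, h2, ?_⟩
  nlinarith [Real.sin_sq_add_cos_sq θ]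

lemma ratio_eq (q x θ : ℝ) :
    ratio q x θ = (x ^ 2 * Real.cos θ ^ 2 - q ^ 2 * Real.sin θ ^ 2) / (Real.cos θ ^ 2 - q ^ 2) := by
  unfold ratio
  congr 1
  linear_combination q ^ 2 * Real.sin_sq_add_cos_sq θ

/-- This factorization makes the derivative of arcsin √ratio in x an explicit product: the common
denominator cos²θ - q² cancels. -/
lemma one_sub_ratio {q x θ : ℝ} (h : q ^ 2 < Real.cos θ ^ 2) :
    1 - ratio q x θ = (1 - x ^ 2 - q ^ 2) * Real.cos θ ^ 2 / (Real.cos θ ^ 2 - q ^ 2) := by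
  have : Real.cos θ ^ 2 - q ^ 2 ≠ 0 := by linarith
  unfold ratio
  field_simp
  ring

lemma radicand_pos {q x θ : ℝ} (hx : 0 < x) (hθ0 : 0 ≤ θ) (hθ : Real.sin θ ≤ x)
    (hθ2 : θ < Real.pi / 2) (hq : x ^ 2 + q ^ 2 < 1) :
    0 < x ^ 2 * Real.cos θ ^ 2 - q ^ 2 * Real.sin θ ^ 2 := by
  obtain ⟨hc, hs, hqc⟩ := sin_lt_cos_bounds hx.le hθ0 hθ hθ2 hq
  have h1 : Real.sin θ ^ 2 ≤ x ^ 2 := by gcongr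
  have h2 : q ^ 2 * Real.sin θ ^ 2 ≤ q ^ 2 * x ^ 2 := by gcongr
  nlinarith [mul_pos hx hx]

lemma hasDerivAt_arcsin_sqrt_ratio {q x θ : ℝ} (hx : 0 < x) (hθ0 : 0 ≤ θ) (hθ : Real.sin θ ≤ x)
    (hθ2 : θ < Real.pi / 2) (hq : x ^ 2 + q ^ 2 < 1) :
    HasDerivAt (fun x => Real.arcsin √(ratio q x θ)) (ratioKernel q x θ) x := by
  obtain ⟨hc, hs, hqc⟩ := sin_lt_cos_bounds hx.le hθ0 hθ hθ2 hq
  have hN := radicand_pos hx hθ0 hθ hθ2 hq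
  have hE : 0 < Real.cos θ ^ 2 - q ^ 2 := by linarith
  have hD : 0 < 1 - x ^ 2 - q ^ 2 := by linarith
  have hR : 0 < ratio q x θ := by rw [ratio_eq]; positivity
  have hR1 : 0 < 1 - ratio q x θ := by rw [one_sub_ratio hqc]; positivity
  have hd : HasDerivAt (fun x => ratio q x θ)
      (2 * x * Real.cos θ ^ 2 / (Real.cos θ ^ 2 - q ^ 2)) x := by
    unfold ratio
    have := ((((hasDerivAt_id x).pow 2).add_const (q ^ 2)).mul_const
      (Real.cos θ ^ 2)).sub_const (q ^ 2) |>.div_const (Real.cos θ ^ 2 - q ^ 2)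
    simpa using this
  have hlt : √(ratio q x θ) < 1 := by
    rw [Real.sqrt_lt' one_pos]; linarith
  have := (Real.hasDerivAt_arcsin (by linarith [Real.sqrt_nonneg (ratio q x θ)]) hlt.ne).comp x
    (hd.sqrt hR.ne')
  refine this.congr_deriv ?_
  rw [Real.sq_sqrt hR.le, one_sub_ratio hqc, ratio_eq, Real.sqrt_div hN.le,
    Real.sqrt_div (by positivity), Real.sqrt_mul hD.le, Real.sqrt_sq hc.le, ratioKernel]
  have h1 := Real.sq_sqrt hE.le
  have h2 := Real.sqrt_pos.2 hE
  have h3 := Real.sqrt_pos.2 hN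
  have h4 := Real.sqrt_pos.2 hD
  field_simp
  rw [h1]

/-- The kernel is elementary in θ too: with s = sin θ its radicand is x² - (x² + q²) s², which
integrates to an arcsine. -/
lemma hasDerivAt_arcsin_sin_div {q x θ : ℝ} (hx : 0 < x) (hθ0 : 0 ≤ θ) (hθ : Real.sin θ ≤ x)
    (hθ2 : θ < Real.pi / 2) (hq : x ^ 2 + q ^ 2 < 1) :
    HasDerivAt (fun θ => x / (√(1 - x ^ 2 - q ^ 2) * √(x ^ 2 + q ^ 2)) *
      Real.arcsin (√(x ^ 2 + q ^ 2) / x * Real.sin θ)) (ratioKernel q x θ) θ := by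
  obtain ⟨hc, hs, hqc⟩ := sin_lt_cos_bounds hx.le hθ0 hθ hθ2 hq
  have hN := radicand_pos hx hθ0 hθ hθ2 hq
  have hD : 0 < 1 - x ^ 2 - q ^ 2 := by linarith
  have hb : 0 < x ^ 2 + q ^ 2 := by positivity
  have hb' := Real.sqrt_pos.2 hb
  have hbsq := Real.sq_sqrt hb.le
  have hlt : √(x ^ 2 + q ^ 2) / x * Real.sin θ < 1 := by
    calc √(x ^ 2 + q ^ 2) / x * Real.sin θ ≤ √(x ^ 2 + q ^ 2) / x * x := by gcongr
      _ = √(x ^ 2 + q ^ 2) := by field_simp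
      _ < 1 := by rw [Real.sqrt_lt' one_pos]; linarith
  have h0 : 0 ≤ √(x ^ 2 + q ^ 2) / x * Real.sin θ := by positivity
  have := ((Real.hasDerivAt_arcsin (by linarith) hlt.ne).comp θ
    ((Real.hasDerivAt_sin θ).const_mul (√(x ^ 2 + q ^ 2) / x))).const_mul
      (x / (√(1 - x ^ 2 - q ^ 2) * √(x ^ 2 + q ^ 2)))
  refine this.congr_deriv ?_
  have hkey : 1 - (√(x ^ 2 + q ^ 2) / x * Real.sin θ) ^ 2
      = (x ^ 2 * Real.cos θ ^ 2 - q ^ 2 * Real.sin θ ^ 2) / x ^ 2 := by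
    rw [mul_pow, div_pow, hbsq]
    field_simp
    linear_combination -x ^ 2 * Real.sin_sq_add_cos_sq θ
  rw [hkey, Real.sqrt_div hN.le, Real.sqrt_sq hx.le, ratioKernel]
  have h3 := Real.sqrt_pos.2 hN
  have h4 := Real.sqrt_pos.2 hD
  field_simp

lemma hasDerivAt_arcsin_sqrt_sq {q x : ℝ} (hx : 0 < x) (hq : x ^ 2 + q ^ 2 < 1) :
    HasDerivAt (fun x => Real.arcsin √(x ^ 2 + q ^ 2) ^ 2 / 2)
      (x / (√(1 - x ^ 2 - q ^ 2) * √(x ^ 2 + q ^ 2)) * Real.arcsin √(x ^ 2 + q ^ 2)) x := by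
  have hD : 0 < 1 - x ^ 2 - q ^ 2 := by linarith
  have hb : 0 < x ^ 2 + q ^ 2 := by positivity
  have hlt : √(x ^ 2 + q ^ 2) < 1 := by rw [Real.sqrt_lt' one_pos]; linarith
  have h1 : HasDerivAt (fun x : ℝ => x ^ 2 + q ^ 2) (2 * x) x := by
    simpa using ((hasDerivAt_id x).pow 2).add_const (q ^ 2)
  have := (((Real.hasDerivAt_arcsin (by linarith [Real.sqrt_nonneg (x ^ 2 + q ^ 2)]) hlt.ne).comp x
    (h1.sqrt hb.ne')).pow 2).div_const 2
  refine this.congr_deriv ?_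
  have h4 := Real.sqrt_pos.2 hD
  have h5 := Real.sqrt_pos.2 hb
  rw [Real.sq_sqrt hb.le, show 1 - (x ^ 2 + q ^ 2) = 1 - x ^ 2 - q ^ 2 by ring]
  simp only [Function.comp]
  field_simp
  push_cast
  ring

lemma ratioKernel_nonneg {q x θ : ℝ} (hx : 0 ≤ x) (hc : 0 ≤ Real.cos θ) :
    0 ≤ ratioKernel q x θ := by
  unfold ratioKernel; positivity

/-- At the lower endpoint x = sin θ the ratio equals sin²θ, so the primitive takes the value θ
there; this is the θ subtracted from the integrand below. -/
lemma lintegral_ratioKernel_left {p q θ : ℝ} (hθ0 : 0 < θ) (hθ : θ < Real.arcsin p)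
    (hp : 0 ≤ p) (hq : p ^ 2 + q ^ 2 < 1) :
    ∫⁻ x in Set.Ioo (Real.sin θ) p, ENNReal.ofReal (ratioKernel q x θ)
      = ENNReal.ofReal (Real.arcsin √(ratio q p θ) - θ) := by
  have hp1 : p ≤ 1 := by nlinarith [sq_nonneg q]
  have hθ2 : θ < Real.pi / 2 := hθ.trans_le (Real.arcsin_le_pi_div_two p)
  have hsp : Real.sin θ < p := by
    rwa [← lt_arcsin_iff_sin_lt_of_nonneg hθ0.le hθ2]
  have hs : 0 < Real.sin θ := Real.sin_pos_of_pos_of_lt_pi hθ0 (by linarith [Real.pi_pos])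
  have hlt : ∀ x ∈ Set.Icc (Real.sin θ) p, x ^ 2 + q ^ 2 < 1 := fun x hx => by
    have : x ^ 2 ≤ p ^ 2 := by
      have := hs.le.trans hx.1
      gcongr; exact hx.2
    linarith
  have hd : ∀ x ∈ Set.Icc (Real.sin θ) p,
      HasDerivAt (fun x => Real.arcsin √(ratio q x θ)) (ratioKernel q x θ) x := fun x hx =>
    hasDerivAt_arcsin_sqrt_ratio (hs.trans_le hx.1) hθ0.le hx.1 hθ2 (hlt x hx)
  rw [lintegral_Ioo_deriv hsp.le (fun x hx => (hd x hx).continuousAt.continuousWithinAt)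
    (fun x hx => hd x ⟨hx.1.le, hx.2.le⟩) fun x hx => ratioKernel_nonneg (hs.trans hx.1).le
      (Real.cos_nonneg_of_mem_Icc ⟨by linarith [Real.pi_pos], hθ2.le⟩)]
  have h1 := hlt _ ⟨le_rfl, hsp.le⟩
  obtain ⟨-, -, hqc⟩ := sin_lt_cos_bounds hs.le hθ0.le le_rfl hθ2 h1
  have : ratio q (Real.sin θ) θ = Real.sin θ ^ 2 := by
    have : Real.cos θ ^ 2 - q ^ 2 ≠ 0 := by linarith
    rw [ratio_eq]; field_simp
  rw [this, Real.sqrt_sq hs.le, Real.arcsin_sin (by linarith [Real.pi_pos]) hθ2.le]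

lemma lintegral_ratioKernel_right {q x : ℝ} (hx : 0 < x) (hq : x ^ 2 + q ^ 2 < 1) :
    ∫⁻ θ in Set.Ioo 0 (Real.arcsin x), ENNReal.ofReal (ratioKernel q x θ)
      = ENNReal.ofReal (x / (√(1 - x ^ 2 - q ^ 2) * √(x ^ 2 + q ^ 2)) *
          Real.arcsin √(x ^ 2 + q ^ 2)) := by
  have hx1 : x < 1 := by nlinarith [sq_nonneg q]
  have h0 : 0 ≤ Real.arcsin x := Real.arcsin_nonneg.2 hx.le
  have hθ2 : ∀ θ ∈ Set.Icc 0 (Real.arcsin x), θ < Real.pi / 2 := fun θ hθ =>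
    hθ.2.trans_lt (Real.arcsin_lt_pi_div_two.2 hx1)
  have hd : ∀ θ ∈ Set.Icc 0 (Real.arcsin x), HasDerivAt _ (ratioKernel q x θ) θ := fun θ hθ =>
    hasDerivAt_arcsin_sin_div hx hθ.1
      ((le_arcsin_iff_sin_le_of_nonneg hθ.1 (hθ2 θ hθ)).1 hθ.2)
      (hθ2 θ hθ) hq
  rw [lintegral_Ioo_deriv h0 (fun θ hθ => (hd θ hθ).continuousAt.continuousWithinAt)
    (fun θ hθ => hd θ ⟨hθ.1.le, hθ.2.le⟩) fun θ hθ => ratioKernel_nonneg hx.le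
      (Real.cos_nonneg_of_mem_Icc ⟨by linarith [Real.pi_pos, hθ.1],
        (hθ2 θ ⟨hθ.1.le, hθ.2.le⟩).le⟩)]
  rw [Real.sin_arcsin (by linarith) hx1.le, Real.sin_zero, mul_zero, Real.arcsin_zero, mul_zero,
    sub_zero, div_mul_cancel₀ _ hx.ne']

lemma measurable_ratioKernel (q : ℝ) :
    Measurable fun t : ℝ × ℝ => ENNReal.ofReal (ratioKernel q t.2 t.1) := by
  unfold ratioKernel; fun_prop

/-- Both sides are the integral of `ratioKernel` over the region 0 < θ, sin θ < x < p. Integrating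
in x first gives the left side; integrating in θ first gives the derivative of arcsin²√(x² + q²)/2.
-/
lemma lintegral_arcsin_sqrt_ratio {p q : ℝ} (hp : 0 < p) (hq : p ^ 2 + q ^ 2 < 1) :
    ∫⁻ θ in Set.Ioo 0 (Real.arcsin p), ENNReal.ofReal (Real.arcsin √(ratio q p θ) - θ)
      = ENNReal.ofReal (Real.arcsin √(p ^ 2 + q ^ 2) ^ 2 / 2 - Real.arcsin q ^ 2 / 2) := by
  have hp1 : p < 1 := by nlinarith [sq_nonneg q]
  have hlt : ∀ x ∈ Set.Ioo 0 p, x ^ 2 + q ^ 2 < 1 := fun x hx => by nlinarith [hx.1, hx.2]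
  -- The value at x = 0 of the primitive; the sign of q disappears in the square.
  have hsq : Real.arcsin q ^ 2 = Real.arcsin √(0 ^ 2 + q ^ 2) ^ 2 := by
    rw [zero_pow two_ne_zero, zero_add, Real.sqrt_sq_eq_abs]
    rcases abs_choice q with h | h <;> simp [h, Real.arcsin_neg]
  rw [hsq, ← lintegral_Ioo_deriv (g := fun x => Real.arcsin √(x ^ 2 + q ^ 2) ^ 2 / 2) hp.le
    (by fun_prop) (fun x hx => hasDerivAt_arcsin_sqrt_sq hx.1 (hlt x hx)) fun x hx => by
      have := hx.1
      have := Real.arcsin_nonneg.2 (Real.sqrt_nonneg (x ^ 2 + q ^ 2))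
      positivity]
  rw [setLIntegral_congr_fun measurableSet_Ioo
    (fun θ hθ => (lintegral_ratioKernel_left hθ.1 hθ.2 hp.le hq).symm),
    setLIntegral_congr_fun measurableSet_Ioo
    (fun x hx => (lintegral_ratioKernel_right hx.1 (hlt x hx)).symm)]
  let S : Set (ℝ × ℝ) := {t | 0 < t.1 ∧ t.1 < Real.pi / 2 ∧ Real.sin t.1 < t.2 ∧ t.2 < p}
  have hS : MeasurableSet S :=
    (measurableSet_lt measurable_const measurable_fst).inter
      ((measurableSet_lt measurable_fst measurable_const).inter
      ((measurableSet_lt (Real.measurable_sin.comp measurable_fst) measurable_snd).inter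
      (measurableSet_lt measurable_snd measurable_const)))
  let f : ℝ → ℝ → ENNReal := fun θ x =>
    S.indicator (fun t => ENNReal.ofReal (ratioKernel q t.2 t.1)) (θ, x)
  have hf : Measurable (Function.uncurry f) := (measurable_ratioKernel q).indicator hS
  trans ∫⁻ θ, ∫⁻ x, f θ x
  · rw [← lintegral_indicator measurableSet_Ioo]
    congr 1 with θ
    by_cases hθ : θ ∈ Set.Ioo 0 (Real.arcsin p)
    · rw [Set.indicator_of_mem hθ, ← lintegral_indicator measurableSet_Ioo]
      congr 1 with x
      have h2 := hθ.2.trans_le (Real.arcsin_le_pi_div_two p)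
      simp only [f, Set.indicator, S, Set.mem_Ioo, Set.mem_ofPred_eq, hθ.1, h2, true_and]
    · rw [Set.indicator_of_notMem hθ]
      refine (lintegral_eq_zero_of_ae_eq_zero (.of_forall fun x => ?_)).symm
      refine Set.indicator_of_notMem (fun hx => hθ ⟨hx.1, ?_⟩) _
      exact (lt_arcsin_iff_sin_lt_of_nonneg hx.1.le hx.2.1).2
        (hx.2.2.1.trans hx.2.2.2)
  · rw [lintegral_lintegral_swap hf.aemeasurable, ← lintegral_indicator measurableSet_Ioo]
    congr 1 with x
    by_cases hx : x ∈ Set.Ioo 0 p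
    · rw [Set.indicator_of_mem hx, ← lintegral_indicator measurableSet_Ioo]
      congr 1 with θ
      have h2 := Real.arcsin_lt_pi_div_two.2 (hx.2.trans hp1)
      simp only [f, Set.indicator, S, Set.mem_Ioo, Set.mem_ofPred_eq, hx.2, and_true]
      congr 1
      refine propext (Iff.intro (fun h => ⟨h.1, ?_⟩) fun h => ⟨h.1, h.2.trans h2, ?_⟩)
      · exact (lt_arcsin_iff_sin_lt_of_nonneg h.1.le h.2.1).2 h.2.2
      · exact (lt_arcsin_iff_sin_lt_of_nonneg h.1.le (h.2.trans h2)).1 h.2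
    · rw [Set.indicator_of_notMem hx]
      refine lintegral_eq_zero_of_ae_eq_zero (.of_forall fun θ => ?_)
      refine Set.indicator_of_notMem (fun h => hx ⟨?_, h.2.2.2⟩) _
      exact (Real.sin_pos_of_pos_of_lt_pi h.1 (by linarith [Real.pi_pos, h.2.1])).trans h.2.2.1

lemma integral_arcsin_sqrt_ratio {p q : ℝ} (hp : 0 ≤ p) (hq : p ^ 2 + q ^ 2 < 1) :
    ∫ θ in (0 : ℝ)..Real.arcsin p, Real.arcsin √(ratio q p θ)
      = (Real.arcsin p ^ 2 - Real.arcsin q ^ 2 + Real.arcsin √(p ^ 2 + q ^ 2) ^ 2) / 2 := by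
  rcases hp.eq_or_lt with rfl | hp
  · rw [zero_pow two_ne_zero, zero_add, Real.sqrt_sq_eq_abs]
    rcases abs_choice q with h | h <;> simp [h, Real.arcsin_neg]
  have hp1 : p < 1 := by nlinarith [sq_nonneg q]
  have h0 : 0 ≤ Real.arcsin p := Real.arcsin_nonneg.2 hp.le
  have hc : ContinuousOn (fun θ => Real.arcsin √(ratio q p θ)) (Set.Icc 0 (Real.arcsin p)) := by
    refine Real.continuous_arcsin.comp_continuousOn (Real.continuous_sqrt.comp_continuousOn ?_)
    unfold ratio
    refine ContinuousOn.div (by fun_prop) (by fun_prop) fun θ hθ => ?_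
    have hθ2 := hθ.2.trans_lt (Real.arcsin_lt_pi_div_two.2 hp1)
    have := (sin_lt_cos_bounds hp.le hθ.1 ((le_arcsin_iff_sin_le_of_nonneg hθ.1 hθ2).1 hθ.2) hθ2 hq).2.2
    linarith
  have hi : IntervalIntegrable (fun θ => Real.arcsin √(ratio q p θ)) volume 0
      (Real.arcsin p) :=
    ContinuousOn.intervalIntegrable (by rwa [Set.uIcc_of_le h0])
  -- Subtracting θ leaves a nonnegative integrand covered by Tonelli; adding back ∫ θ contributes
  -- arcsin²p / 2.
  have hkey : ∫ θ in (0 : ℝ)..Real.arcsin p, (Real.arcsin √(ratio q p θ) - θ)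
      = Real.arcsin √(p ^ 2 + q ^ 2) ^ 2 / 2 - Real.arcsin q ^ 2 / 2 := by
    have hle : ∀ θ ∈ Set.Ioo 0 (Real.arcsin p), 0 ≤ Real.arcsin √(ratio q p θ) - θ := by
      intro θ hθ
      have hθ2 := hθ.2.trans (Real.arcsin_lt_pi_div_two.2 hp1)
      have hsp := ((lt_arcsin_iff_sin_lt_of_nonneg hθ.1.le hθ2).1 hθ.2).le
      obtain ⟨h1, h2, h3⟩ := sin_lt_cos_bounds hp.le hθ.1.le hsp hθ2 hq
      rw [sub_nonneg, le_arcsin_iff_sin_le_of_nonneg hθ.1.le hθ2]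
      apply Real.le_sqrt_of_sq_le
      rw [ratio_eq, le_div_iff₀ (by linarith)]
      have : Real.sin θ ^ 2 ≤ p ^ 2 := by gcongr
      nlinarith [mul_pos h1 h1]
    have hi' := ((intervalIntegrable_iff_integrableOn_Ioo_of_le h0).1
      (hi.sub (continuous_id.intervalIntegrable _ _)))
    rw [intervalIntegral.integral_of_le h0, integral_Ioc_eq_integral_Ioo,
      integral_eq_lintegral_of_nonneg_ae ((ae_restrict_iff' measurableSet_Ioo).2 (.of_forall hle))
        hi'.aestronglyMeasurable, lintegral_arcsin_sqrt_ratio hp hq, ENNReal.toReal_ofReal]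
    have : Real.arcsin q ^ 2 ≤ Real.arcsin √(p ^ 2 + q ^ 2) ^ 2 := by
      rw [← sq_abs, abs_arcsin]
      have := Real.arcsin_nonneg.2 (abs_nonneg q)
      have := Real.abs_le_sqrt (show q ^ 2 ≤ p ^ 2 + q ^ 2 by linarith [sq_nonneg p])
      gcongr
    linarith
  rw [intervalIntegral.integral_sub hi (continuous_id'.intervalIntegrable _ _), integral_id] at hkey
  linarith

lemma sq_norm_eq (β : ℂ) : ‖β‖ ^ 2 = β.re ^ 2 + β.im ^ 2 := by
  rw [Complex.sq_norm, Complex.normSq_apply]; ring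

/-- The difference of the two integrals is elementary. -/
lemma integral1_sub_integral2 {β : ℂ} (hβ : ‖β‖ < 1) :
    integral1 β - integral2 β = kappa4 β ^ 2 - kappa5 β ^ 2 := by
  have hlt : β.re ^ 2 + β.im ^ 2 < 1 := by
    rw [← sq_norm_eq]; nlinarith [norm_nonneg β]
  have h1 : integral1 β = (kappa4 β ^ 2 - kappa5 β ^ 2 + Real.arcsin ‖β‖ ^ 2) / 2 := by
    have := integral_arcsin_sqrt_ratio (p := |β.re|) (q := β.im) (abs_nonneg _) (by simpa)
    rw [← abs_arcsin, sq_abs, sq_abs, ← sq_norm_eq, Real.sqrt_sq (norm_nonneg β)] at this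
    simpa [integral1, kappa4, kappa5, ratio, sq_norm_eq β] using this
  have h2 : integral2 β = (kappa5 β ^ 2 - kappa4 β ^ 2 + Real.arcsin ‖β‖ ^ 2) / 2 := by
    have := integral_arcsin_sqrt_ratio (p := |β.im|) (q := β.re) (abs_nonneg _)
      (by rw [sq_abs]; linarith)
    rw [← abs_arcsin, sq_abs, sq_abs, add_comm (β.im ^ 2), ← sq_norm_eq,
      Real.sqrt_sq (norm_nonneg β)] at this
    simpa [integral2, kappa4, kappa5, ratio, sq_norm_eq β, add_comm (β.im ^ 2)] using this
  rw [h1, h2]; ring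

/-! ### Radial integrals of the Gaussian pair. -/

lemma lintegral_Ioi_deriv {g g' : ℝ → ℝ} {a l : ℝ} (hd : ∀ x ∈ Set.Ici a, HasDerivAt g (g' x) x)
    (h0 : ∀ x ∈ Set.Ioi a, 0 ≤ g' x) (hl : Tendsto g atTop (𝓝 l)) :
    ∫⁻ x in Set.Ioi a, ENNReal.ofReal (g' x) = ENNReal.ofReal (l - g a) := by
  have hc := (hd a Set.self_mem_Ici).continuousAt.continuousWithinAt (s := Set.Ici a)
  have hd' : ∀ x ∈ Set.Ioi a, HasDerivAt g (g' x) x := fun x hx => hd x (Set.Ioi_subset_Ici_self hx)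
  rw [← ofReal_integral_eq_lintegral_ofReal (integrableOn_Ioi_deriv_of_nonneg hc hd' h0 hl)
    ((ae_restrict_iff' measurableSet_Ioi).2 (.of_forall h0)),
    integral_Ioi_of_hasDerivAt_of_nonneg hc hd' h0 hl]

lemma lintegral_pow_mul_exp_neg_mul_sq (n : ℕ) {k : ℝ} (hk : 0 < k) :
    ∫⁻ x in Set.Ioi (0 : ℝ), ENNReal.ofReal (x ^ n * Real.exp (-k * x ^ 2))
      = ENNReal.ofReal (k ^ (-((n : ℝ) + 1) / 2) * (1 / 2) * Real.Gamma (((n : ℝ) + 1) / 2)) := by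
  have hn : (-1 : ℝ) < n := by have := n.cast_nonneg (α := ℝ); linarith
  have h1 := integral_rpow_mul_exp_neg_mul_rpow (p := 2) (q := n) two_pos hn hk
  have h2 := integrableOn_rpow_mul_exp_neg_mul_rpow (p := 2) hn two_pos hk
  simp only [Real.rpow_natCast, Real.rpow_two] at h1 h2
  rw [← h1, ofReal_integral_eq_lintegral_ofReal h2]
  refine (ae_restrict_iff' measurableSet_Ioi).2 (.of_forall fun x hx => ?_)
  have : 0 < x := hx
  positivity

lemma lintegral_pow_three_mul_exp_neg_mul_sq {k : ℝ} (hk : 0 < k) :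
    ∫⁻ x in Set.Ioi (0 : ℝ), ENNReal.ofReal (x ^ 3 * Real.exp (-k * x ^ 2))
      = ENNReal.ofReal (1 / (2 * k ^ 2)) := by
  rw [lintegral_pow_mul_exp_neg_mul_sq 3 hk]
  norm_num [Real.Gamma_two]

lemma lintegral_pow_four_mul_exp_neg_mul_sq {k : ℝ} (hk : 0 < k) :
    ∫⁻ x in Set.Ioi (0 : ℝ), ENNReal.ofReal (x ^ 4 * Real.exp (-k * x ^ 2))
      = ENNReal.ofReal (3 * √Real.pi / (8 * (k ^ 2 * √k))) := by
  rw [lintegral_pow_mul_exp_neg_mul_sq 4 hk]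
  have hG : Real.Gamma ((((4 : ℕ) : ℝ) + 1) / 2) = 3 / 4 * √Real.pi := by
    rw [show (((4 : ℕ) : ℝ) + 1) / 2 = 1 / 2 + 1 + 1 by norm_num, Real.Gamma_add_one (by norm_num),
      Real.Gamma_add_one (by norm_num), Real.Gamma_one_half_eq]
    ring
  have hk2 : k ^ (-(((4 : ℕ) : ℝ) + 1) / 2) = (k ^ 2 * √k)⁻¹ := by
    rw [show -(((4 : ℕ) : ℝ) + 1) / 2 = -(2 + 1 / 2) by norm_num, Real.rpow_neg hk.le,
      Real.rpow_add hk, Real.rpow_two, ← Real.sqrt_eq_rpow]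
  rw [hG, hk2]
  congr 1
  field_simp
  norm_num

lemma lintegral_Ioi_comp_mul {a : ℝ} (ha : 0 < a) (f : ℝ → ENNReal) :
    ∫⁻ x in Set.Ioi (0 : ℝ), f x = ∫⁻ t in Set.Ioi (0 : ℝ), ENNReal.ofReal a * f (a * t) := by
  have h := lintegral_image_eq_lintegral_abs_deriv_mul (s := Set.Ioi (0 : ℝ)) (f := fun t => a * t)
    (f' := fun _ => a) measurableSet_Ioi
    (fun x _ => by simpa using ((hasDerivAt_id x).const_mul a).hasDerivWithinAt)
    (fun x _ y _ h => mul_left_cancel₀ ha.ne' h) f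
  rw [abs_of_pos ha] at h
  rw [← h]
  congr 2
  ext x
  simp only [Set.mem_Ioi, Set.mem_image]
  exact ⟨fun hx => ⟨x / a, div_pos hx ha, by field_simp⟩, by rintro ⟨t, ht, rfl⟩; positivity⟩

/-- The substitution y = x t turns the quadratic form into x² (1 + t² - 2ct), so the x-integral is a
Gamma integral. The exponent rises by two: one factor x from y, one from the Jacobian. -/
lemma lintegral_radial_eq (D c : ℝ) (n : ℕ) :
    ∫⁻ x in Set.Ioi (0 : ℝ), ∫⁻ y in Set.Ioi (0 : ℝ),
        ENNReal.ofReal (x ^ n * y * Real.exp (-(x ^ 2 + y ^ 2 - 2 * c * (x * y)) / D))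
      = ∫⁻ t in Set.Ioi (0 : ℝ), ENNReal.ofReal t * ∫⁻ x in Set.Ioi (0 : ℝ),
        ENNReal.ofReal (x ^ (n + 2) * Real.exp (-((1 + t ^ 2 - 2 * c * t) / D) * x ^ 2)) := by
  have h1 : ∀ x ∈ Set.Ioi (0 : ℝ), ∫⁻ y in Set.Ioi (0 : ℝ),
        ENNReal.ofReal (x ^ n * y * Real.exp (-(x ^ 2 + y ^ 2 - 2 * c * (x * y)) / D))
      = ∫⁻ t in Set.Ioi (0 : ℝ), ENNReal.ofReal t *
        ENNReal.ofReal (x ^ (n + 2) * Real.exp (-((1 + t ^ 2 - 2 * c * t) / D) * x ^ 2)) := by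
    intro x hx
    have hx' : (0 : ℝ) < x := hx
    rw [lintegral_Ioi_comp_mul hx]
    refine setLIntegral_congr_fun measurableSet_Ioi fun t ht => ?_
    have ht' : (0 : ℝ) < t := ht
    rw [← ENNReal.ofReal_mul hx'.le, ← ENNReal.ofReal_mul ht'.le]
    congr 1
    rw [show -(x ^ 2 + (x * t) ^ 2 - 2 * c * (x * (x * t))) / D
      = -((1 + t ^ 2 - 2 * c * t) / D) * x ^ 2 by ring]
    ring
  rw [setLIntegral_congr_fun measurableSet_Ioi h1, lintegral_lintegral_swap]
  · refine setLIntegral_congr_fun measurableSet_Ioi fun t ht => ?_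
    rw [lintegral_const_mul]
    fun_prop
  · fun_prop

lemma quadratic_eq (c t : ℝ) : 1 + t ^ 2 - 2 * c * t = (t - c) ^ 2 + (1 - c ^ 2) := by ring

lemma hasDerivAt_quadratic (c t : ℝ) :
    HasDerivAt (fun t => 1 + t ^ 2 - 2 * c * t) (2 * (t - c)) t := by
  have := (((hasDerivAt_id t).pow 2).const_add 1).sub ((hasDerivAt_id t).const_mul (2 * c))
  refine this.congr_deriv ?_
  simp; ring

lemma tendsto_quadratic (c : ℝ) : Tendsto (fun t : ℝ => 1 + t ^ 2 - 2 * c * t) atTop atTop := by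
  simp_rw [quadratic_eq]
  exact tendsto_atTop_add_const_right _ _ ((tendsto_pow_atTop two_ne_zero).comp
    (tendsto_atTop_add_const_right _ (-c) tendsto_id))

lemma tendsto_arctan_shift (c : ℝ) {e : ℝ} (he : 0 < e) :
    Tendsto (fun t => Real.arctan ((t - c) / e)) atTop (𝓝 (Real.pi / 2)) :=
  (tendsto_nhds_of_tendsto_nhdsWithin Real.tendsto_arctan_atTop).comp
    ((tendsto_atTop_add_const_right _ (-c) tendsto_id).atTop_div_const he)

/-- Read as a sine of an arctangent, the quotient has an evident limit at infinity. -/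
lemma div_sqrt_quadratic_eq {c : ℝ} (hc : 0 < 1 - c ^ 2) (t : ℝ) :
    (t - c) / √(1 + t ^ 2 - 2 * c * t) = Real.sin (Real.arctan ((t - c) / √(1 - c ^ 2))) := by
  have he := Real.sqrt_pos.2 hc
  rw [Real.sin_arctan, div_pow, Real.sq_sqrt hc.le,
    show 1 + (t - c) ^ 2 / (1 - c ^ 2) = (1 + t ^ 2 - 2 * c * t) / (1 - c ^ 2) by
      field_simp; ring, Real.sqrt_div' _ hc.le]
  field_simp

lemma tendsto_div_sqrt_quadratic {c : ℝ} (hc : 0 < 1 - c ^ 2) :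
    Tendsto (fun t => (t - c) / √(1 + t ^ 2 - 2 * c * t)) atTop (𝓝 1) := by
  rw [funext (div_sqrt_quadratic_eq hc)]
  have := (Real.continuous_sin.tendsto _).comp (tendsto_arctan_shift c (Real.sqrt_pos.2 hc))
  rwa [Real.sin_pi_div_two] at this

/-- The radial integral that gives the density of the two arguments. -/
noncomputable def radialJ (c : ℝ) : ℝ :=
  (1 / (1 - c ^ 2) + c * (Real.pi / 2 + Real.arcsin c) / √(1 - c ^ 2) ^ 3) / 4

lemma lintegral_radial_one {D c : ℝ} (hD : 0 < D) (hc : 0 < 1 - c ^ 2) :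
    ∫⁻ x in Set.Ioi (0 : ℝ), ∫⁻ y in Set.Ioi (0 : ℝ),
        ENNReal.ofReal (x * y * Real.exp (-(x ^ 2 + y ^ 2 - 2 * c * (x * y)) / D))
      = ENNReal.ofReal (D ^ 2 * radialJ c) := by
  have h := lintegral_radial_eq D c 1
  simp only [pow_one] at h
  have hq : ∀ t : ℝ, 0 < 1 + t ^ 2 - 2 * c * t := fun t => by rw [quadratic_eq]; positivity
  rw [h]
  have h1 : ∀ t ∈ Set.Ioi (0 : ℝ), ENNReal.ofReal t * ∫⁻ x in Set.Ioi (0 : ℝ),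
        ENNReal.ofReal (x ^ (1 + 2) * Real.exp (-((1 + t ^ 2 - 2 * c * t) / D) * x ^ 2))
      = ENNReal.ofReal (D ^ 2 / 2 * (t / (1 + t ^ 2 - 2 * c * t) ^ 2)) := by
    intro t ht
    have := hq t
    rw [lintegral_pow_three_mul_exp_neg_mul_sq (div_pos this hD),
      ← ENNReal.ofReal_mul (le_of_lt ht)]
    congr 1
    field_simp
  have he := Real.sqrt_pos.2 hc
  have hesq := Real.sq_sqrt hc.le
  set e := √(1 - c ^ 2) with he_def
  -- With q = 1 + t² - 2ct = (t-c)² + e², split t/q² = (t-c)/q² + c/q². The first part integrates to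
  -- -1/(2q), the second is the standard primitive of 1/((t-c)² + e²)².
  rw [setLIntegral_congr_fun measurableSet_Ioi h1, lintegral_Ioi_deriv
    (g := fun t => D ^ 2 / 2 * (-(1 / (2 * (1 + t ^ 2 - 2 * c * t))) +
      c * ((t - c) / (2 * e ^ 2 * (1 + t ^ 2 - 2 * c * t)) +
        Real.arctan ((t - c) / e) / (2 * e ^ 3))))
    (l := D ^ 2 / 2 * (-0 + c * (0 + Real.pi / 2 / (2 * e ^ 3))))]
  · rw [radialJ, ← he_def, Real.arcsin_eq_arctan (x := c)
      ⟨by nlinarith, by nlinarith⟩, ← he_def]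
    congr 1
    simp only [zero_sub, neg_div, Real.arctan_neg]
    rw [← hesq]
    field_simp
    linear_combination 8 * e * hesq
  · intro t _
    have hq' := hq t
    have hq0 := hasDerivAt_quadratic c t
    have ha : HasDerivAt (fun t => Real.arctan ((t - c) / e)) _ t :=
      (((hasDerivAt_id t).sub_const c).div_const e).arctan
    have := (((((hq0.const_mul 2).inv (by positivity)).neg).add
      (((((hasDerivAt_id t).sub_const c).div (hq0.const_mul (2 * e ^ 2)) (by positivity)).add
        (ha.div_const (2 * e ^ 3))).const_mul c)).const_mul (D ^ 2 / 2))
    simp only [← one_div] at this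
    refine this.congr_deriv ?_
    have h3 : 1 + ((t - c) / e) ^ 2 = (1 + t ^ 2 - 2 * c * t) / e ^ 2 := by
      rw [quadratic_eq, ← hesq]; field_simp; ring
    simp only [id]
    rw [h3]
    field_simp
    rw [hesq]
    ring
  · intro t ht
    have : (0 : ℝ) < t := ht
    positivity
  · have hi := (tendsto_quadratic c).inv_tendsto_atTop
    refine Tendsto.const_mul _ (Tendsto.add (Tendsto.neg ?_) (Tendsto.const_mul _
      (Tendsto.add ?_ ((tendsto_arctan_shift c he).div_const _))))
    · have := hi.const_mul (1 / 2)
      simp only [mul_zero] at this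
      refine this.congr fun t => ?_
      simp only [Pi.inv_apply]; field_simp
    · have := (((tendsto_div_sqrt_quadratic hc).mul
        (Real.tendsto_sqrt_atTop.comp (tendsto_quadratic c)).inv_tendsto_atTop)).const_mul
          (1 / (2 * e ^ 2))
      simp only [mul_zero] at this
      refine this.congr fun t => ?_
      have h5 := Real.sqrt_pos.2 (hq t)
      have h6 := Real.sq_sqrt (hq t).le
      simp only [Pi.inv_apply, Function.comp]
      rw [← h6, Real.sqrt_sq h5.le]
      field_simp

lemma lintegral_radial_two {D c : ℝ} (hD : 0 < D) (hc : 0 < 1 - c ^ 2) :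
    ∫⁻ x in Set.Ioi (0 : ℝ), ∫⁻ y in Set.Ioi (0 : ℝ),
        ENNReal.ofReal (x ^ 2 * y * Real.exp (-(x ^ 2 + y ^ 2 - 2 * c * (x * y)) / D))
      = ENNReal.ofReal (D ^ 2 * √D * (√Real.pi / 8) / (1 - c) ^ 2) := by
  have hq : ∀ t : ℝ, 0 < 1 + t ^ 2 - 2 * c * t := fun t => by rw [quadratic_eq]; positivity
  rw [lintegral_radial_eq D c 2]
  have h1 : ∀ t ∈ Set.Ioi (0 : ℝ), ENNReal.ofReal t * ∫⁻ x in Set.Ioi (0 : ℝ),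
        ENNReal.ofReal (x ^ (2 + 2) * Real.exp (-((1 + t ^ 2 - 2 * c * t) / D) * x ^ 2))
      = ENNReal.ofReal (D ^ 2 * √D * (3 * √Real.pi / 8) *
        (t / ((1 + t ^ 2 - 2 * c * t) ^ 2 * √(1 + t ^ 2 - 2 * c * t)))) := by
    intro t ht
    have := hq t
    rw [lintegral_pow_four_mul_exp_neg_mul_sq (div_pos this hD),
      ← ENNReal.ofReal_mul (le_of_lt ht), Real.sqrt_div this.le]
    congr 1
    have h5 := Real.sqrt_pos.2 this
    have h6 := Real.sqrt_pos.2 hD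
    field_simp
  -- The same split for t/q^{5/2}. Here the primitive is algebraic, and the boundary values collapse
  -- to 1/(3(1-c)²), because (1+c)² cancels against (1-c²)².
  rw [setLIntegral_congr_fun measurableSet_Ioi h1, lintegral_Ioi_deriv
    (g := fun t => D ^ 2 * √D * (3 * √Real.pi / 8) *
      (-(1 / (3 * ((1 + t ^ 2 - 2 * c * t) * √(1 + t ^ 2 - 2 * c * t)))) +
      c * ((t - c) / (3 * (1 - c ^ 2) * ((1 + t ^ 2 - 2 * c * t) * √(1 + t ^ 2 - 2 * c * t))) +
        2 / (3 * (1 - c ^ 2) ^ 2) * ((t - c) / √(1 + t ^ 2 - 2 * c * t)))))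
    (l := D ^ 2 * √D * (3 * √Real.pi / 8) * (-0 + c * (0 + 2 / (3 * (1 - c ^ 2) ^ 2) * 1)))]
  · congr 1
    have h2 : 1 - c ≠ 0 := fun h => by rw [show c = 1 by linarith] at hc; norm_num at hc
    have h3 : 1 - c ^ 2 ≠ 0 := hc.ne'
    norm_num
    field_simp
    ring
  · intro t _
    have hq' := hq t
    have hq0 := hasDerivAt_quadratic c t
    have hs := hq0.sqrt hq'.ne'
    have h5 := Real.sqrt_pos.2 hq'
    have h6 := Real.sq_sqrt hq'.le
    have hl := (hasDerivAt_id t).sub_const c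
    have := (((((hq0.mul hs).const_mul 3).inv
      (mul_pos three_pos (mul_pos hq' h5)).ne').neg).add
      (((hl.div ((hq0.mul hs).const_mul (3 * (1 - c ^ 2)))
      (mul_pos (mul_pos three_pos hc) (mul_pos hq' h5)).ne').add
        ((hl.div hs h5.ne').const_mul (2 / (3 * (1 - c ^ 2) ^ 2)))).const_mul c)).const_mul
          (D ^ 2 * √D * (3 * √Real.pi / 8))
    simp only [← one_div] at this
    refine this.congr_deriv ?_
    have h3 : 1 - c ^ 2 ≠ 0 := hc.ne'
    simp only [id, Pi.mul_apply]
    set s := √(1 + t ^ 2 - 2 * c * t)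
    rw [← h6]
    field_simp
    rw [h6]
    ring
  · intro t ht
    have : (0 : ℝ) < t := ht
    have := hq t
    positivity
  · have hi := (tendsto_quadratic c).inv_tendsto_atTop
    have hs := (Real.tendsto_sqrt_atTop.comp (tendsto_quadratic c)).inv_tendsto_atTop
    have hr := tendsto_div_sqrt_quadratic hc
    refine Tendsto.const_mul _ (Tendsto.add (Tendsto.neg ?_) (Tendsto.const_mul _
      (Tendsto.add ?_ (hr.const_mul _))))
    · have := (hi.mul hs).const_mul (1 / 3)
      simp only [mul_zero] at this
      refine this.congr fun t => ?_
      simp only [Pi.inv_apply, Function.comp]; field_simp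
    · have := (hr.mul hi).const_mul (1 / (3 * (1 - c ^ 2)))
      simp only [mul_zero] at this
      refine this.congr fun t => ?_
      simp only [Pi.inv_apply]; field_simp

/-! ### Polar coordinates and the joint law of the two arguments. -/

lemma lintegral_complex_eq_polar {f : ℂ → ENNReal} (hf : Measurable f) :
    ∫⁻ z, f z = ∫⁻ θ in Set.Ioo (-Real.pi) Real.pi, ∫⁻ x in Set.Ioi (0 : ℝ),
      ENNReal.ofReal x * f (x * (Real.cos θ + Real.sin θ * Complex.I)) := by
  rw [← Complex.lintegral_comp_polarCoord_symm, polarCoord_target, Measure.volume_eq_prod,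
    ← Measure.prod_restrict, lintegral_prod_symm]
  · simp only [Complex.polarCoord_symm_apply, smul_eq_mul]
  · simp only [Complex.polarCoord_symm_apply, smul_eq_mul]
    fun_prop

lemma lintegral_complex_prod_eq_polar {f : ℂ × ℂ → ENNReal} (hf : Measurable f) :
    ∫⁻ z, f z = ∫⁻ θ in Set.Ioo (-Real.pi) Real.pi ×ˢ Set.Ioo (-Real.pi) Real.pi,
      ∫⁻ x in Set.Ioi (0 : ℝ), ∫⁻ y in Set.Ioi (0 : ℝ), ENNReal.ofReal (x * y) *
        f (x * (Real.cos θ.1 + Real.sin θ.1 * Complex.I),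
          y * (Real.cos θ.2 + Real.sin θ.2 * Complex.I)) := by
  rw [Measure.volume_eq_prod, lintegral_prod _ hf.aemeasurable,
    lintegral_complex_eq_polar (by fun_prop), Measure.volume_eq_prod, ← Measure.prod_restrict,
    lintegral_prod]
  · refine lintegral_congr fun θ => ?_
    rw [lintegral_lintegral_swap]
    · refine setLIntegral_congr_fun measurableSet_Ioi fun x hx => ?_
      rw [lintegral_complex_eq_polar (by fun_prop), ← lintegral_const_mul]
      · refine lintegral_congr fun θ' => ?_
        rw [← lintegral_const_mul]
        · refine lintegral_congr fun y => ?_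
          rw [ENNReal.ofReal_mul (le_of_lt hx), mul_assoc]
        · fun_prop
      · fun_prop
    · fun_prop
  · fun_prop

/-- The real part of the correlation, rotated by the angle `ψ`. -/
noncomputable def corr (β : ℂ) (ψ : ℝ) : ℝ := β.re * Real.cos ψ + β.im * Real.sin ψ

lemma corr_sq_add (β : ℂ) (ψ : ℝ) :
    corr β ψ ^ 2 + (-β.re * Real.sin ψ + β.im * Real.cos ψ) ^ 2 = ‖β‖ ^ 2 := by
  rw [sq_norm_eq, corr]
  linear_combination (β.re ^ 2 + β.im ^ 2) * Real.sin_sq_add_cos_sq ψ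

lemma one_sub_corr_sq_pos {β : ℂ} (hβ : ‖β‖ < 1) (ψ : ℝ) : 0 < 1 - corr β ψ ^ 2 := by
  have := corr_sq_add β ψ
  nlinarith [norm_nonneg β, sq_nonneg (-β.re * Real.sin ψ + β.im * Real.cos ψ)]

lemma one_sub_corr_pos {β : ℂ} (hβ : ‖β‖ < 1) (ψ : ℝ) : 0 < 1 - corr β ψ := by
  nlinarith [one_sub_corr_sq_pos hβ ψ]

/-- The joint density of a pair of unit variance complex normal variables of correlation `β`. -/
noncomputable def pairDensity (β : ℂ) (z : ℂ × ℂ) : ℝ :=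
  Real.exp (-(‖z.1‖ ^ 2 + ‖z.2‖ ^ 2 - 2 * (conj β * (conj z.1 * z.2)).re) / (1 - ‖β‖ ^ 2))
    / (Real.pi ^ 2 * (1 - ‖β‖ ^ 2))

lemma measurable_pairDensity (β : ℂ) : Measurable (pairDensity β) := by
  unfold pairDensity; fun_prop

/-- The joint law of a pair of unit variance complex normal variables of correlation `β`. -/
noncomputable def pairLaw (β : ℂ) : Measure (ℂ × ℂ) :=
  volume.withDensity fun z => ENNReal.ofReal (pairDensity β z)

lemma pairDensity_polar (β : ℂ) (x y : ℝ) (θ : ℝ × ℝ) :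
    pairDensity β (x * (Real.cos θ.1 + Real.sin θ.1 * Complex.I),
          y * (Real.cos θ.2 + Real.sin θ.2 * Complex.I))
      = Real.exp (-(x ^ 2 + y ^ 2 - 2 * corr β (θ.2 - θ.1) * (x * y)) / (1 - ‖β‖ ^ 2))
        / (Real.pi ^ 2 * (1 - ‖β‖ ^ 2)) := by
  have h : ∀ x θ : ℝ, ‖(x : ℂ) * (Real.cos θ + Real.sin θ * Complex.I)‖ ^ 2 = x ^ 2 := by
    intro x θ
    rw [sq_norm_eq]
    simp [-Complex.ofReal_cos, -Complex.ofReal_sin]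
    linear_combination x ^ 2 * Real.sin_sq_add_cos_sq θ
  unfold pairDensity
  simp only [h]
  congr 5
  rw [corr, Real.cos_sub, Real.sin_sub]
  simp [-Complex.ofReal_cos, -Complex.ofReal_sin]
  ring

lemma arg_polar {x θ : ℝ} (hx : 0 < x) (hθ : θ ∈ Set.Ioo (-Real.pi) Real.pi) :
    Complex.arg (x * (Real.cos θ + Real.sin θ * Complex.I)) = θ := by
  push_cast
  exact Complex.arg_mul_cos_add_sin_mul_I hx ⟨hθ.1, hθ.2.le⟩

lemma norm_polar {x : ℝ} (hx : 0 < x) (θ : ℝ) :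
    ‖(x : ℂ) * (Real.cos θ + Real.sin θ * Complex.I)‖ = x := by
  rw [norm_mul, Complex.norm_real, Real.norm_of_nonneg hx.le]
  push_cast
  rw [Complex.norm_cos_add_sin_mul_I, mul_one]

/-- The law of the two arguments, weighted by a function of the two moduli. -/
lemma map_arg_withDensity {β : ℂ} (w : ℝ → ℝ → ℝ) (hw : Measurable (Function.uncurry w))
    (K : ℝ → ℝ)
    (hK : ∀ ψ, ∫⁻ x in Set.Ioi (0 : ℝ), ∫⁻ y in Set.Ioi (0 : ℝ),
      ENNReal.ofReal (w x y * (x * y *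
        Real.exp (-(x ^ 2 + y ^ 2 - 2 * corr β ψ * (x * y)) / (1 - ‖β‖ ^ 2)))
          / (Real.pi ^ 2 * (1 - ‖β‖ ^ 2))) = ENNReal.ofReal (K ψ))
    (hw0 : ∀ x y, 0 < x → 0 < y → 0 ≤ w x y) :
    ((pairLaw β).withDensity fun z => ENNReal.ofReal (w ‖z.1‖ ‖z.2‖)).map
        (fun z => (z.1.arg, z.2.arg))
      = (volume.restrict (Set.Ioo (-Real.pi) Real.pi ×ˢ Set.Ioo (-Real.pi) Real.pi)).withDensity
        fun θ => ENNReal.ofReal (K (θ.2 - θ.1)) := by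
  have harg : Measurable fun z : ℂ × ℂ => (z.1.arg, z.2.arg) :=
    (Complex.measurable_arg.comp measurable_fst).prodMk (Complex.measurable_arg.comp measurable_snd)
  have hw' : Measurable fun z : ℂ × ℂ => ENNReal.ofReal (w ‖z.1‖ ‖z.2‖) :=
    (hw.comp (measurable_fst.norm.prodMk measurable_snd.norm)).ennreal_ofReal
  have hd := (measurable_pairDensity β).ennreal_ofReal
  ext S hS
  rw [Measure.map_apply harg hS, withDensity_apply _ (harg hS), withDensity_apply _ hS, pairLaw,
    restrict_withDensity (harg hS), lintegral_withDensity_eq_lintegral_mul _ hd hw',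
    ← lintegral_indicator (harg hS), ← lintegral_indicator hS,
    lintegral_complex_prod_eq_polar ((hd.mul hw').indicator (harg hS))]
  refine setLIntegral_congr_fun (measurableSet_Ioo.prod measurableSet_Ioo) fun θ hθ => ?_
  by_cases hS' : θ ∈ S
  · simp only [Set.indicator_of_mem hS']
    rw [← hK]
    refine setLIntegral_congr_fun measurableSet_Ioi fun x hx => ?_
    refine setLIntegral_congr_fun measurableSet_Ioi fun y hy => ?_
    have hx' : (0 : ℝ) < x := hx
    have hy' : (0 : ℝ) < y := hy
    rw [Set.indicator_of_mem]
    · simp only [Pi.mul_apply, pairDensity_polar, norm_polar hx', norm_polar hy']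
      rw [mul_comm (ENNReal.ofReal (Real.exp _ / _)), ← ENNReal.ofReal_mul (hw0 x y hx' hy'),
        ← ENNReal.ofReal_mul (by positivity)]
      congr 1
      ring
    · simpa only [Set.mem_preimage, arg_polar hx' hθ.1, arg_polar hy' hθ.2] using hS'
  · simp only [Set.indicator_of_notMem hS']
    rw [← lintegral_zero (μ := volume.restrict (Set.Ioi (0 : ℝ)))]
    refine setLIntegral_congr_fun measurableSet_Ioi fun x hx => ?_
    rw [← lintegral_zero (μ := volume.restrict (Set.Ioi (0 : ℝ)))]
    refine setLIntegral_congr_fun measurableSet_Ioi fun y hy => ?_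
    rw [Set.indicator_of_notMem, mul_zero]
    have hx' : (0 : ℝ) < x := hx
    have hy' : (0 : ℝ) < y := hy
    simpa only [Set.mem_preimage, arg_polar hx' hθ.1, arg_polar hy' hθ.2] using hS'

lemma one_sub_norm_sq_pos {β : ℂ} (hβ : ‖β‖ < 1) : 0 < 1 - ‖β‖ ^ 2 := by
  nlinarith [norm_nonneg β]

lemma map_arg_pairLaw {β : ℂ} (hβ : ‖β‖ < 1) :
    (pairLaw β).map (fun z => (z.1.arg, z.2.arg))
      = (volume.restrict (Set.Ioo (-Real.pi) Real.pi ×ˢ Set.Ioo (-Real.pi) Real.pi)).withDensity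
        fun θ => ENNReal.ofReal ((1 - ‖β‖ ^ 2) * radialJ (corr β (θ.2 - θ.1)) / Real.pi ^ 2) := by
  have hD := one_sub_norm_sq_pos hβ
  rw [← map_arg_withDensity (β := β) (fun _ _ => 1) (by fun_prop)
    (fun ψ => (1 - ‖β‖ ^ 2) * radialJ (corr β ψ) / Real.pi ^ 2)]
  · simp
  · intro ψ
    simp only [one_mul, div_eq_inv_mul (_ * Real.exp _) _,
      ENNReal.ofReal_mul (inv_nonneg.2 (by positivity : 0 ≤ Real.pi ^ 2 * (1 - ‖β‖ ^ 2)))]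
    rw [lintegral_congr fun x => lintegral_const_mul _ (by fun_prop), lintegral_const_mul _
      (by fun_prop), lintegral_radial_one hD (one_sub_corr_sq_pos hβ ψ),
      ← ENNReal.ofReal_mul (by positivity)]
    congr 1
    field_simp
  · simp

/-- The density of the two arguments, weighted by one of the moduli. -/
noncomputable def weightedDensity (β : ℂ) (ψ : ℝ) : ℝ :=
  √(1 - ‖β‖ ^ 2) * (1 - ‖β‖ ^ 2) / (8 * (Real.pi * √Real.pi)) / (1 - corr β ψ) ^ 2

lemma map_arg_pairLaw_norm_fst {β : ℂ} (hβ : ‖β‖ < 1) :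
    ((pairLaw β).withDensity fun z => ENNReal.ofReal ‖z.1‖).map (fun z => (z.1.arg, z.2.arg))
      = (volume.restrict (Set.Ioo (-Real.pi) Real.pi ×ˢ Set.Ioo (-Real.pi) Real.pi)).withDensity
        fun θ => ENNReal.ofReal (weightedDensity β (θ.2 - θ.1)) := by
  have hD := one_sub_norm_sq_pos hβ
  refine map_arg_withDensity (β := β) (fun x _ => x) (by fun_prop) (weightedDensity β) ?_
    fun x _ hx _ => hx.le
  intro ψ
  have : ∀ x y : ℝ, x * (x * y *
        Real.exp (-(x ^ 2 + y ^ 2 - 2 * corr β ψ * (x * y)) / (1 - ‖β‖ ^ 2)))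
          / (Real.pi ^ 2 * (1 - ‖β‖ ^ 2)) = (Real.pi ^ 2 * (1 - ‖β‖ ^ 2))⁻¹ * (x ^ 2 * y *
        Real.exp (-(x ^ 2 + y ^ 2 - 2 * corr β ψ * (x * y)) / (1 - ‖β‖ ^ 2))) := by
    intro x y; ring
  simp only [this,
    ENNReal.ofReal_mul (inv_nonneg.2 (by positivity : 0 ≤ Real.pi ^ 2 * (1 - ‖β‖ ^ 2)))]
  rw [lintegral_congr fun x => lintegral_const_mul _ (by fun_prop), lintegral_const_mul _
    (by fun_prop), lintegral_radial_two hD (one_sub_corr_sq_pos hβ ψ),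
    ← ENNReal.ofReal_mul (by positivity), weightedDensity]
  congr 1
  have h1 := one_sub_corr_pos hβ ψ
  have h2 := Real.sqrt_pos.2 Real.pi_pos
  have h3 := Real.sq_sqrt Real.pi_pos.le
  field_simp
  rw [h3]

lemma map_arg_pairLaw_norm_snd {β : ℂ} (hβ : ‖β‖ < 1) :
    ((pairLaw β).withDensity fun z => ENNReal.ofReal ‖z.2‖).map (fun z => (z.1.arg, z.2.arg))
      = (volume.restrict (Set.Ioo (-Real.pi) Real.pi ×ˢ Set.Ioo (-Real.pi) Real.pi)).withDensity
        fun θ => ENNReal.ofReal (weightedDensity β (θ.2 - θ.1)) := by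
  have hD := one_sub_norm_sq_pos hβ
  refine map_arg_withDensity (β := β) (fun _ y => y) (by fun_prop) (weightedDensity β) ?_
    fun _ y _ hy => hy.le
  intro ψ
  have : ∀ x y : ℝ, y * (x * y *
        Real.exp (-(x ^ 2 + y ^ 2 - 2 * corr β ψ * (x * y)) / (1 - ‖β‖ ^ 2)))
          / (Real.pi ^ 2 * (1 - ‖β‖ ^ 2)) = (Real.pi ^ 2 * (1 - ‖β‖ ^ 2))⁻¹ * (y ^ 2 * x *
        Real.exp (-(y ^ 2 + x ^ 2 - 2 * corr β ψ * (y * x)) / (1 - ‖β‖ ^ 2))) := by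
    intro x y; ring_nf
  simp only [this,
    ENNReal.ofReal_mul (inv_nonneg.2 (by positivity : 0 ≤ Real.pi ^ 2 * (1 - ‖β‖ ^ 2)))]
  -- The quadratic form is symmetric in the two radii, so swapping the integrals reduces to the
  -- weight on the first modulus.
  rw [lintegral_lintegral_swap (by fun_prop),
    lintegral_congr fun x => lintegral_const_mul _ (by fun_prop), lintegral_const_mul _
    (by fun_prop), lintegral_radial_two hD (one_sub_corr_sq_pos hβ ψ),
    ← ENNReal.ofReal_mul (by positivity), weightedDensity]
  congr 1
  have h1 := one_sub_corr_pos hβ ψ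
  have h2 := Real.sqrt_pos.2 Real.pi_pos
  have h3 := Real.sq_sqrt Real.pi_pos.le
  field_simp
  rw [h3]

/-! ### Quantization cells as open quadrants. -/

lemma sign_eq_one_iff {x : ℝ} : Real.sign x = 1 ↔ 0 < x := by
  rcases lt_trichotomy x 0 with h | h | h
  · rw [Real.sign_of_neg h]; constructor <;> intro h' <;> linarith
  · simp [h]
  · simp [Real.sign_of_pos h, h]

lemma sign_eq_neg_one_iff {x : ℝ} : Real.sign x = -1 ↔ x < 0 := by
  rw [← neg_inj, neg_neg, ← Real.sign_neg, sign_eq_one_iff, neg_pos]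

lemma arg_pos_iff {z : ℂ} : 0 < z.arg ↔ 0 < z.im ∨ z.re < 0 ∧ z.im = 0 := by
  rw [lt_iff_le_and_ne, ne_comm, Complex.arg_nonneg_iff, Ne, Complex.arg_eq_zero_iff]
  grind

/-- The angle α is the clockwise edge of the quadrant of σ, at π/4 before the direction of σ, whence
e^{iα} = (σ/√2) e^{-iπ/4}. The equivalence holds for every z: on an axis `Real.sign` is 0 for some
coordinate, and the interval of arguments is open. -/
lemma exists_quadrant {σ : ℂ} (hσ : σ ∈ symbols) : ∃ α : ℝ,
    Set.Ioo α (α + Real.pi / 2) ⊆ Set.Ioo (-Real.pi) Real.pi ∧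
    Complex.exp (α * Complex.I) = σ * (1 - Complex.I) / 2 ∧
    ∀ z, quantize z = σ ↔ z.arg ∈ Set.Ioo α (α + Real.pi / 2) := by
  have hpi := Real.pi_pos
  simp only [symbols, Finset.mem_insert, Finset.mem_singleton] at hσ
  rcases hσ with rfl | rfl | rfl | rfl
  · refine ⟨0, Set.Ioo_subset_Ioo (by linarith) (by linarith), ?_, fun z => ?_⟩
    · apply Complex.ext <;> simp
    · simp only [quantize, sign_eq_one_iff, zero_add, Set.mem_Ioo, arg_pos_iff,
        Complex.arg_lt_pi_div_two_iff, Complex.ext_iff, Complex.zero_re, Complex.zero_im]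
      grind
  · refine ⟨-(Real.pi / 2), Set.Ioo_subset_Ioo (by linarith) (by linarith), ?_, fun z => ?_⟩
    · push_cast
      rw [neg_mul, Complex.exp_neg, Complex.exp_pi_div_two_mul_I, Complex.inv_I]
      apply Complex.ext <;> norm_num
    · rw [neg_add_cancel]
      simp only [quantize, Complex.mk.injEq, sign_eq_one_iff, sign_eq_neg_one_iff, Set.mem_Ioo,
        Complex.arg_neg_iff, Complex.neg_pi_div_two_lt_arg_iff]
      grind
  · refine ⟨Real.pi / 2, Set.Ioo_subset_Ioo (by linarith) (by linarith), ?_, fun z => ?_⟩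
    · push_cast
      rw [Complex.exp_pi_div_two_mul_I]
      apply Complex.ext <;> norm_num
    · rw [add_halves, Set.mem_Ioo, ← not_le]
      simp only [quantize, Complex.mk.injEq, sign_eq_one_iff, sign_eq_neg_one_iff,
        Complex.arg_le_pi_div_two_iff, Complex.arg_lt_pi_iff]
      grind
  -- The third quadrant starts at -π rather than π to lie inside the principal branch; the cut
  -- itself has argument π and is excluded.
  · refine ⟨-Real.pi, Set.Ioo_subset_Ioo (by linarith) (by linarith), ?_, fun z => ?_⟩
    · push_cast
      rw [neg_mul, Complex.exp_neg, Complex.exp_pi_mul_I]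
      apply Complex.ext <;> norm_num
    · rw [show -Real.pi + Real.pi / 2 = -(Real.pi / 2) by ring, Set.mem_Ioo,
        ← not_le (a := -(Real.pi / 2))]
      simp only [quantize, Complex.mk.injEq, sign_eq_neg_one_iff, Complex.neg_pi_lt_arg,
        Complex.neg_pi_div_two_le_arg_iff]
      grind

/-- Integration over a pair of quadrants in polar coordinates. -/
lemma setIntegral_quadrants {β : ℂ} {w : ℂ × ℂ → ℝ} (hw : Measurable w) (hw0 : ∀ z, 0 ≤ w z)
    {K : ℝ → ℝ} (hK : Continuous K) (hK0 : ∀ ψ, 0 ≤ K ψ)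
    (hmap : ((pairLaw β).withDensity fun z => ENNReal.ofReal (w z)).map
        (fun z => (z.1.arg, z.2.arg))
      = (volume.restrict (Set.Ioo (-Real.pi) Real.pi ×ˢ Set.Ioo (-Real.pi) Real.pi)).withDensity
        fun θ => ENNReal.ofReal (K (θ.2 - θ.1)))
    {A B : Set ℝ} (hA : MeasurableSet A) (hB : MeasurableSet B)
    (hAsub : A ⊆ Set.Ioo (-Real.pi) Real.pi) (hBsub : B ⊆ Set.Ioo (-Real.pi) Real.pi)
    {g : ℝ × ℝ → ℂ} (hg : Continuous g) :
    ∫ z in {z : ℂ × ℂ | z.1.arg ∈ A ∧ z.2.arg ∈ B}, (w z : ℂ) * g (z.1.arg, z.2.arg) ∂(pairLaw β)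
      = ∫ θ in A ×ˢ B, (K (θ.2 - θ.1) : ℂ) * g θ := by
  have harg : Measurable fun z : ℂ × ℂ => (z.1.arg, z.2.arg) :=
    (Complex.measurable_arg.comp measurable_fst).prodMk (Complex.measurable_arg.comp measurable_snd)
  have hAB := hA.prod hB
  have h1 := setIntegral_withDensity_eq_setIntegral_toReal_smul (μ := pairLaw β)
    hw.ennreal_ofReal (.of_forall fun _ => ENNReal.ofReal_lt_top)
    (fun z => g (z.1.arg, z.2.arg)) (harg hAB)
  have h2 := setIntegral_withDensity_eq_setIntegral_toReal_smul
    (μ := volume.restrict (Set.Ioo (-Real.pi) Real.pi ×ˢ Set.Ioo (-Real.pi) Real.pi))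
    (f := fun θ : ℝ × ℝ => ENNReal.ofReal (K (θ.2 - θ.1))) (s := A ×ˢ B)
    (by fun_prop) (.of_forall fun _ => ENNReal.ofReal_lt_top) g hAB
  rw [← hmap, setIntegral_map hAB hg.aestronglyMeasurable harg.aemeasurable, h1,
    Measure.restrict_restrict hAB, Set.inter_eq_left.2 (Set.prod_mono hAsub hBsub)] at h2
  simp only [ENNReal.toReal_ofReal (hw0 _), ENNReal.toReal_ofReal (hK0 _), Complex.real_smul] at h2
  exact h2

/-! ### The probability of a pair of quadrants. -/

/-- The derivative of `corr β`. -/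
noncomputable def corr' (β : ℂ) (ψ : ℝ) : ℝ := -β.re * Real.sin ψ + β.im * Real.cos ψ

lemma hasDerivAt_corr (β : ℂ) (ψ : ℝ) : HasDerivAt (corr β) (corr' β ψ) ψ := by
  have := ((Real.hasDerivAt_cos ψ).const_mul β.re).add ((Real.hasDerivAt_sin ψ).const_mul β.im)
  refine this.congr_deriv ?_
  rw [corr']; ring

lemma hasDerivAt_corr' (β : ℂ) (ψ : ℝ) : HasDerivAt (corr' β) (-corr β ψ) ψ := by
  have := ((Real.hasDerivAt_sin ψ).const_mul (-β.re)).add ((Real.hasDerivAt_cos ψ).const_mul β.im)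
  refine this.congr_deriv ?_
  rw [corr]; ring

@[fun_prop]
lemma continuous_corr (β : ℂ) : Continuous (corr β) := by unfold corr; fun_prop

@[fun_prop]
lemma continuous_corr' (β : ℂ) : Continuous (corr' β) := by unfold corr'; fun_prop

lemma corr_abs_lt {β : ℂ} (hβ : ‖β‖ < 1) (ψ : ℝ) : corr β ψ ∈ Set.Ioo (-1) 1 :=
  abs_lt.1 ((sq_lt_one_iff_abs_lt_one _).1 (by linarith [one_sub_corr_sq_pos hβ ψ]))

/-- Half the square of `arccos (-corr β)`. -/
noncomputable def halfSqArc (β : ℂ) (ψ : ℝ) : ℝ := (Real.pi / 2 + Real.arcsin (corr β ψ)) ^ 2 / 2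

/-- The derivative of `halfSqArc β`. -/
noncomputable def halfSqArc' (β : ℂ) (ψ : ℝ) : ℝ :=
  (Real.pi / 2 + Real.arcsin (corr β ψ)) * (corr' β ψ / √(1 - corr β ψ ^ 2))

lemma hasDerivAt_halfSqArc {β : ℂ} (hβ : ‖β‖ < 1) (ψ : ℝ) :
    HasDerivAt (halfSqArc β) (halfSqArc' β ψ) ψ := by
  have hc := corr_abs_lt hβ ψ
  have := ((((Real.hasDerivAt_arcsin hc.1.ne' hc.2.ne).comp ψ (hasDerivAt_corr β ψ)).const_add
    (Real.pi / 2)).pow 2).div_const 2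
  refine this.congr_deriv ?_
  simp only [halfSqArc', Function.comp]
  push_cast
  ring

/-- The key identity for the probability: the radial factor is a second derivative up to an affine
change. It rests on c'' = -c and c² + c'² = |β|². -/
lemma hasDerivAt_halfSqArc' {β : ℂ} (hβ : ‖β‖ < 1) (ψ : ℝ) :
    HasDerivAt (halfSqArc' β) (1 - 4 * ((1 - ‖β‖ ^ 2) * radialJ (corr β ψ))) ψ := by
  have hc := corr_abs_lt hβ ψ
  have hE := one_sub_corr_sq_pos hβ ψ
  have hs := Real.sqrt_pos.2 hE
  have hsq := Real.sq_sqrt hE.le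
  have h1 := ((Real.hasDerivAt_arcsin hc.1.ne' hc.2.ne).comp ψ (hasDerivAt_corr β ψ)).const_add
    (Real.pi / 2)
  have h2 := (((hasDerivAt_corr β ψ).pow 2).const_sub 1).sqrt hE.ne'
  have := h1.mul ((hasDerivAt_corr' β ψ).div h2 hs.ne')
  refine this.congr_deriv ?_
  have hb := corr_sq_add β ψ
  rw [← corr'] at hb
  simp only [radialJ, Function.comp, Pi.div_apply, Pi.pow_apply]
  set s := √(1 - corr β ψ ^ 2)
  rw [← hsq]
  have hb' : 1 - ‖β‖ ^ 2 = s ^ 2 - corr' β ψ ^ 2 := by rw [hsq]; linarith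
  rw [hb']
  field_simp
  push_cast
  ring

/-- For c < 0 the sign is the inequality A ≤ tan A at A = π/2 + arcsin c, since tan A = √(1 -
c²)/(-c). Nonnegativity allows passing from `ENNReal.ofReal` densities back to real ones. -/
lemma radialJ_nonneg {c : ℝ} (hc : c ∈ Set.Ioo (-1) 1) : 0 ≤ radialJ c := by
  have hE : 0 < 1 - c ^ 2 := by nlinarith [hc.1, hc.2]
  have hs := Real.sqrt_pos.2 hE
  have hsq := Real.sq_sqrt hE.le
  have h1 := Real.neg_pi_div_two_lt_arcsin.2 hc.1
  have key : 0 ≤ √(1 - c ^ 2) + c * (Real.pi / 2 + Real.arcsin c) := by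
    rcases le_or_gt 0 c with h | h
    · have := Real.arcsin_nonneg.2 h
      positivity
    · have h2 := Real.arcsin_lt_zero.2 h
      have h3 := Real.le_tan (x := Real.pi / 2 + Real.arcsin c) (by linarith) (by linarith)
      rw [add_comm, Real.tan_eq_sin_div_cos, Real.sin_add_pi_div_two, Real.cos_add_pi_div_two,
        Real.cos_arcsin, Real.sin_arcsin hc.1.le hc.2.le, le_div_iff₀ (by linarith)] at h3
      linarith
  have : radialJ c = (√(1 - c ^ 2) + c * (Real.pi / 2 + Real.arcsin c)) /
      (4 * √(1 - c ^ 2) ^ 3) := by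
    unfold radialJ
    nth_rewrite 1 [← hsq]
    field_simp
  rw [this]
  positivity

lemma continuous_radialJ_corr {β : ℂ} (hβ : ‖β‖ < 1) : Continuous fun ψ => radialJ (corr β ψ) := by
  have h := fun ψ => one_sub_corr_sq_pos hβ ψ
  have h' := fun ψ => (Real.sqrt_pos.2 (h ψ))
  unfold radialJ
  refine Continuous.div_const (Continuous.add (Continuous.div (by fun_prop) (by fun_prop)
    fun ψ => (h ψ).ne') (Continuous.div (by fun_prop) (by fun_prop) fun ψ => ?_)) _
  exact (pow_pos (h' ψ) 3).ne'

lemma setIntegral_box {E : Type*} [NormedAddCommGroup E] [NormedSpace ℝ E] {f : ℝ × ℝ → E}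
    (hf : Continuous f) {a b c d : ℝ} (hab : a ≤ b) (hcd : c ≤ d) :
    ∫ θ in Set.Ioo a b ×ˢ Set.Ioo c d, f θ = ∫ x in a..b, ∫ y in c..d, f (x, y) := by
  have hi : IntegrableOn f (Set.Ioo a b ×ˢ Set.Ioo c d) (volume.prod volume) :=
    (hf.continuousOn.integrableOn_compact (isCompact_Icc.prod isCompact_Icc)).mono_set
      (Set.prod_mono Set.Ioo_subset_Icc_self Set.Ioo_subset_Icc_self)
  rw [Measure.volume_eq_prod, setIntegral_prod _ hi]
  simp only [intervalIntegral.integral_of_le hab, intervalIntegral.integral_of_le hcd,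
    integral_Ioc_eq_integral_Ioo]

lemma setIntegral_box_swap {E : Type*} [NormedAddCommGroup E] [NormedSpace ℝ E] {f : ℝ × ℝ → E}
    (hf : Continuous f) {a b c d : ℝ} (hab : a ≤ b) (hcd : c ≤ d) :
    ∫ θ in Set.Ioo a b ×ˢ Set.Ioo c d, f θ = ∫ y in c..d, ∫ x in a..b, f (x, y) := by
  have h := setIntegral_box (f := fun θ => f θ.swap) (by fun_prop) hcd hab
  rw [Measure.volume_eq_prod, ← Measure.prod_restrict, integral_prod_swap] at h
  rw [Measure.volume_eq_prod, ← Measure.prod_restrict, h]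
  rfl

/-- The correlation `β` rotated by the angle `δ`. -/
noncomputable def rot (β : ℂ) (δ : ℝ) : ℂ := ⟨corr β δ, corr' β δ⟩

lemma norm_rot (β : ℂ) (δ : ℝ) : ‖rot β δ‖ = ‖β‖ := by
  rw [← sq_eq_sq₀ (norm_nonneg _) (norm_nonneg _), sq_norm_eq, ← corr_sq_add β δ]
  rfl

lemma corr_add (β : ℂ) (x δ : ℝ) : corr β (x + δ) = corr (rot β δ) x := by
  simp only [corr, corr', rot, Real.cos_add, Real.sin_add]; ring

lemma corr_add_pi_div_two (β : ℂ) (δ : ℝ) : corr β (δ + Real.pi / 2) = corr' β δ := by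
  simp only [corr, corr', Real.cos_add_pi_div_two, Real.sin_add_pi_div_two]; ring

lemma corr_sub_pi_div_two (β : ℂ) (δ : ℝ) : corr β (δ - Real.pi / 2) = -corr' β δ := by
  simp only [corr, corr', Real.cos_sub_pi_div_two, Real.sin_sub_pi_div_two]; ring

lemma corr'_sub_pi_div_two (β : ℂ) (δ : ℝ) : corr' β (δ - Real.pi / 2) = corr β δ := by
  simp only [corr, corr', Real.cos_sub_pi_div_two, Real.sin_sub_pi_div_two]; ring

/-- The probability of a pair of quadrants. -/
lemma integral_density_box {β : ℂ} (hβ : ‖β‖ < 1) (α₁ α₂ : ℝ) :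
    ∫ x in α₁..α₁ + Real.pi / 2, ∫ y in α₂..α₂ + Real.pi / 2,
        (1 - ‖β‖ ^ 2) * radialJ (corr β (y - x)) / Real.pi ^ 2
      = ((Real.pi / 2 + Real.arcsin (corr β (α₂ - α₁))) ^ 2
          - Real.arcsin (corr' β (α₂ - α₁)) ^ 2) / (4 * Real.pi ^ 2) := by
  have hJ := continuous_radialJ_corr hβ
  have hpi := Real.pi_pos
  have inner : ∀ x : ℝ, ∫ y in α₂..α₂ + Real.pi / 2,
      (1 - ‖β‖ ^ 2) * radialJ (corr β (y - x)) / Real.pi ^ 2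
      = (Real.pi / 2 - halfSqArc' β (α₂ + Real.pi / 2 - x) + halfSqArc' β (α₂ - x))
        / (4 * Real.pi ^ 2) := by
    intro x
    rw [intervalIntegral.integral_comp_sub_right
      (fun ψ => (1 - ‖β‖ ^ 2) * radialJ (corr β ψ) / Real.pi ^ 2),
      intervalIntegral.integral_eq_sub_of_hasDerivAt
        (f := fun ψ => (ψ - halfSqArc' β ψ) / (4 * Real.pi ^ 2))]
    · ring
    · intro ψ _
      refine (((hasDerivAt_id ψ).sub (hasDerivAt_halfSqArc' hβ ψ)).div_const _).congr_deriv ?_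
      field_simp
      ring
    · exact ((hJ.const_mul _).div_const _).intervalIntegrable _ _
  have hc' : Continuous (halfSqArc' β) :=
    continuous_iff_continuousAt.2 fun ψ => (hasDerivAt_halfSqArc' hβ ψ).continuousAt
  simp only [inner]
  rw [intervalIntegral.integral_eq_sub_of_hasDerivAt (f := fun x =>
    (Real.pi / 2 * x + halfSqArc β (α₂ + Real.pi / 2 - x) - halfSqArc β (α₂ - x))
      / (4 * Real.pi ^ 2))]
  -- The second difference: the centre counts twice, and at the shifts by ±π/2 the correlation is
  -- ±c', so the cross terms cancel in the sum of squares.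
  · rw [show α₂ + Real.pi / 2 - (α₁ + Real.pi / 2) = α₂ - α₁ by ring,
      show α₂ + Real.pi / 2 - α₁ = α₂ - α₁ + Real.pi / 2 by ring,
      show α₂ - (α₁ + Real.pi / 2) = α₂ - α₁ - Real.pi / 2 by ring]
    simp only [halfSqArc, corr_add_pi_div_two, corr_sub_pi_div_two, Real.arcsin_neg]
    ring
  · intro x _
    have h1 := (hasDerivAt_halfSqArc hβ (α₂ + Real.pi / 2 - x)).comp x
      ((hasDerivAt_id x).const_sub (α₂ + Real.pi / 2))
    have h2 := (hasDerivAt_halfSqArc hβ (α₂ - x)).comp x ((hasDerivAt_id x).const_sub α₂)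
    refine (((((hasDerivAt_id x).const_mul (Real.pi / 2)).add h1).sub h2).div_const _).congr_deriv ?_
    ring
  · exact (by fun_prop : Continuous _).intervalIntegrable _ _

/-! ### Angular integrals for the first moments. -/

/-- The normalized integral over a quarter turn of `1 / (1 - corr β)`. -/
noncomputable def quarterArc (β : ℂ) : ℝ :=
  Real.pi / 2 + Real.arctan (β.re / √(1 - ‖β‖ ^ 2)) + Real.arctan (β.im / √(1 - ‖β‖ ^ 2))
    + Real.arctan (β.re * β.im / √(1 - ‖β‖ ^ 2))

/-- Write 1/(1-c) = 1/(1-c²) + c/(1-c²). The first term is rational in tan ψ; the second is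
elementary because c = -(c')' and 1 - c² = (1-|β|²) + c'². -/
lemma hasDerivAt_quarterArc {β : ℂ} (hβ : ‖β‖ < 1) {ψ : ℝ} (hψ : 0 < Real.cos ψ) :
    HasDerivAt (fun ψ => Real.arctan (((1 - β.im ^ 2) * Real.tan ψ - β.re * β.im) / √(1 - ‖β‖ ^ 2))
      - Real.arctan (corr' β ψ / √(1 - ‖β‖ ^ 2)))
      (√(1 - ‖β‖ ^ 2) * (1 / (1 - corr β ψ))) ψ := by
  have hD := one_sub_norm_sq_pos hβ
  have hd := Real.sqrt_pos.2 hD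
  have hdsq := Real.sq_sqrt hD.le
  have h1 := ((((Real.hasDerivAt_tan hψ.ne').const_mul (1 - β.im ^ 2)).sub_const
    (β.re * β.im)).div_const √(1 - ‖β‖ ^ 2)).arctan
  have h2 := ((hasDerivAt_corr' β ψ).div_const √(1 - ‖β‖ ^ 2)).arctan
  refine (h1.sub h2).congr_deriv ?_
  have hc := one_sub_corr_pos hβ ψ
  have hE := one_sub_corr_sq_pos hβ ψ
  have hb := corr_sq_add β ψ
  rw [← corr'] at hb
  have hn := sq_norm_eq β
  set d := √(1 - ‖β‖ ^ 2)
  have e2 : 1 + (corr' β ψ / d) ^ 2 = (1 - corr β ψ ^ 2) / d ^ 2 := by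
    field_simp; rw [hdsq]; linarith
  have him : 0 < 1 - β.im ^ 2 := by nlinarith [sq_nonneg β.re]
  have e1 : 1 + (((1 - β.im ^ 2) * Real.tan ψ - β.re * β.im) / d) ^ 2
      = (1 - β.im ^ 2) * (1 - corr β ψ ^ 2) / (d ^ 2 * Real.cos ψ ^ 2) := by
    rw [Real.tan_eq_sin_div_cos]
    field_simp
    rw [hdsq, hn, corr]
    linear_combination (1 - β.im ^ 2) * Real.sin_sq_add_cos_sq ψ
  rw [e1, e2]
  have hfac : 1 - corr β ψ ^ 2 = (1 - corr β ψ) * (1 + corr β ψ) := by ring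
  have hc' : 0 < 1 + corr β ψ := by rw [hfac] at hE; exact pos_of_mul_pos_right hE hc.le
  rw [hfac]
  field_simp
  ring

lemma integral_quarterArc {β : ℂ} (hβ : ‖β‖ < 1) :
    ∫ ψ in (0 : ℝ)..Real.pi / 2, √(1 - ‖β‖ ^ 2) * (1 / (1 - corr β ψ)) = quarterArc β := by
  have hD := one_sub_norm_sq_pos hβ
  have hd := Real.sqrt_pos.2 hD
  have him : 0 < 1 - β.im ^ 2 := by nlinarith [sq_nonneg β.re, sq_norm_eq β]
  have hc : Continuous fun ψ => √(1 - ‖β‖ ^ 2) * (1 / (1 - corr β ψ)) :=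
    continuous_const.mul (continuous_const.div (by fun_prop) fun ψ => (one_sub_corr_pos hβ ψ).ne')
  have hcont : Continuous fun ψ => Real.arctan (corr' β ψ / √(1 - ‖β‖ ^ 2)) := by fun_prop
  have hder := fun ψ (hψ : ψ ∈ Set.Ico 0 (Real.pi / 2)) => hasDerivAt_quarterArc hβ (ψ := ψ)
    (Real.cos_pos_of_mem_Ioo ⟨by linarith [Real.pi_pos, hψ.1], hψ.2⟩)
  -- The tangent blows up at π/2, so the right endpoint enters as a limit, contributing the constant
  -- π/2.
  rw [intervalIntegral.integral_eq_sub_of_hasDerivAt_of_tendsto (by linarith [Real.pi_pos])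
    (fun ψ hψ => hder ψ ⟨hψ.1.le, hψ.2⟩) (hc.intervalIntegrable _ _)
    ((hder 0 ⟨le_rfl, by linarith [Real.pi_pos]⟩).continuousAt.mono_left nhdsWithin_le_nhds)
    (fb := Real.pi / 2 - Real.arctan (corr' β (Real.pi / 2) / √(1 - ‖β‖ ^ 2)))]
  · simp [quarterArc, corr', neg_div, Real.arctan_neg]
    ring
  · refine Tendsto.sub ?_ ((hcont.tendsto _).mono_left nhdsWithin_le_nhds)
    refine (tendsto_nhds_of_tendsto_nhdsWithin Real.tendsto_arctan_atTop).comp ?_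
    refine Tendsto.atTop_div_const hd (tendsto_atTop_add_const_right _ _ ?_)
    exact Real.tendsto_tan_pi_div_two.const_mul_atTop him

lemma integral_quarterArc_shift {β : ℂ} (hβ : ‖β‖ < 1) (δ : ℝ) :
    ∫ ψ in δ..δ + Real.pi / 2, √(1 - ‖β‖ ^ 2) * (1 / (1 - corr β ψ)) = quarterArc (rot β δ) := by
  rw [← integral_quarterArc (by rwa [norm_rot]), norm_rot]
  simp only [← corr_add]
  rw [intervalIntegral.integral_comp_add_right
    (fun ψ => √(1 - ‖β‖ ^ 2) * (1 / (1 - corr β ψ))), zero_add, add_comm]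

lemma hasDerivAt_inv_one_sub_corr {β : ℂ} (hβ : ‖β‖ < 1) (ψ : ℝ) :
    HasDerivAt (fun ψ => 1 / (1 - corr β ψ)) (corr' β ψ / (1 - corr β ψ) ^ 2) ψ := by
  have := ((hasDerivAt_corr β ψ).const_sub 1).inv (one_sub_corr_pos hβ ψ).ne'
  simp only [← one_div] at this
  refine this.congr_deriv ?_
  ring

lemma hasDerivAt_exp_mul_I (x : ℝ) :
    HasDerivAt (fun x : ℝ => Complex.exp (x * Complex.I))
      (Complex.I * Complex.exp (x * Complex.I)) x := by
  have := ((Complex.ofRealCLM.hasDerivAt (x := x)).mul_const Complex.I).cexp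
  refine this.congr_deriv ?_
  simp; ring

/-- The complex kernel whose integrals over quadrants are the moments of the observation. -/
noncomputable def angKernel (β : ℂ) (ψ : ℝ) : ℂ :=
  ((1 / (1 - corr β ψ) : ℝ) : ℂ) + Complex.I * ((corr' β ψ / (1 - corr β ψ) ^ 2 : ℝ) : ℂ)

lemma continuous_inv_one_sub_corr {β : ℂ} (hβ : ‖β‖ < 1) :
    Continuous fun ψ => 1 / (1 - corr β ψ) :=
  continuous_const.div (by fun_prop) fun ψ => (one_sub_corr_pos hβ ψ).ne'

lemma continuous_angKernel {β : ℂ} (hβ : ‖β‖ < 1) : Continuous (angKernel β) := by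
  have h1 := continuous_inv_one_sub_corr hβ
  have h2 : Continuous fun ψ => corr' β ψ / (1 - corr β ψ) ^ 2 :=
    (continuous_corr' β).div (by fun_prop) fun ψ => (pow_pos (one_sub_corr_pos hβ ψ) 2).ne'
  unfold angKernel
  fun_prop

lemma exp_add_pi_div_two (α : ℝ) :
    Complex.exp ((α + Real.pi / 2 : ℝ) * Complex.I) = Complex.I * Complex.exp (α * Complex.I) := by
  push_cast
  rw [add_mul, Complex.exp_add, Complex.exp_pi_div_two_mul_I, mul_comm]

/-- `angKernel` is f + i f' with f = 1/(1-c), so e^{ix} times it at t - x is the exact derivative of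
-i e^{ix} f(t - x). The i between the two boundary terms comes from e^{iπ/2}. -/
lemma integral_exp_mul_angKernel {β : ℂ} (hβ : ‖β‖ < 1) (α t : ℝ) :
    ∫ x in α..α + Real.pi / 2, Complex.exp (x * Complex.I) * angKernel β (t - x)
      = Complex.exp (α * Complex.I) * (((1 / (1 - corr β (t - (α + Real.pi / 2))) : ℝ) : ℂ)
        + Complex.I * ((1 / (1 - corr β (t - α)) : ℝ) : ℂ)) := by
  have hk := continuous_angKernel hβ
  rw [intervalIntegral.integral_eq_sub_of_hasDerivAt (f := fun x : ℝ => -Complex.I *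
    (Complex.exp (x * Complex.I) * ((1 / (1 - corr β (t - x)) : ℝ) : ℂ)))]
  · rw [exp_add_pi_div_two]
    linear_combination (-Complex.exp (α * Complex.I) *
      ((1 / (1 - corr β (t - (α + Real.pi / 2))) : ℝ) : ℂ)) * Complex.I_mul_I
  · intro x _
    have h1 := ((hasDerivAt_inv_one_sub_corr hβ (t - x)).comp x
      ((hasDerivAt_id x).const_sub t)).ofReal_comp
    refine (((hasDerivAt_exp_mul_I x).mul h1).const_mul (-Complex.I)).congr_deriv ?_
    simp only [angKernel, Function.comp]
    push_cast
    linear_combination (-Complex.exp (x * Complex.I) *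
      (1 / (1 - (corr β (t - x) : ℂ)))) * Complex.I_mul_I
  · exact (by fun_prop : Continuous _).intervalIntegrable _ _

lemma integral_exp_mul_conj_angKernel {β : ℂ} (hβ : ‖β‖ < 1) (α t : ℝ) :
    ∫ x in α..α + Real.pi / 2, Complex.exp (x * Complex.I) * conj (angKernel β (x - t))
      = Complex.exp (α * Complex.I) * (((1 / (1 - corr β (α + Real.pi / 2 - t)) : ℝ) : ℂ)
        + Complex.I * ((1 / (1 - corr β (α - t)) : ℝ) : ℂ)) := by
  have hk := continuous_angKernel hβ
  rw [intervalIntegral.integral_eq_sub_of_hasDerivAt (f := fun x : ℝ => -Complex.I *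
    (Complex.exp (x * Complex.I) * ((1 / (1 - corr β (x - t)) : ℝ) : ℂ)))]
  · rw [exp_add_pi_div_two]
    linear_combination (-Complex.exp (α * Complex.I) *
      ((1 / (1 - corr β (α + Real.pi / 2 - t)) : ℝ) : ℂ)) * Complex.I_mul_I
  · intro x _
    have h1 := ((hasDerivAt_inv_one_sub_corr hβ (x - t)).comp x
      ((hasDerivAt_id x).sub_const t)).ofReal_comp
    refine (((hasDerivAt_exp_mul_I x).mul h1).const_mul (-Complex.I)).congr_deriv ?_
    simp only [angKernel, Function.comp, id, map_add, map_mul, Complex.conj_I, Complex.conj_ofReal]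
    push_cast
    linear_combination (-Complex.exp (x * Complex.I) *
      (1 / (1 - (corr β (x - t) : ℂ)))) * Complex.I_mul_I
  · exact (by fun_prop : Continuous _).intervalIntegrable _ _

/-- The normalized first moment of the decorrelated observation in a pair of quadrants. -/
noncomputable def quadrantMoment (β : ℂ) (δ : ℝ) : ℂ :=
  quarterArc (rot β (δ - Real.pi / 2)) + Complex.I * quarterArc (rot β δ)

lemma conj_mul_exp (β : ℂ) (ψ : ℝ) :
    conj β * Complex.exp (ψ * Complex.I) = corr β ψ - Complex.I * corr' β ψ := by
  rw [Complex.exp_mul_I, ← Complex.ofReal_cos, ← Complex.ofReal_sin]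
  apply Complex.ext <;>
    simp [corr, corr', -Complex.ofReal_cos, -Complex.ofReal_sin]
  ring

lemma one_sub_conj_mul_exp {β : ℂ} (hβ : ‖β‖ < 1) (ψ : ℝ) :
    (1 - conj β * Complex.exp (ψ * Complex.I)) * ((1 / (1 - corr β ψ) ^ 2 : ℝ) : ℂ)
      = angKernel β ψ := by
  have hc : (1 - corr β ψ : ℂ) ≠ 0 := mod_cast (one_sub_corr_pos hβ ψ).ne'
  rw [conj_mul_exp, angKernel]
  push_cast
  field_simp
  ring

lemma integral_inv_one_sub_corr_cast {β : ℂ} (hβ : ‖β‖ < 1) (δ : ℝ) :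
    ∫ ψ in δ..δ + Real.pi / 2, ((√(1 - ‖β‖ ^ 2) * (1 / (1 - corr β ψ)) : ℝ) : ℂ)
      = quarterArc (rot β δ) := by
  rw [intervalIntegral.integral_ofReal, integral_quarterArc_shift hβ]

/-- Factoring out e^{iθ₁} leaves (1 - β^* e^{iψ})/(1-c)², which is `angKernel`; θ₁ is therefore
integrated first, and the boundary terms are quarter turns in θ₂. -/
lemma integral_moment_fst {β : ℂ} (hβ : ‖β‖ < 1) (α₁ α₂ : ℝ) :
    ∫ θ in Set.Ioo α₁ (α₁ + Real.pi / 2) ×ˢ Set.Ioo α₂ (α₂ + Real.pi / 2),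
        (weightedDensity β (θ.2 - θ.1) : ℂ) *
          (Complex.exp (θ.1 * Complex.I) - conj β * Complex.exp (θ.2 * Complex.I))
      = (1 - ‖β‖ ^ 2) / (8 * (Real.pi * √Real.pi)) *
        (Complex.exp (α₁ * Complex.I) * quadrantMoment β (α₂ - α₁)) := by
  have hk := continuous_angKernel hβ
  have hcast := Complex.continuous_ofReal.comp
    ((continuous_inv_one_sub_corr hβ).const_mul √(1 - ‖β‖ ^ 2))
  have hpt : ∀ θ : ℝ × ℝ, (weightedDensity β (θ.2 - θ.1) : ℂ) *
      (Complex.exp (θ.1 * Complex.I) - conj β * Complex.exp (θ.2 * Complex.I))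
      = (1 - ‖β‖ ^ 2) / (8 * (Real.pi * √Real.pi)) * √(1 - ‖β‖ ^ 2) *
        (Complex.exp (θ.1 * Complex.I) * angKernel β (θ.2 - θ.1)) := by
    intro θ
    rw [← one_sub_conj_mul_exp hβ, weightedDensity]
    have : Complex.exp (θ.2 * Complex.I) = Complex.exp (θ.1 * Complex.I) *
        Complex.exp ((θ.2 - θ.1 : ℝ) * Complex.I) := by
      rw [← Complex.exp_add]; push_cast; ring_nf
    rw [this]
    push_cast
    ring
  simp only [hpt]
  rw [integral_const_mul, setIntegral_box_swap (by fun_prop) (by linarith [Real.pi_pos])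
    (by linarith [Real.pi_pos]), mul_assoc]
  congr 1
  simp only [integral_exp_mul_angKernel hβ]
  rw [intervalIntegral.integral_const_mul, mul_left_comm]
  congr 1
  rw [← intervalIntegral.integral_const_mul]
  simp only [mul_add, mul_left_comm _ Complex.I, ← Complex.ofReal_mul]
  rw [intervalIntegral.integral_add, intervalIntegral.integral_const_mul,
    intervalIntegral.integral_comp_sub_right
      (fun ψ => ((√(1 - ‖β‖ ^ 2) * (1 / (1 - corr β ψ)) : ℝ) : ℂ)),
    intervalIntegral.integral_comp_sub_right
      (fun ψ => ((√(1 - ‖β‖ ^ 2) * (1 / (1 - corr β ψ)) : ℝ) : ℂ)), quadrantMoment,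
    ← integral_inv_one_sub_corr_cast hβ, ← integral_inv_one_sub_corr_cast hβ]
  · ring_nf
  · exact (hcast.comp (continuous_id.sub continuous_const)).intervalIntegrable _ _
  · exact (continuous_const.mul (hcast.comp
      (continuous_id.sub continuous_const))).intervalIntegrable _ _

/-- Here e^{iθ₂} factors out, leaving the conjugate kernel, and θ₂ is integrated first. The same two
quarter turns appear with exchanged roles, hence i times the conjugate moment. -/
lemma integral_moment_snd {β : ℂ} (hβ : ‖β‖ < 1) (α₁ α₂ : ℝ) :
    ∫ θ in Set.Ioo α₁ (α₁ + Real.pi / 2) ×ˢ Set.Ioo α₂ (α₂ + Real.pi / 2),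
        (weightedDensity β (θ.2 - θ.1) : ℂ) *
          (Complex.exp (θ.2 * Complex.I) - β * Complex.exp (θ.1 * Complex.I))
      = (1 - ‖β‖ ^ 2) / (8 * (Real.pi * √Real.pi)) *
        (Complex.exp (α₂ * Complex.I) * (Complex.I * conj (quadrantMoment β (α₂ - α₁)))) := by
  have hk := continuous_angKernel hβ
  have hcast := Complex.continuous_ofReal.comp
    ((continuous_inv_one_sub_corr hβ).const_mul √(1 - ‖β‖ ^ 2))
  have hpt : ∀ θ : ℝ × ℝ, (weightedDensity β (θ.2 - θ.1) : ℂ) *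
      (Complex.exp (θ.2 * Complex.I) - β * Complex.exp (θ.1 * Complex.I))
      = (1 - ‖β‖ ^ 2) / (8 * (Real.pi * √Real.pi)) * √(1 - ‖β‖ ^ 2) *
        (Complex.exp (θ.2 * Complex.I) * conj (angKernel β (θ.2 - θ.1))) := by
    intro θ
    rw [← one_sub_conj_mul_exp hβ, weightedDensity]
    have : Complex.exp (θ.1 * Complex.I) = Complex.exp (θ.2 * Complex.I) *
        conj (Complex.exp ((θ.2 - θ.1 : ℝ) * Complex.I)) := by
      rw [← Complex.exp_conj, ← Complex.exp_add, map_mul, Complex.conj_I, Complex.conj_ofReal]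
      push_cast; ring_nf
    rw [this]
    simp only [map_mul, map_sub, map_one, Complex.conj_conj, Complex.conj_ofReal]
    push_cast
    ring
  simp only [hpt]
  rw [integral_const_mul, setIntegral_box (by fun_prop) (by linarith [Real.pi_pos])
    (by linarith [Real.pi_pos]), mul_assoc]
  congr 1
  simp only [integral_exp_mul_conj_angKernel hβ]
  rw [intervalIntegral.integral_const_mul, mul_left_comm]
  congr 1
  rw [← intervalIntegral.integral_const_mul]
  simp only [mul_add, mul_left_comm _ Complex.I, ← Complex.ofReal_mul]
  rw [intervalIntegral.integral_add, intervalIntegral.integral_const_mul,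
    intervalIntegral.integral_comp_sub_left
      (fun ψ => ((√(1 - ‖β‖ ^ 2) * (1 / (1 - corr β ψ)) : ℝ) : ℂ)),
    intervalIntegral.integral_comp_sub_left
      (fun ψ => ((√(1 - ‖β‖ ^ 2) * (1 / (1 - corr β ψ)) : ℝ) : ℂ)), quadrantMoment,
    map_add, map_mul, Complex.conj_I, Complex.conj_ofReal, Complex.conj_ofReal,
    ← integral_inv_one_sub_corr_cast hβ, ← integral_inv_one_sub_corr_cast hβ]
  · rw [mul_add, ← mul_assoc Complex.I, mul_neg, Complex.I_mul_I, neg_neg, one_mul]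
    ring_nf
  · exact (hcast.comp (continuous_const.sub continuous_id)).intervalIntegrable _ _
  · exact (continuous_const.mul (hcast.comp
      (continuous_const.sub continuous_id))).intervalIntegrable _ _

/-! ### Identification with the constants κ and with the stated formulas. -/

lemma arcsin_div_sqrt {x y : ℝ} (h : x ^ 2 + y ^ 2 < 1) :
    Real.arcsin (x / √(1 - y ^ 2)) = Real.arctan (x / √(1 - (x ^ 2 + y ^ 2))) := by
  have hy : 0 < 1 - y ^ 2 := by nlinarith [sq_nonneg x]
  have hs := Real.sqrt_pos.2 hy
  have hlt : (x / √(1 - y ^ 2)) ^ 2 < 1 := by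
    rw [div_pow, Real.sq_sqrt hy.le, div_lt_one hy]; linarith
  rw [Real.arcsin_eq_arctan (abs_lt.1 ((sq_lt_one_iff_abs_lt_one _).1 hlt)), div_pow,
    Real.sq_sqrt hy.le, show 1 - x ^ 2 / (1 - y ^ 2) = (1 - (x ^ 2 + y ^ 2)) / (1 - y ^ 2) by
      field_simp; ring, Real.sqrt_div (by linarith)]
  congr 1
  have := Real.sqrt_pos.2 (show 0 < 1 - (x ^ 2 + y ^ 2) by linarith)
  field_simp

lemma re_sq_add_im_sq_lt_one {β : ℂ} (hβ : ‖β‖ < 1) : β.re ^ 2 + β.im ^ 2 < 1 := by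
  linarith [one_sub_norm_sq_pos hβ, sq_norm_eq β]

lemma kappa1_eq {β : ℂ} (hβ : ‖β‖ < 1) : kappa1 β = Real.arctan (β.re / √(1 - ‖β‖ ^ 2)) := by
  rw [kappa1, arcsin_div_sqrt (re_sq_add_im_sq_lt_one hβ), sq_norm_eq]

lemma kappa2_eq {β : ℂ} (hβ : ‖β‖ < 1) : kappa2 β = Real.arctan (β.im / √(1 - ‖β‖ ^ 2)) := by
  rw [kappa2, arcsin_div_sqrt (by linarith [re_sq_add_im_sq_lt_one hβ]), sq_norm_eq, add_comm]

/-- In the passage from arcsine to arctangent, 1 - sin²κ₁ sin²κ₂ has numerator (1 - Im²)(1 - Re²) -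
Re² Im² = 1 - |β|². -/
lemma kappa3_eq {β : ℂ} (hβ : ‖β‖ < 1) :
    kappa3 β = Real.arctan (β.re * β.im / √(1 - ‖β‖ ^ 2)) := by
  have h := re_sq_add_im_sq_lt_one hβ
  have hD := one_sub_norm_sq_pos hβ
  have hn := sq_norm_eq β
  have h1 : 0 < 1 - β.re ^ 2 := by nlinarith [sq_nonneg β.im]
  have h2 : 0 < 1 - β.im ^ 2 := by nlinarith [sq_nonneg β.re]
  have hs : ∀ x y : ℝ, x ^ 2 + y ^ 2 < 1 →
      Real.sin (Real.arcsin (x / √(1 - y ^ 2))) = x / √(1 - y ^ 2) := by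
    intro x y h
    have hy : 0 < 1 - y ^ 2 := by nlinarith [sq_nonneg x]
    have := abs_le_one_iff_mul_self_le_one.2 (show x / √(1 - y ^ 2) * (x / √(1 - y ^ 2)) ≤ 1 by
      rw [← sq, div_pow, Real.sq_sqrt hy.le, div_le_one hy]; linarith)
    exact Real.sin_arcsin (abs_le.1 this).1 (abs_le.1 this).2
  rw [kappa3, kappa1, kappa2, hs _ _ h, hs _ _ (by linarith)]
  have hprod : β.re / √(1 - β.im ^ 2) * (β.im / √(1 - β.re ^ 2))
      = β.re * β.im / √((1 - β.im ^ 2) * (1 - β.re ^ 2)) := by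
    rw [Real.sqrt_mul h2.le]; field_simp
  have hmul : 0 < (1 - β.im ^ 2) * (1 - β.re ^ 2) := mul_pos h2 h1
  have hlt : (β.re * β.im / √((1 - β.im ^ 2) * (1 - β.re ^ 2))) ^ 2 < 1 := by
    rw [div_pow, Real.sq_sqrt hmul.le, div_lt_one hmul]; nlinarith
  rw [hprod, Real.arcsin_eq_arctan (abs_lt.1 ((sq_lt_one_iff_abs_lt_one _).1 hlt)), div_pow,
    Real.sq_sqrt hmul.le, show 1 - (β.re * β.im) ^ 2 / ((1 - β.im ^ 2) * (1 - β.re ^ 2))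
      = (1 - ‖β‖ ^ 2) / ((1 - β.im ^ 2) * (1 - β.re ^ 2)) by rw [hn]; field_simp; ring,
    Real.sqrt_div hD.le]
  congr 1
  have := Real.sqrt_pos.2 hD
  have := Real.sqrt_pos.2 hmul
  field_simp

lemma exp_sub_mul_I {σ₁ σ₂ : ℂ} {α₁ α₂ : ℝ}
    (h₁ : Complex.exp (α₁ * Complex.I) = σ₁ * (1 - Complex.I) / 2)
    (h₂ : Complex.exp (α₂ * Complex.I) = σ₂ * (1 - Complex.I) / 2) :
    Complex.exp ((α₂ - α₁ : ℝ) * Complex.I) = conj σ₁ * σ₂ / 2 := by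
  have h : Complex.exp ((α₂ - α₁ : ℝ) * Complex.I)
      = Complex.exp (α₂ * Complex.I) * conj (Complex.exp (α₁ * Complex.I)) := by
    rw [← Complex.exp_conj, ← Complex.exp_add, map_mul, Complex.conj_I, Complex.conj_ofReal]
    push_cast; ring_nf
  rw [h, h₁, h₂]
  simp only [map_mul, map_div₀, map_sub, map_one, Complex.conj_I, map_ofNat]
  linear_combination (-σ₂ * conj σ₁ / 4) * Complex.I_mul_I

lemma rot_eq_of_exp {β τ : ℂ} {δ : ℝ} (h : Complex.exp (δ * Complex.I) = τ) :
    rot β δ = β * conj τ := by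
  have := conj_mul_exp β δ
  rw [h] at this
  rw [← Complex.conj_conj β, ← map_mul, this]
  apply Complex.ext <;> simp [rot]

lemma rot_sub_pi_div_two (β : ℂ) (δ : ℝ) : rot β (δ - Real.pi / 2) = Complex.I * rot β δ := by
  apply Complex.ext <;> simp [rot, corr_sub_pi_div_two, corr'_sub_pi_div_two]

lemma mem_observations_two {ρ : Fin 2 → ℂ} :
    ρ ∈ observations 2 ↔ ρ 0 ∈ symbols ∧ ρ 1 ∈ symbols := by
  simp [observations, Fintype.mem_piFinset, Fin.forall_fin_two]

lemma exists_of_mem_symbols {σ : ℂ} (hσ : σ ∈ symbols) :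
    ∃ a b : ℝ, (a = 1 ∨ a = -1) ∧ (b = 1 ∨ b = -1) ∧ σ = ⟨a, b⟩ := by
  simp only [symbols, Finset.mem_insert, Finset.mem_singleton] at hσ
  rcases hσ with rfl | rfl | rfl | rfl
  exacts [⟨1, 1, by simp⟩, ⟨1, -1, by simp⟩, ⟨-1, 1, by simp⟩, ⟨-1, -1, by simp⟩]

lemma mul_conj_half (β : ℂ) (a b c e : ℝ) :
    β * conj (conj (⟨a, b⟩ : ℂ) * ⟨c, e⟩ / 2)
      = ⟨β.re * ((a * c + b * e) / 2) + β.im * ((a * e - b * c) / 2),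
        β.im * ((a * c + b * e) / 2) - β.re * ((a * e - b * c) / 2)⟩ := by
  rw [show conj (⟨a, b⟩ : ℂ) * ⟨c, e⟩ / 2 = ((1 / 2 : ℝ) : ℂ) * (conj (⟨a, b⟩ : ℂ) * ⟨c, e⟩) by
    push_cast; ring]
  apply Complex.ext <;> simp <;> ring

/-- ρ₀^* ρ₁ / 2 is a fourth root of unity, so the rotated correlation has parts ±Re β, ±Im β,
possibly exchanged. An exchange flips the sign of κ₄² - κ₅², which the product of the four signs
records. -/
lemma probExpr_eq {β : ℂ} (hβ : ‖β‖ < 1) {ρ : Fin 2 → ℂ} (hρ : ρ ∈ observations 2) :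
    probExpr β ρ = ((Real.pi / 2 + Real.arcsin (β * conj (conj (ρ 0) * ρ 1 / 2)).re) ^ 2
      - Real.arcsin (β * conj (conj (ρ 0) * ρ 1 / 2)).im ^ 2) / (4 * Real.pi ^ 2) := by
  have hpi := Real.pi_ne_zero
  rw [mem_observations_two] at hρ
  obtain ⟨a, b, ha, hb, h0⟩ := exists_of_mem_symbols hρ.1
  obtain ⟨c, e, hc, he, h1⟩ := exists_of_mem_symbols hρ.2
  rw [probExpr, integral1_sub_integral2 hβ, kappa4, kappa5, h0, h1, mul_conj_half]
  simp only [Complex.mul_re, Complex.mul_im, Complex.conj_re, Complex.conj_im]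
  rcases ha with rfl | rfl <;> rcases hb with rfl | rfl <;> rcases hc with rfl | rfl <;>
    rcases he with rfl | rfl <;> (norm_num [Real.arcsin_neg]; field_simp; ring)

/-- When Re β < 0, taking sines reduces this to |Im β| < √(1 - (Re β)²). It makes the difference of
squares in the probability positive. -/
lemma abs_arcsin_im_lt {β : ℂ} (hβ : ‖β‖ < 1) :
    |Real.arcsin β.im| < Real.pi / 2 + Real.arcsin β.re := by
  have h := re_sq_add_im_sq_lt_one hβ
  have hre : |β.re| < 1 := (Complex.abs_re_le_norm β).trans_lt hβ
  have him : |β.im| < 1 := (Complex.abs_im_le_norm β).trans_lt hβ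
  rw [abs_arcsin]
  rcases le_or_gt 0 β.re with h0 | h0
  · linarith [Real.arcsin_nonneg.2 h0, Real.arcsin_lt_pi_div_two.2 him]
  · have h1 := Real.neg_pi_div_two_lt_arcsin.2 (abs_lt.1 hre).1
    have h2 := Real.arcsin_lt_zero.2 h0
    rw [Real.arcsin_lt_iff_lt_sin' ⟨by linarith, by linarith⟩, add_comm, Real.sin_add_pi_div_two,
      Real.cos_arcsin]
    apply Real.lt_sqrt_of_sq_lt
    rw [sq_abs]; linarith

lemma norm_mul_conj_symbols {β : ℂ} {ρ : Fin 2 → ℂ} (hρ : ρ ∈ observations 2) :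
    ‖β * conj (conj (ρ 0) * ρ 1 / 2)‖ = ‖β‖ := by
  rw [mem_observations_two] at hρ
  obtain ⟨α₁, -, h₁, -⟩ := exists_quadrant hρ.1
  obtain ⟨α₂, -, h₂, -⟩ := exists_quadrant hρ.2
  rw [← rot_eq_of_exp (exp_sub_mul_I h₁ h₂), norm_rot]

lemma probExpr_pos {β : ℂ} (hβ : ‖β‖ < 1) {ρ : Fin 2 → ℂ} (hρ : ρ ∈ observations 2) :
    0 < probExpr β ρ := by
  have h := abs_arcsin_im_lt (β := β * conj (conj (ρ 0) * ρ 1 / 2))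
    (by rwa [norm_mul_conj_symbols hρ])
  rw [probExpr_eq hβ hρ]
  have := sq_lt_sq' (by linarith [abs_nonneg (Real.arcsin (β * conj (conj (ρ 0) * ρ 1 / 2)).im)]) h
  rw [sq_abs] at this
  have hpi := Real.pi_pos
  apply div_pos <;> [linarith; positivity]

/-- The constants π/2 of the two quarter arcs combine through (1 - i)(1 + i) = 2 into the multiple
of ρ; the arctangents, being odd, give u after a check of the sixteen sign patterns. -/
lemma exp_mul_quadrantMoment {β : ℂ} (hβ : ‖β‖ < 1) {ρ : Fin 2 → ℂ} (hρ : ρ ∈ observations 2)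
    {δ : ℝ} (hδ : Complex.exp (δ * Complex.I) = conj (ρ 0) * ρ 1 / 2) :
    ρ 0 * (1 - Complex.I) / 2 * quadrantMoment β δ = Real.pi / 2 * ρ 0 + uVec β ρ 0 ∧
    ρ 1 * (1 - Complex.I) / 2 * (Complex.I * conj (quadrantMoment β δ))
      = Real.pi / 2 * ρ 1 + uVec β ρ 1 := by
  rw [mem_observations_two] at hρ
  obtain ⟨a, b, ha, hb, h0⟩ := exists_of_mem_symbols hρ.1
  obtain ⟨c, e, hc, he, h1⟩ := exists_of_mem_symbols hρ.2
  rw [h0, h1] at hδ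
  have hsplit : ∀ (x y X Y : ℝ), (⟨x, y⟩ : ℂ) * (1 - Complex.I) / 2 * (X + Complex.I * Y)
      = ⟨((x + y) * X - (y - x) * Y) / 2, ((x + y) * Y + (y - x) * X) / 2⟩ := by
    intro x y X Y
    rw [show (⟨x, y⟩ : ℂ) * (1 - Complex.I) / 2 * (X + Complex.I * Y)
      = ((1 / 2 : ℝ) : ℂ) * (⟨x, y⟩ * (1 - Complex.I) * (X + Complex.I * Y)) by push_cast; ring]
    apply Complex.ext <;> simp <;> ring
  have hconj : Complex.I * conj (quadrantMoment β δ) = (quarterArc (rot β δ) : ℂ)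
      + Complex.I * quarterArc (rot β (δ - Real.pi / 2)) := by
    rw [quadrantMoment, map_add, map_mul, Complex.conj_I, Complex.conj_ofReal, Complex.conj_ofReal]
    linear_combination -(quarterArc (rot β δ) : ℂ) * Complex.I_mul_I
  have hu0 : (Real.pi / 2 * ρ 0 + uVec β ρ 0 : ℂ) =
      ⟨Real.pi / 2 * a + a * b * (e * kappa1 β - c * kappa2 β) - a * c * e * kappa3 β,
        Real.pi / 2 * b + a * b * (c * kappa1 β + e * kappa2 β) + b * c * e * kappa3 β⟩ := by
    rw [uVec, h0, h1]
    apply Complex.ext <;> simp <;> ring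
  have hu1 : (Real.pi / 2 * ρ 1 + uVec β ρ 1 : ℂ) =
      ⟨Real.pi / 2 * c + c * e * (a * kappa2 β + b * kappa1 β) + a * b * c * kappa3 β,
        Real.pi / 2 * e + c * e * (a * kappa1 β - b * kappa2 β) - a * b * e * kappa3 β⟩ := by
    rw [uVec, h0, h1]
    apply Complex.ext <;> simp <;> ring
  rw [hu0, hu1, hconj, quadrantMoment, h0, h1, hsplit, hsplit, rot_sub_pi_div_two, quarterArc,
    quarterArc, norm_mul, Complex.norm_I, one_mul, norm_rot, rot_eq_of_exp hδ, mul_conj_half,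
    kappa1_eq hβ, kappa2_eq hβ, kappa3_eq hβ]
  simp only [Complex.I_mul_re, Complex.I_mul_im, Complex.mk.injEq]
  have hcomm := mul_comm β.im β.re
  rcases ha with rfl | rfl <;> rcases hb with rfl | rfl <;> rcases hc with rfl | rfl <;>
    rcases he with rfl | rfl <;> norm_num [neg_div, Real.arctan_neg, hcomm] <;>
    refine ⟨⟨?_, ?_⟩, ?_, ?_⟩ <;> ring

/-! ### Probability and first moments of a cell. -/

/-- The pairs that are quantized to `ρ`. -/
def cell (ρ : Fin 2 → ℂ) : Set (ℂ × ℂ) := {z | quantize z.1 = ρ 0 ∧ quantize z.2 = ρ 1}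

lemma weightedDensity_nonneg {β : ℂ} (hβ : ‖β‖ < 1) (ψ : ℝ) : 0 ≤ weightedDensity β ψ := by
  have := one_sub_norm_sq_pos hβ
  unfold weightedDensity; positivity

lemma continuous_weightedDensity {β : ℂ} (hβ : ‖β‖ < 1) : Continuous (weightedDensity β) := by
  unfold weightedDensity
  exact continuous_const.div (by fun_prop) fun ψ => (pow_pos (one_sub_corr_pos hβ ψ) 2).ne'

lemma cell_eq {ρ : Fin 2 → ℂ} {A B : Set ℝ} (hA : ∀ z, quantize z = ρ 0 ↔ z.arg ∈ A)
    (hB : ∀ z, quantize z = ρ 1 ↔ z.arg ∈ B) :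
    cell ρ = {z : ℂ × ℂ | z.1.arg ∈ A ∧ z.2.arg ∈ B} := by
  ext z
  exact and_congr (hA z.1) (hB z.2)

/-- The probability of a cell. -/
lemma pairLaw_real_cell {β : ℂ} (hβ : ‖β‖ < 1) {ρ : Fin 2 → ℂ} (hρ : ρ ∈ observations 2) :
    (pairLaw β).real (cell ρ) = probExpr β ρ := by
  obtain ⟨α₁, hs₁, he₁, h₁⟩ := exists_quadrant (mem_observations_two.1 hρ).1
  obtain ⟨α₂, hs₂, he₂, h₂⟩ := exists_quadrant (mem_observations_two.1 hρ).2
  have hD := one_sub_norm_sq_pos hβ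
  have hJ := continuous_radialJ_corr hβ
  have h := setIntegral_quadrants (β := β) (w := fun _ => 1) measurable_const
    (fun _ => zero_le_one) (K := fun ψ => (1 - ‖β‖ ^ 2) * radialJ (corr β ψ) / Real.pi ^ 2)
    (by fun_prop) (fun ψ => by have := radialJ_nonneg (corr_abs_lt hβ ψ); positivity)
    (by rw [← map_arg_pairLaw hβ]; simp) measurableSet_Ioo measurableSet_Ioo hs₁ hs₂
    (g := fun _ => 1) continuous_const
  rw [← cell_eq h₁ h₂] at h
  simp only [Complex.ofReal_one, mul_one, setIntegral_const, Complex.real_smul] at h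
  have hc : Continuous fun x : ℝ × ℝ =>
      (1 - ‖β‖ ^ 2) * radialJ (corr β (x.2 - x.1)) / Real.pi ^ 2 :=
    ((hJ.comp (continuous_snd.sub continuous_fst)).const_mul _).div_const _
  rw [integral_complex_ofReal, setIntegral_box hc (by linarith [Real.pi_pos])
    (by linarith [Real.pi_pos]), integral_density_box hβ] at h
  rw [probExpr_eq hβ hρ, ← rot_eq_of_exp (exp_sub_mul_I he₁ he₂)]
  exact Complex.ofReal_injective h

/-- Since z = |z| e^{i arg z}, the modulus acts as the weight, and both moduli give the same angular
density. -/
lemma setIntegral_cell_combination {β : ℂ} (hβ : ‖β‖ < 1) (h1 : Integrable (fun z => z.1) (pairLaw β))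
    (h2 : Integrable (fun z => z.2) (pairLaw β)) {ρ : Fin 2 → ℂ} {α₁ α₂ : ℝ}
    (hs₁ : Set.Ioo α₁ (α₁ + Real.pi / 2) ⊆ Set.Ioo (-Real.pi) Real.pi)
    (hs₂ : Set.Ioo α₂ (α₂ + Real.pi / 2) ⊆ Set.Ioo (-Real.pi) Real.pi)
    (hq₁ : ∀ z, quantize z = ρ 0 ↔ z.arg ∈ Set.Ioo α₁ (α₁ + Real.pi / 2))
    (hq₂ : ∀ z, quantize z = ρ 1 ↔ z.arg ∈ Set.Ioo α₂ (α₂ + Real.pi / 2)) (a b : ℂ) :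
    ∫ z in cell ρ, (a * z.1 + b * z.2) ∂(pairLaw β)
      = ∫ θ in Set.Ioo α₁ (α₁ + Real.pi / 2) ×ˢ Set.Ioo α₂ (α₂ + Real.pi / 2),
        (weightedDensity β (θ.2 - θ.1) : ℂ) *
          (a * Complex.exp (θ.1 * Complex.I) + b * Complex.exp (θ.2 * Complex.I)) := by
  have hW := continuous_weightedDensity hβ
  have m1 := setIntegral_quadrants (β := β) (w := fun z => ‖z.1‖) (by fun_prop)
    (fun _ => norm_nonneg _) hW (weightedDensity_nonneg hβ) (map_arg_pairLaw_norm_fst hβ)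
    measurableSet_Ioo measurableSet_Ioo hs₁ hs₂
    (g := fun θ => Complex.exp (θ.1 * Complex.I)) (by fun_prop)
  have m2 := setIntegral_quadrants (β := β) (w := fun z => ‖z.2‖) (by fun_prop)
    (fun _ => norm_nonneg _) hW (weightedDensity_nonneg hβ) (map_arg_pairLaw_norm_snd hβ)
    measurableSet_Ioo measurableSet_Ioo hs₁ hs₂
    (g := fun θ => Complex.exp (θ.2 * Complex.I)) (by fun_prop)
  rw [← cell_eq hq₁ hq₂] at m1 m2
  simp only [Complex.norm_mul_exp_arg_mul_I] at m1 m2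
  rw [integral_add (h1.integrableOn.const_mul a) (h2.integrableOn.const_mul b),
    integral_const_mul, integral_const_mul, m1, m2, ← integral_const_mul, ← integral_const_mul,
    ← integral_add]
  · congr 1 with θ
    ring
  all_goals
    refine IntegrableOn.mono_set (t := Set.Icc α₁ (α₁ + Real.pi / 2) ×ˢ
      Set.Icc α₂ (α₂ + Real.pi / 2)) ?_
      (Set.prod_mono Set.Ioo_subset_Icc_self Set.Ioo_subset_Icc_self)
    exact ContinuousOn.integrableOn_compact (isCompact_Icc.prod isCompact_Icc) (by fun_prop)

/-- The first moments of the decorrelated pair in a cell. -/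
lemma setIntegral_cell_decorrelated {β : ℂ} (hβ : ‖β‖ < 1)
    (h1 : Integrable (fun z => z.1) (pairLaw β)) (h2 : Integrable (fun z => z.2) (pairLaw β))
    {ρ : Fin 2 → ℂ} (hρ : ρ ∈ observations 2) :
    ∫ z in cell ρ, (z.1 - conj β * z.2) / (1 - ‖β‖ ^ 2 : ℝ) ∂(pairLaw β)
      = 1 / (2 * √Real.pi) * (1 / 8 * ρ 0 + 1 / (4 * Real.pi) * uVec β ρ 0) ∧
    ∫ z in cell ρ, (z.2 - β * z.1) / (1 - ‖β‖ ^ 2 : ℝ) ∂(pairLaw β)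
      = 1 / (2 * √Real.pi) * (1 / 8 * ρ 1 + 1 / (4 * Real.pi) * uVec β ρ 1) := by
  obtain ⟨α₁, hs₁, he₁, hq₁⟩ := exists_quadrant (mem_observations_two.1 hρ).1
  obtain ⟨α₂, hs₂, he₂, hq₂⟩ := exists_quadrant (mem_observations_two.1 hρ).2
  have hD : ((1 - ‖β‖ ^ 2 : ℝ) : ℂ) ≠ 0 := mod_cast (one_sub_norm_sq_pos hβ).ne'
  have hpi : (Real.pi : ℂ) ≠ 0 := mod_cast Real.pi_ne_zero
  have hspi : ((√Real.pi : ℝ) : ℂ) ≠ 0 := mod_cast (Real.sqrt_pos.2 Real.pi_pos).ne'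
  have hm := exp_mul_quadrantMoment hβ hρ (exp_sub_mul_I he₁ he₂)
  have c1 := setIntegral_cell_combination hβ h1 h2 hs₁ hs₂ hq₁ hq₂ 1 (-conj β)
  have c2 := setIntegral_cell_combination hβ h1 h2 hs₁ hs₂ hq₁ hq₂ (-β) 1
  simp only [one_mul, neg_mul, ← sub_eq_add_neg, neg_add_eq_sub] at c1 c2
  rw [integral_moment_fst hβ, he₁, hm.1] at c1
  rw [integral_moment_snd hβ, he₂, hm.2] at c2
  rw [integral_div, integral_div, c1, c2]
  push_cast at hD ⊢
  constructor <;> (field_simp; ring)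

/-! ### Complex normal vectors: linear images, independence and densities. -/

variable {Ω : Type*} [mΩ : MeasurableSpace Ω] {μ : Measure Ω}

/-- The standard complex normal law. -/
noncomputable def stdComplexNormal : Measure ℂ :=
  volume.withDensity fun z => ENNReal.ofReal (Real.exp (-‖z‖ ^ 2) / Real.pi)

lemma integrable_mul_of_memLp {X Y : Ω → ℂ} (hX : MemLp X 2 μ) (hY : MemLp Y 2 μ) :
    Integrable (fun ω => X ω * Y ω) μ := hX.integrable_mul hY

lemma memLp_conj {X : Ω → ℂ} (hX : MemLp X 2 μ) : MemLp (fun ω => conj (X ω)) 2 μ :=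
  hX.of_le (Complex.continuous_conj.comp_aestronglyMeasurable hX.1) (.of_forall fun ω => by simp)

/-- Complex variables with vanishing covariance and pseudo-covariance are uncorrelated as real
vectors. -/
lemma covariance_inner_eq_zero [IsProbabilityMeasure μ] {X Y : Ω → ℂ} (hX : MemLp X 2 μ)
    (hY : MemLp Y 2 μ) (h0 : ∫ ω, X ω ∂μ = 0) (h1 : ∫ ω, X ω * conj (Y ω) ∂μ = 0)
    (h2 : ∫ ω, X ω * Y ω ∂μ = 0) (x y : ℂ) :
    cov[fun ω => inner ℝ x (X ω), fun ω => inner ℝ y (Y ω); μ] = 0 := by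
  have hXi := hX.integrable one_le_two
  have hxX : MemLp (fun ω => inner ℝ x (X ω)) 2 μ := hX.const_inner x
  have hyY : MemLp (fun ω => inner ℝ y (Y ω)) 2 μ := hY.const_inner y
  have e0 : ∫ ω, inner ℝ x (X ω) ∂μ = 0 := by
    rw [integral_inner hXi, h0, inner_zero_right]
  rw [covariance_eq_sub hxX hyY, e0, zero_mul, sub_zero]
  have hi1 := (integrable_mul_of_memLp hX (memLp_conj hY)).const_mul (conj x * y)
  have hi2 := (integrable_mul_of_memLp hX hY).const_mul (conj x * conj y)
  -- The identity Re u · Re v = Re(u v^* + u v)/2 expresses the real covariance through the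
  -- covariance and the pseudo-covariance.
  have hpt : ∀ ω, inner ℝ x (X ω) * inner ℝ y (Y ω)
      = 1 / 2 * (conj x * y * (X ω * conj (Y ω)) + conj x * conj y * (X ω * Y ω)).re := by
    intro ω
    simp only [Complex.inner, Complex.add_re, Complex.mul_re, Complex.mul_im, Complex.conj_re,
      Complex.conj_im]
    ring
  simp only [Pi.mul_apply, hpt]
  have hre := Complex.reCLM.integral_comp_comm (hi1.add hi2)
  simp only [Complex.reCLM_apply, Pi.add_apply] at hre
  rw [integral_const_mul, hre, integral_add hi1 hi2, integral_const_mul, integral_const_mul, h1, h2]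
  simp

/-- Vanishing pseudo-covariance forces the real and imaginary parts to be uncorrelated with variance
1/2 each; joint Gaussianity makes them independent, and the two real densities multiply. -/
lemma map_eq_stdComplexNormal [IsProbabilityMeasure μ] {g : Ω → ℂ} (hg : HasGaussianLaw g μ)
    (h0 : ∫ ω, g ω ∂μ = 0) (h1 : ∫ ω, g ω * conj (g ω) ∂μ = 1) (h2 : ∫ ω, g ω * g ω ∂μ = 0) :
    μ.map g = stdComplexNormal := by
  have hL := hg.memLp_two
  have hi1 := integrable_mul_of_memLp hL (memLp_conj hL)
  have hi2 := integrable_mul_of_memLp hL hL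
  have hgi := hL.integrable one_le_two
  have hjoint : HasGaussianLaw (fun ω => ((g ω).re, (g ω).im)) μ :=
    hg.map_fun (Complex.equivRealProdCLM : ℂ →L[ℝ] ℝ × ℝ)
  have hre0 : ∫ ω, (g ω).re ∂μ = 0 := by
    have := Complex.reCLM.integral_comp_comm hgi
    simpa [h0] using this
  have him0 : ∫ ω, (g ω).im ∂μ = 0 := by
    have := Complex.imCLM.integral_comp_comm hgi
    simpa [h0] using this
  have hsum := Complex.reCLM.integral_comp_comm (hi1.add hi2)
  have hdiff := Complex.reCLM.integral_comp_comm (hi1.sub hi2)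
  have hcross := Complex.imCLM.integral_comp_comm hi2
  simp only [Complex.reCLM_apply, Complex.imCLM_apply, Pi.add_apply, Pi.sub_apply,
    integral_add hi1 hi2, integral_sub hi1 hi2, h1, h2] at hsum hdiff hcross
  have hre2 : ∫ ω, (g ω).re * (g ω).re ∂μ = 1 / 2 := by
    have : ∀ ω, (g ω).re * (g ω).re = 1 / 2 * (g ω * conj (g ω) + g ω * g ω).re := fun ω => by
      simp; ring
    simp only [this, integral_const_mul, hsum]; simp
  have him2 : ∫ ω, (g ω).im * (g ω).im ∂μ = 1 / 2 := by
    have : ∀ ω, (g ω).im * (g ω).im = 1 / 2 * (g ω * conj (g ω) - g ω * g ω).re := fun ω => by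
      simp; ring
    simp only [this, integral_const_mul, hdiff]; simp
  have hri : ∫ ω, (g ω).re * (g ω).im ∂μ = 0 := by
    have : ∀ ω, (g ω).re * (g ω).im = 1 / 2 * (g ω * g ω).im := fun ω => by
      simp; ring
    simp only [this, integral_const_mul, hcross]; simp
  have hLre := hjoint.fst.memLp_two
  have hLim := hjoint.snd.memLp_two
  have hind : IndepFun (fun ω => (g ω).re) (fun ω => (g ω).im) μ := by
    refine hjoint.indepFun_of_covariance_eq_zero ?_
    rw [covariance_eq_sub hLre hLim, hre0, zero_mul, sub_zero]
    exact hri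
  have vre : Var[fun ω => (g ω).re; μ] = 1 / 2 := by
    rw [← covariance_self hLre.aemeasurable, covariance_eq_sub hLre hLre, hre0, zero_mul, sub_zero]
    exact hre2
  have vim : Var[fun ω => (g ω).im; μ] = 1 / 2 := by
    rw [← covariance_self hLim.aemeasurable, covariance_eq_sub hLim hLim, him0, zero_mul, sub_zero]
    exact him2
  have hmap : μ.map (fun ω => ((g ω).re, (g ω).im))
      = (gaussianReal 0 (Real.toNNReal (1 / 2))).prod (gaussianReal 0 (Real.toNNReal (1 / 2))) := by
    rw [(indepFun_iff_map_prod_eq_prod_map_map hLre.aemeasurable hLim.aemeasurable).1 hind,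
      hjoint.fst.map_eq_gaussianReal, hjoint.snd.map_eq_gaussianReal, vre, vim, hre0, him0]
  have hne : Real.toNNReal (1 / 2) ≠ 0 := by simp
  have hgm := hg.aemeasurable
  ext S hS
  have e1 : μ.map g S = μ.map (fun ω => ((g ω).re, (g ω).im))
      (Complex.measurableEquivRealProd.symm ⁻¹' S) := by
    rw [Measure.map_apply_of_aemeasurable hgm hS, Measure.map_apply_of_aemeasurable
      (hLre.aemeasurable.prodMk hLim.aemeasurable)
      (Complex.measurableEquivRealProd.symm.measurable hS)]
    rfl
  rw [e1, hmap, gaussianReal_of_var_ne_zero _ hne,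
    prod_withDensity (measurable_gaussianPDF _ _) (measurable_gaussianPDF _ _),
    withDensity_apply _ (Complex.measurableEquivRealProd.symm.measurable hS), stdComplexNormal,
    withDensity_apply _ hS, ← Measure.volume_eq_prod,
    ← Complex.volume_preserving_equiv_real_prod.symm.setLIntegral_comp_preimage hS (by fun_prop)]
  refine lintegral_congr fun x => ?_
  have hn : ‖Complex.measurableEquivRealProd.symm x‖ ^ 2 = x.1 ^ 2 + x.2 ^ 2 := by
    rw [sq_norm_eq]; rfl
  rw [hn, gaussianPDF, gaussianPDF, ← ENNReal.ofReal_mul (gaussianPDFReal_nonneg _ _ _)]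
  congr 1
  rw [gaussianPDFReal, gaussianPDFReal, Real.coe_toNNReal _ (by norm_num)]
  have hs := Real.mul_self_sqrt Real.pi_pos.le
  have : 2 * Real.pi * (1 / 2) = Real.pi := by ring
  rw [this, mul_mul_mul_comm, ← mul_inv, hs, ← Real.exp_add, mul_comm Real.pi⁻¹,
    ← div_eq_mul_inv _ Real.pi]
  congr 2
  ring

lemma lintegral_affine (β : ℂ) {d : ℝ} (hd : 0 < d) (w : ℂ) {f : ℂ → ENNReal} (hf : Measurable f) :
    ∫⁻ z, f (β * w + d * z) = ENNReal.ofReal (1 / d ^ 2) * ∫⁻ z, f z := by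
  have h := Measure.map_addHaar_smul (volume : Measure ℂ) hd.ne'
  have h1 : ∫⁻ z, f (β * w + z) ∂(Measure.map (fun z : ℂ => d • z) volume)
      = ∫⁻ z, f (β * w + d * z) := by
    rw [lintegral_map (by fun_prop) (by fun_prop)]
    simp
  rw [← h1, h, lintegral_smul_measure, lintegral_add_left_eq_self f]
  simp [abs_of_pos hd]

/-- Cholesky factorization: for fixed first coordinate w, the map z ↦ βw + dz with d² = 1 - |β|² has
real Jacobian d², matching the normalization of `pairDensity`, and it diagonalizes the quadratic
form. -/
lemma map_prod_eq_pairLaw {β : ℂ} (hβ : ‖β‖ < 1) :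
    (stdComplexNormal.prod stdComplexNormal).map
      (fun g => (g.1, β * g.1 + √(1 - ‖β‖ ^ 2) * g.2)) = pairLaw β := by
  have hD := one_sub_norm_sq_pos hβ
  have hd := Real.sqrt_pos.2 hD
  have hdsq := Real.sq_sqrt hD.le
  set d := √(1 - ‖β‖ ^ 2)
  refine Measure.ext_of_lintegral _ fun f hf => ?_
  have hm : Measurable fun z : ℂ => ENNReal.ofReal (Real.exp (-‖z‖ ^ 2) / Real.pi) := by fun_prop
  rw [lintegral_map hf (by fun_prop), stdComplexNormal, prod_withDensity hm hm, pairLaw,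
    lintegral_withDensity_eq_lintegral_mul _ (by fun_prop) (by fun_prop),
    lintegral_withDensity_eq_lintegral_mul _ (measurable_pairDensity β).ennreal_ofReal hf,
    lintegral_prod _ (by fun_prop), Measure.volume_eq_prod,
    lintegral_prod _ ((measurable_pairDensity β).ennreal_ofReal.mul hf).aemeasurable]
  refine lintegral_congr fun w => ?_
  have hmd := (measurable_pairDensity β)
  have key := lintegral_affine β hd w (f := fun z => ENNReal.ofReal (pairDensity β (w, z)) * f (w, z))
    (by fun_prop)
  have hfin : ENNReal.ofReal (d ^ 2) * ENNReal.ofReal (1 / d ^ 2) = 1 := by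
    rw [← ENNReal.ofReal_mul (by positivity)]
    simp [hd.ne']
  simp only [Pi.mul_apply]
  rw [← one_mul (∫⁻ y, _ * f (w, y)), ← hfin, mul_assoc, ← key, ← lintegral_const_mul _ (by fun_prop)]
  refine lintegral_congr fun z => ?_
  rw [← mul_assoc]
  congr 1
  rw [← ENNReal.ofReal_mul (by positivity), ← ENNReal.ofReal_mul (by positivity)]
  congr 1
  rw [pairDensity, ← hdsq]
  have hexp : -(‖w‖ ^ 2 + ‖β * w + d * z‖ ^ 2 - 2 * (conj β * (conj w * (β * w + d * z))).re) / d ^ 2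
      = -‖w‖ ^ 2 + -‖z‖ ^ 2 := by
    rw [div_eq_iff (by positivity)]
    have hb := sq_norm_eq β
    rw [sq_norm_eq w, sq_norm_eq z, sq_norm_eq (β * w + d * z)]
    simp only [Complex.add_re, Complex.add_im, Complex.mul_re, Complex.mul_im, Complex.conj_re,
      Complex.conj_im, Complex.ofReal_re, Complex.ofReal_im]
    have hd2 : d ^ 2 = 1 - (β.re ^ 2 + β.im ^ 2) := by rw [hdsq, hb]
    linear_combination (w.re ^ 2 + w.im ^ 2) * hd2
  simp only
  rw [hexp, Real.exp_add]
  field_simp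

namespace IsComplexNormal

variable {m n : ℕ} {X : Ω → EuclideanSpace ℂ (Fin n)} {Γ : Matrix (Fin n) (Fin n) ℂ}

lemma memLp (hX : IsComplexNormal X Γ μ) (k : Fin n) : MemLp (fun ω => X ω k) 2 μ :=
  (hX.gaussian.map_fun ((EuclideanSpace.proj k : EuclideanSpace ℂ (Fin n) →L[ℂ] ℂ).restrictScalars
    ℝ)).memLp_two

/-- Linear images of complex normal vectors are complex normal. -/
lemma linear_image (hX : IsComplexNormal X Γ μ) (A : Matrix (Fin m) (Fin n) ℂ) :
    IsComplexNormal (fun ω => WithLp.toLp 2 fun i => ∑ k, A i k * X ω k) (A * Γ * Aᴴ) μ := by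
  have hL := hX.memLp
  have : IsProbabilityMeasure μ := hX.gaussian.isProbabilityMeasure
  have hi := fun k => (hL k).integrable one_le_two
  refine ⟨?_, fun i => ?_, fun i j => ?_, fun i j => ?_⟩
  · let T : EuclideanSpace ℂ (Fin n) →ₗ[ℂ] EuclideanSpace ℂ (Fin m) :=
      { toFun := fun x => WithLp.toLp 2 fun i => ∑ k, A i k * x k
        map_add' := fun x y => by ext i; simp [mul_add, Finset.sum_add_distrib]
        map_smul' := fun c x => by ext i; simp [Finset.mul_sum, mul_left_comm] }
    exact hX.gaussian.map_fun ((LinearMap.toContinuousLinearMap T).restrictScalars ℝ)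
  · simp only
    rw [integral_finsetSum _ fun k _ => (hi k).const_mul _]
    simp [integral_const_mul, hX.mean]
  · have hint := fun k l => (integrable_mul_of_memLp (hL k) (memLp_conj (hL l))).const_mul
      (A i k * conj (A j l))
    have e : ∀ ω, (∑ k, A i k * X ω k) * conj (∑ k, A j k * X ω k)
        = ∑ l, ∑ k, A i k * conj (A j l) * (X ω k * conj (X ω l)) := fun ω => by
      rw [map_sum, Finset.sum_mul_sum, Finset.sum_comm]
      refine Finset.sum_congr rfl fun l _ => Finset.sum_congr rfl fun k _ => ?_
      rw [map_mul]; ring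
    simp only [e]
    rw [integral_finsetSum _ fun l _ => integrable_finsetSum _ fun k _ => hint k l,
      Matrix.mul_apply]
    refine Finset.sum_congr rfl fun l _ => ?_
    rw [integral_finsetSum _ fun k _ => hint k l, Matrix.mul_apply, Finset.sum_mul]
    refine Finset.sum_congr rfl fun k _ => ?_
    rw [integral_const_mul, hX.covariance, Matrix.conjTranspose_apply, starRingEnd_apply]; ring
  · have hint := fun k l => (integrable_mul_of_memLp (hL k) (hL l)).const_mul (A i k * A j l)
    have e : ∀ ω, (∑ k, A i k * X ω k) * (∑ k, A j k * X ω k)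
        = ∑ k, ∑ l, A i k * A j l * (X ω k * X ω l) := fun ω => by
      rw [Finset.sum_mul_sum]
      refine Finset.sum_congr rfl fun l _ => Finset.sum_congr rfl fun k _ => ?_
      ring
    simp only [e]
    rw [integral_finsetSum _ fun l _ => integrable_finsetSum _ fun k _ => hint _ _]
    refine Finset.sum_eq_zero fun l _ => ?_
    rw [integral_finsetSum _ fun k _ => hint _ _]
    refine Finset.sum_eq_zero fun k _ => ?_
    rw [integral_const_mul, hX.pseudoCovariance, mul_zero]

/-- Uncorrelated entries of a complex normal vector are independent. -/
lemma iIndepFun_of_diagonal (hX : IsComplexNormal X Γ μ) (hΓ : ∀ i j, i ≠ j → Γ i j = 0) :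
    iIndepFun (fun i ω => X ω i) μ := by
  have : IsProbabilityMeasure μ := hX.gaussian.isProbabilityMeasure
  refine HasGaussianLaw.iIndepFun_of_covariance_inner ?_ fun i j hij x y => ?_
  · exact hX.gaussian.map_fun
      ((EuclideanSpace.equiv (Fin n) ℂ).toContinuousLinearMap.restrictScalars ℝ)
  · exact covariance_inner_eq_zero (hX.memLp i) (hX.memLp j) (hX.mean i)
      ((hX.covariance i j).trans (hΓ i j hij)) (hX.pseudoCovariance i j) x y

/-- Two independent complex normal pairs form a complex normal vector. -/
lemma append {h w : Ω → EuclideanSpace ℂ (Fin 2)} {Φ Ξ : Matrix (Fin 2) (Fin 2) ℂ}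
    (hh : IsComplexNormal h Φ μ) (hw : IsComplexNormal w Ξ μ) (hind : IndepFun h w μ) :
    IsComplexNormal (fun ω => WithLp.toLp 2 ![h ω 0, h ω 1, w ω 0, w ω 1])
      !![Φ 0 0, Φ 0 1, 0, 0; Φ 1 0, Φ 1 1, 0, 0; 0, 0, Ξ 0 0, Ξ 0 1; 0, 0, Ξ 1 0, Ξ 1 1] μ := by
  have hp := hind.hasGaussianLaw hh.gaussian hw.gaussian
  have hc : ∀ k l, ∫ ω, h ω k * conj (w ω l) ∂μ = 0 := fun k l => by
    have h1 : IndepFun (fun ω => h ω k) (fun ω => conj (w ω l)) μ :=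
      hind.comp (φ := fun x : EuclideanSpace ℂ (Fin 2) => x k)
        (ψ := fun x : EuclideanSpace ℂ (Fin 2) => conj (x l)) (by fun_prop) (by fun_prop)
    rw [h1.integral_fun_mul_eq_mul_integral (hh.memLp k).1 (memLp_conj (hw.memLp l)).1, hh.mean,
      zero_mul]
  have hc' : ∀ k l, ∫ ω, w ω k * conj (h ω l) ∂μ = 0 := fun k l => by
    have h1 : IndepFun (fun ω => w ω k) (fun ω => conj (h ω l)) μ :=
      hind.symm.comp (φ := fun x : EuclideanSpace ℂ (Fin 2) => x k)
        (ψ := fun x : EuclideanSpace ℂ (Fin 2) => conj (x l)) (by fun_prop) (by fun_prop)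
    rw [h1.integral_fun_mul_eq_mul_integral (hw.memLp k).1 (memLp_conj (hh.memLp l)).1, hw.mean,
      zero_mul]
  have hm : ∀ k l, ∫ ω, h ω k * w ω l ∂μ = 0 := fun k l => by
    have h1 : IndepFun (fun ω => h ω k) (fun ω => w ω l) μ :=
      hind.comp (φ := fun x : EuclideanSpace ℂ (Fin 2) => x k)
        (ψ := fun x : EuclideanSpace ℂ (Fin 2) => x l) (by fun_prop) (by fun_prop)
    rw [h1.integral_fun_mul_eq_mul_integral (hh.memLp k).1 (hw.memLp l).1, hh.mean, zero_mul]
  have hm' : ∀ k l, ∫ ω, w ω k * h ω l ∂μ = 0 := fun k l => by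
    simpa only [mul_comm] using hm l k
  refine ⟨?_, fun i => ?_, fun i j => ?_, fun i j => ?_⟩
  · let T : EuclideanSpace ℂ (Fin 2) × EuclideanSpace ℂ (Fin 2) →ₗ[ℂ] EuclideanSpace ℂ (Fin 4) :=
      { toFun := fun x => WithLp.toLp 2 ![x.1 0, x.1 1, x.2 0, x.2 1]
        map_add' := fun x y => by ext i; fin_cases i <;> simp
        map_smul' := fun c x => by ext i; fin_cases i <;> simp }
    exact hp.map_fun ((LinearMap.toContinuousLinearMap T).restrictScalars ℝ)
  · fin_cases i <;> simp [hh.mean, hw.mean]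
  · fin_cases i <;> fin_cases j <;> simp [hh.covariance, hw.covariance, hc, hc']
  · fin_cases i <;> fin_cases j <;> simp [hh.pseudoCovariance, hw.pseudoCovariance, hm, hm']

end IsComplexNormal

/-- The covariance of `(h, a h + b w)`. -/
noncomputable def jointCov (a φ β : ℂ) : Matrix (Fin 4) (Fin 4) ℂ :=
  !![1, conj φ, conj a, conj a * conj φ; φ, 1, conj a * φ, conj a;
    a, a * conj φ, 1, conj β; a * φ, a, β, 1]

lemma isComplexNormal_joint {h w : Ω → EuclideanSpace ℂ (Fin 2)} {φ ξ a b β : ℂ}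
    (hh : IsComplexNormal h (constCorr 2 φ) μ) (hw : IsComplexNormal w (constCorr 2 ξ) μ)
    (hind : IndepFun h w μ) (hab : a * conj a + b * conj b = 1)
    (hβ : β = a * conj a * φ + b * conj b * ξ) :
    IsComplexNormal (fun ω => WithLp.toLp 2
      ![h ω 0, h ω 1, a * h ω 0 + b * w ω 0, a * h ω 1 + b * w ω 1]) (jointCov a φ β) μ := by
  have key := (hh.append hw hind).linear_image
    !![1, 0, 0, 0; 0, 1, 0, 0; a, 0, b, 0; 0, a, 0, b]
  have hβ' : conj β = a * conj a * conj φ + b * conj b * conj ξ := by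
    rw [hβ]; simp only [map_add, map_mul, Complex.conj_conj]; ring
  convert key using 1
  · ext ω i
    fin_cases i <;> simp [Fin.sum_univ_four]
  · ext i j
    fin_cases i <;> fin_cases j <;>
      simp [jointCov, constCorr, Matrix.mul_apply, Fin.sum_univ_four, Matrix.conjTranspose_apply] <;>
      first
      | linear_combination -hab
      | linear_combination hβ
      | linear_combination hβ'
      | ring

/-- The innovation of the observed pair, together with the error of a linear estimator. -/
lemma iIndepFun_innovation {X : Fin 4 → Ω → ℂ} {a φ β c₀ c₁ : ℂ} {t : ℝ} {k : Fin 2}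
    (hX : IsComplexNormal (fun ω => WithLp.toLp 2 fun i => X i ω) (jointCov a φ β) μ)
    (h0 : c₀ + c₁ * β = conj a * constCorr 2 φ k 0)
    (h1 : c₀ * conj β + c₁ = conj a * constCorr 2 φ k 1) :
    iIndepFun ![fun ω => X 2 ω, fun ω => t * (X 3 ω - β * X 2 ω),
      fun ω => X (k.castLE (by decide)) ω - c₀ * X 2 ω - c₁ * X 3 ω] μ := by
  -- `h0` and `h1` are the normal equations of the regression on entries 2 and 3. They make the
  -- transformed covariance diagonal, which for a complex normal vector gives independence.
  have key := (hX.linear_image !![0, 0, 1, 0; 0, 0, -(t * β), t;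
    if k = 0 then 1 else 0, if k = 0 then 0 else 1, -c₀, -c₁]).iIndepFun_of_diagonal ?_
  · convert key using 1
    ext i ω
    fin_cases i <;> fin_cases k <;> simp [Fin.sum_univ_four] <;> ring
  · have h0' := congrArg conj h0
    have h1' := congrArg conj h1
    intro i j hij
    fin_cases k <;>
      simp [constCorr] at h0 h1 h0' h1' <;>
    fin_cases i <;> fin_cases j <;> first
      | exact absurd rfl hij
      | (simp [jointCov, Matrix.mul_apply, Fin.sum_univ_four, Matrix.conjTranspose_apply]
         <;> first
         | ring1
         | linear_combination -h0
         | linear_combination -h0'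
         | linear_combination t * conj β * h0 - t * h1
         | linear_combination t * β * h0' - t * h1')

/-- The first entry and the normalized innovation are independent standard complex normals, and the
pair is their Cholesky image. -/
lemma map_pair_eq_pairLaw {X : Fin 4 → Ω → ℂ} {a φ β : ℂ} (hβ : ‖β‖ < 1)
    (hX : IsComplexNormal (fun ω => WithLp.toLp 2 fun i => X i ω) (jointCov a φ β) μ)
    (hind : IndepFun (fun ω => X 2 ω)
      (fun ω => ((√(1 - ‖β‖ ^ 2))⁻¹ : ℝ) * (X 3 ω - β * X 2 ω)) μ) :
    μ.map (fun ω => (X 2 ω, X 3 ω)) = pairLaw β := by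
  have : IsProbabilityMeasure μ := hX.gaussian.isProbabilityMeasure
  have hD := one_sub_norm_sq_pos hβ
  have hd := Real.sqrt_pos.2 hD
  have hdsq := Real.sq_sqrt hD.le
  set d := √(1 - ‖β‖ ^ 2)
  have hm2 := (hX.memLp 2).aemeasurable
  have hm3 := (hX.memLp 3).aemeasurable
  have hdc : (d : ℂ) ≠ 0 := by exact_mod_cast hd.ne'
  have hdβ : (d : ℂ) ^ 2 = 1 - β * conj β := by
    rw [Complex.mul_conj, Complex.normSq_eq_norm_sq]
    exact_mod_cast hdsq
  have hG := hX.linear_image !![0, 0, 1, 0; 0, 0, -(((d⁻¹ : ℝ) : ℂ) * β), ((d⁻¹ : ℝ) : ℂ)]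
  have e0 : ∀ ω, ∑ k, (!![0, 0, 1, 0; 0, 0, -(((d⁻¹ : ℝ) : ℂ) * β), ((d⁻¹ : ℝ) : ℂ)] :
      Matrix (Fin 2) (Fin 4) ℂ) 0 k * X k ω = X 2 ω := fun ω => by simp [Fin.sum_univ_four]
  have e1 : ∀ ω, ∑ k, (!![0, 0, 1, 0; 0, 0, -(((d⁻¹ : ℝ) : ℂ) * β), ((d⁻¹ : ℝ) : ℂ)] :
      Matrix (Fin 2) (Fin 4) ℂ) 1 k * X k ω = (d⁻¹ : ℝ) * (X 3 ω - β * X 2 ω) := fun ω => by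
    simp [Fin.sum_univ_four]; ring
  have hg : ∀ i, HasGaussianLaw (fun ω => (WithLp.toLp 2 fun i => ∑ k,
      (!![0, 0, 1, 0; 0, 0, -(((d⁻¹ : ℝ) : ℂ) * β), ((d⁻¹ : ℝ) : ℂ)] :
      Matrix (Fin 2) (Fin 4) ℂ) i k * X k ω : EuclideanSpace ℂ (Fin 2)) i) μ := fun i =>
    hG.gaussian.map_fun ((EuclideanSpace.proj i : EuclideanSpace ℂ (Fin 2) →L[ℂ] ℂ).restrictScalars ℝ)
  have l0 := map_eq_stdComplexNormal (hg 0) (hG.mean 0) ((hG.covariance 0 0).trans (by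
    simp [jointCov, Matrix.mul_apply, Fin.sum_univ_four, Matrix.conjTranspose_apply]))
    (hG.pseudoCovariance 0 0)
  have l1 := map_eq_stdComplexNormal (hg 1) (hG.mean 1) ((hG.covariance 1 1).trans (by
    simp [jointCov, Matrix.mul_apply, Fin.sum_univ_four, Matrix.conjTranspose_apply]
    field_simp
    linear_combination -hdβ)) (hG.pseudoCovariance 1 1)
  simp only [e0, e1] at l0 l1
  rw [indepFun_iff_map_prod_eq_prod_map_map hm2 (by fun_prop), l0, l1] at hind
  rw [← map_prod_eq_pairLaw hβ, ← hind, AEMeasurable.map_map_of_aemeasurable (by fun_prop)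
    (by fun_prop)]
  congr 1
  ext ω
  · rfl
  · simp only [Function.comp_apply, Complex.ofReal_inv]
    field_simp
    ring

/-! ### Measurability of the cells, null boundaries and the moments of the channel. -/

lemma measurable_sign : Measurable Real.sign :=
  Measurable.ite measurableSet_Iio measurable_const
    (Measurable.ite measurableSet_Ioi measurable_const measurable_const)

lemma measurable_quantize : Measurable quantize := by
  have h : quantize = fun z => Complex.equivRealProdCLM.symm (Real.sign z.re, Real.sign z.im) := by
    ext z
    rw [Complex.equivRealProdCLM_symm_apply, quantize, Complex.mk_eq_add_mul_I]
  rw [h]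
  exact Complex.equivRealProdCLM.symm.continuous.measurable.comp
    ((measurable_sign.comp Complex.measurable_re).prodMk
      (measurable_sign.comp Complex.measurable_im))

lemma sign_mul_of_pos {c : ℝ} (hc : 0 < c) (x : ℝ) : Real.sign (c * x) = Real.sign x := by
  have h1 : c * x < 0 ↔ x < 0 := by simpa using mul_lt_mul_iff_right₀ hc (b := x) (c := 0)
  simp only [Real.sign, h1, mul_pos_iff_of_pos_left hc]

lemma quantize_mul_of_pos {c : ℝ} (hc : 0 < c) (z : ℂ) : quantize (c * z) = quantize z := by
  simp [quantize, sign_mul_of_pos hc]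

lemma measurableSet_cell (ρ : Fin 2 → ℂ) : MeasurableSet (cell ρ) :=
  (measurableSet_eq_fun (measurable_quantize.comp measurable_fst) measurable_const).inter
    (measurableSet_eq_fun (measurable_quantize.comp measurable_snd) measurable_const)

lemma quantize_mem_symbols {z : ℂ} (hre : z.re ≠ 0) (him : z.im ≠ 0) : quantize z ∈ symbols := by
  rcases Real.sign_apply_eq_of_ne_zero _ hre with h | h <;>
    rcases Real.sign_apply_eq_of_ne_zero _ him with h' | h' <;>
    simp [quantize, symbols, h, h']

/-- The kernel is a proper subspace, hence Lebesgue null. Applied to the four real coordinates, it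
excludes the value 0 of the sign. -/
lemma ae_pairLaw_ne_zero (β : ℂ) (L : ℂ × ℂ →ₗ[ℝ] ℝ) (hL : L ≠ 0) :
    ∀ᵐ z ∂pairLaw β, L z ≠ 0 := by
  refine (withDensity_absolutelyContinuous _ _).ae_le (?_ : ∀ᵐ z, L z ≠ 0)
  have := Measure.addHaar_submodule ((volume : Measure ℂ).prod (volume : Measure ℂ)) (LinearMap.ker L)
    (fun h => hL (LinearMap.ker_eq_top.1 h))
  rw [ae_iff, Measure.volume_eq_prod]
  exact measure_mono_null (fun z hz => by simpa using hz) this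

lemma ae_pairLaw_mem_symbols (β : ℂ) :
    ∀ᵐ z ∂pairLaw β, quantize z.1 ∈ symbols ∧ quantize z.2 ∈ symbols := by
  have h (L : ℂ × ℂ →ₗ[ℝ] ℝ) (z : ℂ × ℂ) (hz : L z ≠ 0) := ae_pairLaw_ne_zero β L
    fun h0 => hz (by rw [h0]; rfl)
  filter_upwards [h (Complex.reLm ∘ₗ LinearMap.fst ℝ ℂ ℂ) (1, 0) (by simp),
    h (Complex.imLm ∘ₗ LinearMap.fst ℝ ℂ ℂ) (Complex.I, 0) (by simp),
    h (Complex.reLm ∘ₗ LinearMap.snd ℝ ℂ ℂ) (0, 1) (by simp),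
    h (Complex.imLm ∘ₗ LinearMap.snd ℝ ℂ ℂ) (0, Complex.I) (by simp)] with z h1 h2 h3 h4
  exact ⟨quantize_mem_symbols h1 h2, quantize_mem_symbols h3 h4⟩

/-- A centered variable independent of `Z` integrates to `0` over the events in `σ(Z)`. -/
lemma setIntegral_eq_zero_of_indepFun [IsFiniteMeasure μ] {F : Type*} [MeasurableSpace F]
    {e : Ω → ℂ} {Z : Ω → F} (hind : IndepFun e Z μ) (he : AEStronglyMeasurable e μ)
    (hZ : Measurable Z) (h0 : ∫ ω, e ω ∂μ = 0) {C : Set F} (hC : MeasurableSet C) :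
    ∫ ω in Z ⁻¹' C, e ω ∂μ = 0 := by
  have hm : Measurable (C.indicator fun _ => (1 : ℂ)) := measurable_const.indicator hC
  have h := (hind.comp measurable_id hm).integral_fun_mul_eq_mul_integral he
    (hm.comp hZ).aestronglyMeasurable
  rw [← integral_indicator (hZ hC)]
  simp only [Function.comp_apply, id_eq, h0, zero_mul] at h
  rw [← h]
  congr 1 with ω
  by_cases hω : Z ω ∈ C <;> simp [hω]

/-- The channel integrated over the event that the observed pair is quantized to `ρ`. -/
lemma setIntegral_channel {X : Fin 4 → Ω → ℂ} {a φ β : ℂ} (hβ : ‖β‖ < 1)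
    (hX : IsComplexNormal (fun ω => WithLp.toLp 2 fun i => X i ω) (jointCov a φ β) μ)
    (hmeas : ∀ i, Measurable (X i)) :
    μ.map (fun ω => (X 2 ω, X 3 ω)) = pairLaw β ∧
    ∀ ρ ∈ observations 2, ∀ k : Fin 2,
      ∫ ω in (fun ω => (X 2 ω, X 3 ω)) ⁻¹' cell ρ, X (k.castLE (by decide)) ω ∂μ
        = conj a / (2 * √Real.pi) * numVec φ β ρ k := by
  have : IsProbabilityMeasure μ := hX.gaussian.isProbabilityMeasure
  have hD := one_sub_norm_sq_pos hβ
  set D : ℝ := 1 - ‖β‖ ^ 2 with hDdef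
  have hDc : (D : ℂ) ≠ 0 := by exact_mod_cast hD.ne'
  have hDβ : (D : ℂ) = 1 - β * conj β := by
    rw [Complex.mul_conj, Complex.normSq_eq_norm_sq, hDdef]
    push_cast; rfl
  -- The solution of the normal equations by the inverse of the 2 × 2 covariance of the observed
  -- pair, of determinant D.
  let c₀ : Fin 2 → ℂ := fun k => conj a * (constCorr 2 φ k 0 - constCorr 2 φ k 1 * β) / D
  let c₁ : Fin 2 → ℂ := fun k => conj a * (constCorr 2 φ k 1 - constCorr 2 φ k 0 * conj β) / D
  have hI (k : Fin 2) := iIndepFun_innovation (t := (√(1 - ‖β‖ ^ 2))⁻¹) (c₀ := c₀ k) (c₁ := c₁ k)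
    (k := k) hX
    (by simp only [c₀, c₁]; field_simp; rw [hDβ]; ring)
    (by simp only [c₀, c₁]; field_simp; rw [hDβ]; ring)
  have hZ : Measurable fun ω => (X 2 ω, X 3 ω) := (hmeas 2).prodMk (hmeas 3)
  have hmap : μ.map (fun ω => (X 2 ω, X 3 ω)) = pairLaw β :=
    map_pair_eq_pairLaw hβ hX ((hI 0).indepFun (i := 0) (j := 1) (by decide))
  refine ⟨hmap, fun ρ hρ k => ?_⟩
  have hL : ∀ i, Integrable (X i) μ := fun i => (hX.memLp i).integrable one_le_two
  have hE : Integrable (fun ω => c₀ k * X 2 ω) μ := (hL 2).const_mul _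
  have hE' : Integrable (fun ω => c₁ k * X 3 ω) μ := (hL 3).const_mul _
  have hEs : Integrable (fun ω => X (k.castLE (by decide)) ω - c₀ k * X 2 ω) μ := (hL _).sub hE
  have hd := (Real.sqrt_pos.2 hD).ne'
  have hind : IndepFun (fun ω => X (k.castLE (by decide)) ω - c₀ k * X 2 ω - c₁ k * X 3 ω)
      (fun ω => (X 2 ω, X 3 ω)) μ := by
    have h := (hI k).indepFun_prodMk (fun i => by
      have := hmeas (k.castLE (by decide)); have := hmeas 2; have := hmeas 3
      fin_cases i <;> (simp; fun_prop)) 0 1 2 (by decide) (by decide)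
    -- The observed pair is recovered from the first entry and the innovation, so the regression
    -- error is independent of it.
    have h' := h.symm.comp (φ := id) (ψ := fun g : ℂ × ℂ => (g.1, β * g.1 + √D * g.2))
      measurable_id (by fun_prop)
    convert h' using 1
    · rfl
    · funext ω
      refine Prod.ext rfl ?_
      have : ((√D : ℝ) : ℂ) ≠ 0 := by exact_mod_cast hd
      simp only [Function.comp_apply, Matrix.cons_val_zero, Matrix.cons_val_one, ← hDdef,
        Complex.ofReal_inv]
      field_simp
      ring
  have hz := setIntegral_eq_zero_of_indepFun hind (hEs.sub hE').1 hZ (by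
      have m := hX.mean
      simp only at m
      rw [integral_sub hEs hE', integral_sub (hL _) hE, integral_const_mul, integral_const_mul, m, m, m]
      simp) (measurableSet_cell ρ)
  rw [integral_sub hEs.integrableOn hE'.integrableOn, integral_sub (hL _).integrableOn hE.integrableOn,
    sub_sub, sub_eq_zero, ← integral_add hE.integrableOn hE'.integrableOn] at hz
  have i1 : Integrable (fun z => z.1) (pairLaw β) := by
    rw [← hmap]
    exact (integrable_map_measure (by fun_prop) hZ.aemeasurable).2 (hL 2)
  have i2 : Integrable (fun z => z.2) (pairLaw β) := by
    rw [← hmap]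
    exact (integrable_map_measure (by fun_prop) hZ.aemeasurable).2 (hL 3)
  have hdec := setIntegral_cell_decorrelated hβ i1 i2 hρ
  have htr := setIntegral_map (μ := μ) (g := fun ω => (X 2 ω, X 3 ω))
    (f := fun z => c₀ k * z.1 + c₁ k * z.2) (measurableSet_cell ρ) (by fun_prop) hZ.aemeasurable
  rw [hz, ← htr, hmap]
  -- Regrouping by rows of Φ turns the regression into the decorrelated pair, whose moments are
  -- known.
  have e : ∀ z : ℂ × ℂ, c₀ k * z.1 + c₁ k * z.2
      = conj a * constCorr 2 φ k 0 * ((z.1 - conj β * z.2) / (D : ℂ))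
        + conj a * constCorr 2 φ k 1 * ((z.2 - β * z.1) / (D : ℂ)) := fun z => by
    simp only [c₀, c₁]; field_simp; ring
  simp only [e]
  rw [integral_add, integral_const_mul, integral_const_mul, hdec.1, hdec.2, numVec]
  · simp [Matrix.mulVec, dotProduct, Fin.sum_univ_two]
    ring
  · exact (((i1.sub (i2.const_mul _)).div_const _).const_mul _).integrableOn
  · exact (((i2.sub (i1.const_mul _)).div_const _).const_mul _).integrableOn

/-! ### Conditional mean and mean-square error for a finitely valued observation. -/

/-- Decomposition of an integral along a variable with finitely many values. -/
lemma setIntegral_preimage_eq_sum {F E : Type*} [MeasurableSpace F] [MeasurableSingletonClass F]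
    [NormedAddCommGroup E] [NormedSpace ℝ E] {r : Ω → F} (hr : Measurable r) {O : Finset F}
    (hO : ∀ᵐ ω ∂μ, r ω ∈ O) {f : Ω → E} (hf : Integrable f μ) (T : Set F) [DecidablePred (· ∈ T)] :
    ∫ ω in r ⁻¹' T, f ω ∂μ = ∑ ρ ∈ O with ρ ∈ T, ∫ ω in r ⁻¹' {ρ}, f ω ∂μ := by
  rw [← integral_biUnion_finset _ (fun ρ _ => hr (measurableSet_singleton ρ))
    (fun ρ _ ρ' _ hne => Disjoint.preimage r (by simpa using hne)) (fun _ _ => hf.integrableOn)]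
  refine setIntegral_congr_set ?_
  filter_upwards [hO] with ω hω
  refine propext (?_ : ω ∈ r ⁻¹' T ↔ ω ∈ ⋃ ρ ∈ O.filter (· ∈ T), r ⁻¹' {ρ})
  simp [hω]

lemma integral_eq_sum_preimage {F E : Type*} [MeasurableSpace F] [MeasurableSingletonClass F]
    [NormedAddCommGroup E] [NormedSpace ℝ E] {r : Ω → F} (hr : Measurable r) {O : Finset F}
    (hO : ∀ᵐ ω ∂μ, r ω ∈ O) {f : Ω → E} (hf : Integrable f μ) :
    ∫ ω, f ω ∂μ = ∑ ρ ∈ O, ∫ ω in r ⁻¹' {ρ}, f ω ∂μ := by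
  classical
  simpa using setIntegral_preimage_eq_sum hr hO hf Set.univ

lemma mmseEstimator_eq {n : ℕ} (h : Ω → EuclideanSpace ℂ (Fin n)) (r : Ω → Fin n → ℂ)
    (ρ : Fin n → ℂ) :
    mmseEstimator μ h r ρ = (μ.real (r ⁻¹' {ρ}))⁻¹ • ∫ ω in r ⁻¹' {ρ}, h ω ∂μ := by
  rw [mmseEstimator, ProbabilityTheory.cond, integral_smul_measure, ENNReal.toReal_inv]
  rfl

/-- The conditional expectation given a variable with finitely many values. -/
lemma condExp_comap_eq [IsProbabilityMeasure μ] {n : ℕ} {h : Ω → EuclideanSpace ℂ (Fin n)}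
    {r : Ω → Fin n → ℂ} (hr : Measurable r) {O : Finset (Fin n → ℂ)} (hO : ∀ᵐ ω ∂μ, r ω ∈ O)
    (hpos : ∀ ρ ∈ O, 0 < μ.real (r ⁻¹' {ρ})) (hh : Integrable h μ)
    {G : (Fin n → ℂ) → EuclideanSpace ℂ (Fin n)} (hG : Measurable G)
    (hGO : ∀ ρ ∈ O, mmseEstimator μ h r ρ = G ρ) :
    μ[h | MeasurableSpace.comap r inferInstance] =ᵐ[μ] fun ω => G (r ω) := by
  classical
  have hGi : Integrable (fun ω => G (r ω)) μ := by
    refine Integrable.of_bound (hG.comp hr).aestronglyMeasurable (∑ ρ ∈ O, ‖G ρ‖) ?_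
    filter_upwards [hO] with ω hω
    exact Finset.single_le_sum (f := fun ρ => ‖G ρ‖) (fun _ _ => norm_nonneg _) hω
  refine (ae_eq_condExp_of_forall_setIntegral_eq hr.comap_le hh (fun _ _ _ => hGi.integrableOn)
    ?_ ?_).symm
  · rintro _ ⟨T, -, rfl⟩ -
    rw [setIntegral_preimage_eq_sum hr hO hGi, setIntegral_preimage_eq_sum hr hO hh]
    refine Finset.sum_congr rfl fun ρ hρ => ?_
    have hρ := (Finset.mem_filter.1 hρ).1
    rw [setIntegral_congr_fun (g := fun _ => G ρ) (hr (measurableSet_singleton ρ))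
      fun ω hω => congrArg G hω, setIntegral_const, ← hGO ρ hρ, mmseEstimator_eq,
      smul_inv_smul₀ (hpos ρ hρ).ne']
  · exact (hG.comp (comap_measurable r)).aestronglyMeasurable

/-- Orthogonality principle for a variable with finitely many values. -/
lemma integral_norm_sub_mmseEstimator [IsProbabilityMeasure μ] {n : ℕ}
    {h : Ω → EuclideanSpace ℂ (Fin n)} {r : Ω → Fin n → ℂ} (hr : Measurable r)
    {O : Finset (Fin n → ℂ)} (hO : ∀ᵐ ω ∂μ, r ω ∈ O)
    (hpos : ∀ ρ ∈ O, 0 < μ.real (r ⁻¹' {ρ})) (hh : MemLp h 2 μ)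
    {G : (Fin n → ℂ) → EuclideanSpace ℂ (Fin n)} (hG : Measurable G)
    (hGO : ∀ ρ ∈ O, mmseEstimator μ h r ρ = G ρ) :
    Integrable (fun ω => ‖h ω - mmseEstimator μ h r (r ω)‖ ^ 2) μ ∧
    ∫ ω, ‖h ω - mmseEstimator μ h r (r ω)‖ ^ 2 ∂μ
      = ∫ ω, ‖h ω‖ ^ 2 ∂μ - ∑ ρ ∈ O, μ.real (r ⁻¹' {ρ}) * ‖G ρ‖ ^ 2 := by
  have hGi : MemLp (fun ω => G (r ω)) 2 μ := by
    refine MemLp.of_bound (hG.comp hr).aestronglyMeasurable (∑ ρ ∈ O, ‖G ρ‖) ?_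
    filter_upwards [hO] with ω hω
    exact Finset.single_le_sum (f := fun ρ => ‖G ρ‖) (fun _ _ => norm_nonneg _) hω
  have hae : (fun ω => ‖h ω - mmseEstimator μ h r (r ω)‖ ^ 2)
      =ᵐ[μ] fun ω => ‖h ω - G (r ω)‖ ^ 2 := by
    filter_upwards [hO] with ω hω
    rw [hGO _ hω]
  have hint : Integrable (fun ω => ‖h ω - G (r ω)‖ ^ 2) μ :=
    (hh.sub hGi).integrable_norm_pow (p := 2) two_ne_zero
  have hsq : Integrable (fun ω => ‖h ω‖ ^ 2) μ := hh.integrable_norm_pow (p := 2) two_ne_zero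
  have hi := hh.integrable one_le_two
  refine ⟨hint.congr hae.symm, ?_⟩
  rw [integral_congr_ae hae, integral_eq_sum_preimage hr hO hint,
    integral_eq_sum_preimage hr hO hsq, ← Finset.sum_sub_distrib]
  refine Finset.sum_congr rfl fun ρ hρ => ?_
  have hE : ∫ ω in r ⁻¹' {ρ}, h ω ∂μ = μ.real (r ⁻¹' {ρ}) • G ρ := by
    rw [← hGO ρ hρ, mmseEstimator_eq, smul_inv_smul₀ (hpos ρ hρ).ne']
  -- On one event the estimate is constant; by `hE` the cross term integrates to twice the
  -- probability times ‖G ρ‖², so one copy survives with a minus sign.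
  have e : ∀ ω ∈ r ⁻¹' {ρ}, ‖h ω - G (r ω)‖ ^ 2
      = ‖h ω‖ ^ 2 - (2 * (inner ℂ (G ρ) (h ω)).re - ‖G ρ‖ ^ 2) := fun ω hω => by
    rw [(hω : r ω = ρ), norm_sub_sq (𝕜 := ℂ), ← inner_conj_symm, RCLike.conj_re, RCLike.re_eq_complex_re]
    ring
  have hin : Integrable (fun ω => inner ℂ (G ρ) (h ω)) μ := hi.const_inner _
  have hre : Integrable (fun ω => (inner ℂ (G ρ) (h ω)).re) μ := hin.re
  have hdiff : Integrable (fun ω => 2 * (inner ℂ (G ρ) (h ω)).re - ‖G ρ‖ ^ 2) μ :=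
    (hre.const_mul _).sub (integrable_const _)
  have hI : ∫ ω in r ⁻¹' {ρ}, (inner ℂ (G ρ) (h ω)).re ∂μ
      = μ.real (r ⁻¹' {ρ}) * ‖G ρ‖ ^ 2 := by
    have h1 := Complex.reCLM.integral_comp_comm (hin.integrableOn (s := r ⁻¹' {ρ}))
    simp only [Complex.reCLM_apply] at h1
    rw [h1, integral_inner hi.integrableOn, hE, inner_smul_right_eq_smul, Complex.real_smul,
      Complex.re_ofReal_mul, inner_self_eq_norm_sq_to_K]
    norm_cast
  rw [setIntegral_congr_fun (hr (measurableSet_singleton ρ)) e,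
    integral_sub hsq.integrableOn hdiff.integrableOn,
    integral_sub (hre.const_mul _).integrableOn (integrable_const _).integrableOn,
    integral_const_mul, hI, setIntegral_const, smul_eq_mul]
  ring

lemma measurable_explicitEstimator (γ : ℝ) (s φ ξ : ℂ) :
    Measurable (explicitEstimator γ s φ ξ) := by
  have h0 : Measurable (uVec (betaC γ φ ξ)) := by
    refine measurable_pi_lambda _ fun k => ?_
    fin_cases k <;> (simp [uVec]; fun_prop)
  have h1 : Measurable (probExpr (betaC γ φ ξ)) := by unfold probExpr; fun_prop
  have h2 : Measurable (numVec φ (betaC γ φ ξ)) := by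
    refine (WithLp.measurable_toLp 2 _).comp ?_
    refine measurable_pi_lambda _ fun k => ?_
    simp only [Matrix.mulVec, dotProduct, Fin.sum_univ_two, Pi.add_apply, Pi.smul_apply]
    fun_prop
  unfold explicitEstimator
  fun_prop

/-! ### Application to the one-bit channel model. -/

lemma norm_betaC_lt {γ : ℝ} (hγ : 0 < γ) {φ ξ : ℂ} (hφ : ‖φ‖ < 1) (hξ : ‖ξ‖ < 1) :
    ‖betaC γ φ ξ‖ < 1 := by
  have h : ‖(1 + γ : ℂ)‖ = 1 + γ := by
    rw [← Complex.ofReal_one, ← Complex.ofReal_add, Complex.norm_real, Real.norm_of_nonneg (by positivity)]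
  rw [betaC, norm_div, h, div_lt_one (by positivity)]
  calc ‖(γ : ℂ) * φ + ξ‖ ≤ γ * ‖φ‖ + ‖ξ‖ := by
        refine (norm_add_le _ _).trans_eq ?_
        rw [norm_mul, Complex.norm_real, Real.norm_of_nonneg hγ.le]
    _ < 1 + γ := by nlinarith

lemma integral_norm_sq_of_isComplexNormal {h : Ω → EuclideanSpace ℂ (Fin 2)} {φ : ℂ}
    (hh : IsComplexNormal h (constCorr 2 φ) μ) : ∫ ω, ‖h ω‖ ^ 2 ∂μ = 2 := by
  have hi k := integrable_mul_of_memLp (hh.memLp k) (memLp_conj (hh.memLp k))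
  have e : ∀ k, ∫ ω, ‖h ω k‖ ^ 2 ∂μ = 1 := fun k => by
    have h1 := Complex.reCLM.integral_comp_comm (hi k)
    rw [hh.covariance] at h1
    simpa [Complex.mul_conj, Complex.normSq_eq_norm_sq, constCorr, ← Complex.ofReal_pow] using h1
  have hs : ∀ k, Integrable (fun ω => ‖h ω k‖ ^ 2) μ := fun k =>
    (hh.memLp k).integrable_norm_pow (p := 2) two_ne_zero
  simp only [EuclideanSpace.norm_sq_eq, Fin.sum_univ_two]
  rw [integral_add (hs 0) (hs 1), e, e]
  norm_num

lemma measurable_observe (γ : ℝ) (s : ℂ) {h w : Ω → EuclideanSpace ℂ (Fin 2)} (hh : Measurable h)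
    (hw : Measurable w) : Measurable (observe γ s h w) :=
  measurable_pi_lambda _ fun k => measurable_quantize.comp (by fun_prop)

/-- The law of the observation and the first moments of the channel on its events. -/
lemma observe_law [IsProbabilityMeasure μ] {γ : ℝ} (hγ : 0 < γ) {s : ℂ} (hs : ‖s‖ = 1)
    {φ ξ : ℂ} (hφ : ‖φ‖ < 1) (hξ : ‖ξ‖ < 1) {h w : Ω → EuclideanSpace ℂ (Fin 2)}
    (hh : Measurable h) (hw : Measurable w) (hhlaw : IsComplexNormal h (constCorr 2 φ) μ)
    (hwlaw : IsComplexNormal w (constCorr 2 ξ) μ) (hindep : IndepFun h w μ) :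
    (∀ᵐ ω ∂μ, observe γ s h w ω ∈ observations 2) ∧
    ∀ ρ ∈ observations 2,
      μ.real (observe γ s h w ⁻¹' {ρ}) = probExpr (betaC γ φ ξ) ρ ∧
      ∫ ω in observe γ s h w ⁻¹' {ρ}, h ω ∂μ
        = (conj s * ((√(γ / (4 * Real.pi * (1 + γ))) : ℝ) : ℂ)) • numVec φ (betaC γ φ ξ) ρ := by
  have hγ1 : 0 < 1 + γ := by positivity
  have hβ := norm_betaC_lt hγ hφ hξ
  set c : ℝ := √(1 + γ) with hc
  have hcpos : 0 < c := Real.sqrt_pos.2 hγ1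
  have hcc : (c : ℂ) * c = 1 + γ := by exact_mod_cast Real.mul_self_sqrt hγ1.le
  have hgg : ((√γ : ℝ) : ℂ) * (√γ : ℝ) = γ := by exact_mod_cast Real.mul_self_sqrt hγ.le
  have hc0 : (c : ℂ) ≠ 0 := by exact_mod_cast hcpos.ne'
  have hss : s * conj s = 1 := by rw [Complex.mul_conj, Complex.normSq_eq_norm_sq, hs]; simp
  have hγ1c : (1 + γ : ℂ) ≠ 0 := by exact_mod_cast hγ1.ne'
  -- Scaling by 1/√(1+γ) makes each observed entry of unit variance, with |a|² = γ/(1+γ) and |b|² =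
  -- 1/(1+γ), so the correlation becomes β_c; quantization ignores the positive factor.
  let a : ℂ := (√γ : ℝ) * s / c
  let b : ℂ := 1 / c
  have haa : a * conj a = γ / (1 + γ) := by
    simp only [a, map_div₀, map_mul, Complex.conj_ofReal]
    rw [div_mul_div_comm, mul_mul_mul_comm, hgg, hss, hcc, mul_one]
  have hbb : b * conj b = 1 / (1 + γ) := by
    simp only [b, map_div₀, map_one, Complex.conj_ofReal]
    rw [div_mul_div_comm, hcc, mul_one]
  let X : Fin 4 → Ω → ℂ := fun i ω =>
    ![h ω 0, h ω 1, a * h ω 0 + b * w ω 0, a * h ω 1 + b * w ω 1] i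
  have hX : IsComplexNormal (fun ω => WithLp.toLp 2 fun i => X i ω)
      (jointCov a φ (betaC γ φ ξ)) μ :=
    isComplexNormal_joint hhlaw hwlaw hindep
      (by rw [haa, hbb]; field_simp; ring) (by rw [haa, hbb, betaC]; field_simp)
  have hXm : ∀ i, Measurable (X i) := fun i => by
    fin_cases i <;> simp only [X] <;> simp <;> fun_prop
  have hZ : Measurable fun ω => (X 2 ω, X 3 ω) := (hXm 2).prodMk (hXm 3)
  obtain ⟨hmap, hint⟩ := setIntegral_channel hβ hX hXm
  have hq : ∀ ω, (quantize (X 2 ω) = observe γ s h w ω 0) ∧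
      (quantize (X 3 ω) = observe γ s h w ω 1) := fun ω => by
    constructor
    all_goals
      rw [observe, ← quantize_mul_of_pos (inv_pos.2 hcpos) ((√γ : ℝ) * s * h ω _ + w ω _)]
      congr 1
      simp only [X, a, b, Complex.ofReal_inv]
      simp
      field_simp
  have hpre : ∀ ρ, observe γ s h w ⁻¹' {ρ} = (fun ω => (X 2 ω, X 3 ω)) ⁻¹' cell ρ := fun ρ => by
    ext ω
    simp only [Set.mem_preimage, Set.mem_singleton_iff, cell, Set.mem_ofPred_eq, (hq ω).1,
      (hq ω).2, funext_iff, Fin.forall_fin_two]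
  refine ⟨?_, fun ρ hρ => ⟨?_, ?_⟩⟩
  · have hae := ae_pairLaw_mem_symbols (betaC γ φ ξ)
    rw [← hmap] at hae
    filter_upwards [ae_of_ae_map hZ.aemeasurable hae] with ω hω
    rw [(hq ω).1, (hq ω).2] at hω
    exact mem_observations_two.2 hω
  · rw [hpre, ← map_measureReal_apply hZ (measurableSet_cell ρ), hmap, pairLaw_real_cell hβ hρ]
  · ext k
    have hi : ∀ k, Integrable (fun ω => h ω k) μ := fun k =>
      (hhlaw.memLp k).integrable one_le_two
    have hk := hint ρ hρ k
    rw [← hpre] at hk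
    have hXk : ∀ ω, X (k.castLE (by decide)) ω = h ω k := fun ω => by fin_cases k <;> rfl
    simp only [hXk] at hk
    rw [eval_integral_piLp fun k => (hi k).integrableOn, hk, PiLp.smul_apply, smul_eq_mul]
    congr 1
    have hsq : √(γ / (4 * Real.pi * (1 + γ))) = √γ / (c * (2 * √Real.pi)) := by
      rw [Real.sqrt_div hγ.le, Real.sqrt_mul (by positivity), Real.sqrt_mul (by norm_num),
        show (4 : ℝ) = 2 ^ 2 by norm_num, Real.sqrt_sq (by norm_num), hc]
      ring_nf
    simp only [a, hsq, map_div₀, map_mul, Complex.conj_ofReal]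
    push_cast
    field_simp

end OneBitChannel

theorem proposition1 {Ω : Type*} [mΩ : MeasurableSpace Ω] (μ : Measure Ω) [IsProbabilityMeasure μ]
    (γ : ℝ) (hγ : 0 < γ) (s : ℂ) (hs : ‖s‖ = 1)
    (φ ξ : ℂ) (hφ : ‖φ‖ < 1) (hξ : ‖ξ‖ < 1)
    (h w : Ω → EuclideanSpace ℂ (Fin 2)) (hh : Measurable h) (hw : Measurable w)
    (hhlaw : OneBitChannel.IsComplexNormal h (OneBitChannel.constCorr 2 φ) μ)
    (hwlaw : OneBitChannel.IsComplexNormal w (OneBitChannel.constCorr 2 ξ) μ)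
    (hindep : IndepFun h w μ) :
    -- the probability of each observation vector, and the estimator at it
    (∀ ρ ∈ OneBitChannel.observations 2,
      0 < OneBitChannel.probExpr (OneBitChannel.betaC γ φ ξ) ρ ∧
      μ.real (OneBitChannel.observe γ s h w ⁻¹' {ρ})
        = OneBitChannel.probExpr (OneBitChannel.betaC γ φ ξ) ρ ∧
      OneBitChannel.mmseEstimator μ h (OneBitChannel.observe γ s h w) ρ
        = OneBitChannel.explicitEstimator γ s φ ξ ρ) ∧
    -- the same estimator as the conditional expectation of the channel given the observation
    Integrable h μ ∧
    (μ[h | MeasurableSpace.comap (OneBitChannel.observe γ s h w) inferInstance]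
      =ᵐ[μ] fun ω => OneBitChannel.explicitEstimator γ s φ ξ (OneBitChannel.observe γ s h w ω)) ∧
    -- the resulting mean-square error per dimension
    Integrable (fun ω => ‖h ω - OneBitChannel.mmseEstimator μ h (OneBitChannel.observe γ s h w)
      (OneBitChannel.observe γ s h w ω)‖ ^ 2) μ ∧
    OneBitChannel.mmse μ h (OneBitChannel.observe γ s h w)
      = 1 - γ / (8 * Real.pi * (1 + γ)) * ∑ ρ ∈ OneBitChannel.observations 2,
          ‖OneBitChannel.numVec φ (OneBitChannel.betaC γ φ ξ) ρ‖ ^ 2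
            / OneBitChannel.probExpr (OneBitChannel.betaC γ φ ξ) ρ := by
  classical
  obtain ⟨hO, hlaw⟩ := OneBitChannel.observe_law hγ hs hφ hξ hh hw hhlaw hwlaw hindep
  have hr := OneBitChannel.measurable_observe γ s hh hw
  have hβ := OneBitChannel.norm_betaC_lt hγ hφ hξ
  have hP : ∀ ρ ∈ OneBitChannel.observations 2,
      0 < OneBitChannel.probExpr (OneBitChannel.betaC γ φ ξ) ρ :=
    fun ρ hρ => OneBitChannel.probExpr_pos hβ hρ
  have hpos : ∀ ρ ∈ OneBitChannel.observations 2,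
      0 < μ.real (OneBitChannel.observe γ s h w ⁻¹' {ρ}) :=
    fun ρ hρ => by rw [(hlaw ρ hρ).1]; exact hP ρ hρ
  have hG : ∀ ρ ∈ OneBitChannel.observations 2,
      OneBitChannel.mmseEstimator μ h (OneBitChannel.observe γ s h w) ρ
        = OneBitChannel.explicitEstimator γ s φ ξ ρ := fun ρ hρ => by
    rw [OneBitChannel.mmseEstimator_eq, (hlaw ρ hρ).1, (hlaw ρ hρ).2,
      OneBitChannel.explicitEstimator, ← Complex.coe_smul, smul_smul, Complex.ofReal_inv,
      inv_mul_eq_div]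
  have hL : MemLp h 2 μ := hhlaw.gaussian.memLp_two
  have hGm := OneBitChannel.measurable_explicitEstimator γ s φ ξ
  obtain ⟨hint, hmse⟩ := OneBitChannel.integral_norm_sub_mmseEstimator hr hO hpos hL hGm hG
  refine ⟨fun ρ hρ => ⟨hP ρ hρ, (hlaw ρ hρ).1, hG ρ hρ⟩, hL.integrable one_le_two,
    OneBitChannel.condExp_comap_eq hr hO hpos (hL.integrable one_le_two) hGm hG, hint, ?_⟩
  rw [OneBitChannel.mmse, hmse, OneBitChannel.integral_norm_sq_of_isComplexNormal hhlaw, mul_sub,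
    Finset.mul_sum, Finset.mul_sum]
  congr 1
  · norm_num
  · refine Finset.sum_congr rfl fun ρ hρ => ?_
    have hp := (hP ρ hρ).ne'
    -- The weight P(ρ) of the cell cancels one of the two powers of P(ρ), and the factor 1/2 per
    -- dimension turns 4π into 8π.
    have hn : ‖conj s * ((√(γ / (4 * Real.pi * (1 + γ))) : ℝ) : ℂ)
        / (OneBitChannel.probExpr (OneBitChannel.betaC γ φ ξ) ρ : ℂ)‖ ^ 2
        = γ / (4 * Real.pi * (1 + γ)) / OneBitChannel.probExpr (OneBitChannel.betaC γ φ ξ) ρ ^ 2 := by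
      rw [norm_div, norm_mul, RCLike.norm_conj, hs, one_mul, div_pow, Complex.norm_real,
        Complex.norm_real, Real.norm_eq_abs, Real.norm_eq_abs, sq_abs, sq_abs,
        Real.sq_sqrt (by positivity)]
    rw [(hlaw ρ hρ).1, OneBitChannel.explicitEstimator, norm_smul, mul_pow, hn]
    push_cast
    field_simp
    ring
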